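/- Theorem 3.3. Let $(M,g,J)$ be a connected Kähler manifold of real dimension $2n\ge 6$ with Levi-Civita connection $\nabla$, Ricci tensor $\rho$ and Ricci endomorphism $S$ (so $g(SY,Z)=\rho(Y,Z)$). Let $\tau\in C^\infty(M)$ be a special Kähler potential, i.e. $\tau$ is nonconstant, the field $X=J(\nabla\tau)$ is a Killing field, and at every point with $d\tau\ne0$ all nonzero tangent vectors orthogonal to $X$ and $JX$ are eigenvectors of $\nabla d\tau$; assume that $X$ is holomorphic ($L_XJ=0$). Put $U=\{x\in M: d\tau(x)\neq 0\}$, $\mathcal V=\mathrm{span}\{\nabla\tau,J\nabla\tau\}$ and $\mathcal H=\mathcal V^\perp$ on $U$, $T=\nabla X$ (so $TY=\nabla_YX$), $Q=g(\nabla\tau,\nabla\tau)=g(X,X)$, $\psi=g(X,\cdot)$, $d^c\tau=-d\tau\circ J$. Let $\omega_{\mathcal V}(Y,Z)=g(JY_{\mathcal V},Z_{\mathcal V})$ and $\omega_{\mathcal H}(Y,Z)=g(JY_{\mathcal H},Z_{\mathcal H})$, the subscripts denoting orthogonal projections. Let $\Delta=d\delta+\delta d$, so that $\Delta\tau=-\mathrm{tr}_g\nabla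 d\tau$; for a one-form $\alpha$, $d\alpha(Y,Z)=Y(\alpha(Z))-Z(\alpha(Y))-\alpha([Y,Z])$. Then there are functions $\lambda,\Lambda,\mathsf M\in C^\infty(U)$ such that $J\circ T=-\Lambda\,\mathrm{id}$ on $\mathcal V$ and $J\circ T=-\mathsf M\,\mathrm{id}$ on $\mathcal H$ (equivalently, $\nabla d\tau$ has eigenvalue $\Lambda$ on $\mathcal V$ and $\mathsf M$ on $\mathcal H$), and: (a) $SX=\lambda X$ and $d(\Delta\tau)=2\lambda\,d\tau$ on $U$; (b) $[S,T]=0$ and $\nabla_XS=0$ on $M$; (c) $dQ=2\Lambda\,d\tau$ on $U$; (d) $\psi=d^c\tau$, $d\psi(Y,Z)=2g(TY,Z)$ and $\Delta\psi=2\rho(X,\cdot)$ on $M$, and on $U$ one has $\Delta\psi=2\lambda\psi$ and $dd^c\tau=2\Lambda\,\omega_{\mathcal V}+2\mathsf M\,\omega_{\mathcal H}$; (e) $Q\,d\mathsf M=2\mathsf M(\Lambda-\mathsf M)\,d\tau$ on $U$; moreover either $\mathsf M\equiv0$ on $U$, or $\mathsf M$ has no zero in $U$ and there is a constant $c\in\mathbb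 R$ with $Q/\mathsf M=2(\tau-c)$ on $U$. -/

import Mathlib

open Bundle Manifold ContDiff VectorField

noncomputable section

namespace KahlerGeometry

/-! ### Tensor fields on a smooth manifold `M` modelled on a finite-dimensional space `E` -/

section Basics

variable {E : Type*} [NormedAddCommGroup E] [NormedSpace ℝ E]
  {M : Type*} [TopologicalSpace M] [ChartedSpace E M]

instance instFiniteDimensionalTangentSpace [FiniteDimensional ℝ E] (x : M) :
    FiniteDimensional ℝ (TangentSpace 𝓘(ℝ, E) x) := inferInstanceAs (FiniteDimensional ℝ E)

instance instT2SpaceTangentSpace (x : M) :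
    T2Space (TangentSpace 𝓘(ℝ, E) x) := inferInstanceAs (T2Space E)

/-- Vector fields. -/
abbrev VField (E : Type*) [NormedAddCommGroup E] [NormedSpace ℝ E]
    (M : Type*) [TopologicalSpace M] [ChartedSpace E M] :=
  (x : M) → TangentSpace 𝓘(ℝ, E) x

/-- Fields of endomorphisms of the tangent spaces. -/
abbrev EndField (E : Type*) [NormedAddCommGroup E] [NormedSpace ℝ E]
    (M : Type*) [TopologicalSpace M] [ChartedSpace E M] :=
  (x : M) → TangentSpace 𝓘(ℝ, E) x →L[ℝ] TangentSpace 𝓘(ℝ, E) x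

/-- One-forms. -/
abbrev OneForm (E : Type*) [NormedAddCommGroup E] [NormedSpace ℝ E]
    (M : Type*) [TopologicalSpace M] [ChartedSpace E M] :=
  (x : M) → TangentSpace 𝓘(ℝ, E) x →L[ℝ] ℝ

/-- Fields of bilinear forms; used for two-forms. -/
abbrev TwoForm (E : Type*) [NormedAddCommGroup E] [NormedSpace ℝ E]
    (M : Type*) [TopologicalSpace M] [ChartedSpace E M] :=
  (x : M) → TangentSpace 𝓘(ℝ, E) x →L[ℝ] TangentSpace 𝓘(ℝ, E) x →L[ℝ] ℝ

/-- The differential `df` of a real function. -/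
abbrev differential (E : Type*) [NormedAddCommGroup E] [NormedSpace ℝ E]
    {M : Type*} [TopologicalSpace M] [ChartedSpace E M] (f : M → ℝ) : OneForm E M :=
  mvfderiv 𝓘(ℝ, E) f

/-- Smooth Riemannian metrics on `M`. -/
abbrev RMetric (E : Type*) [NormedAddCommGroup E] [NormedSpace ℝ E]
    (M : Type*) [TopologicalSpace M] [ChartedSpace E M] [IsManifold 𝓘(ℝ, E) ∞ M] :=
  ContMDiffRiemannianMetric 𝓘(ℝ, E) ∞ E (fun x : M => TangentSpace 𝓘(ℝ, E) x)

variable [IsManifold 𝓘(ℝ, E) ∞ M]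

lemma endomorphism_ext {x : M} {A B : TangentSpace 𝓘(ℝ, E) x →L[ℝ] TangentSpace 𝓘(ℝ, E) x}
    (h : ∀ V : VField E M, MDiffAt (T% V) x → A (V x) = B (V x)) : A = B := by
  ext v
  simpa using h (FiberBundle.extend E v) (FiberBundle.mdifferentiableAt_extend 𝓘(ℝ, E) E v)

lemma inner_comm_fun (g : RMetric E M) (V W : VField E M) :
    (fun y => g.inner y (V y) (W y)) = fun y => g.inner y (W y) (V y) :=
  funext fun y => g.symm y (V y) (W y)

lemma mdifferentiableAt_inner (g : RMetric E M) {V W : VField E M} {x : M}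
    (hV : MDiffAt (T% V) x) (hW : MDiffAt (T% W) x) :
    MDiffAt (fun y => g.inner y (V y) (W y)) x := by
  have hg := (g.contMDiff x).mdifferentiableAt (by simp)
  have h : MDifferentiableAt 𝓘(ℝ, E) (𝓘(ℝ, E).prod 𝓘(ℝ, ℝ))
      (fun m => TotalSpace.mk' ℝ (E := Bundle.Trivial M ℝ) m (g.inner m (V m) (W m))) x :=
    MDifferentiableAt.clm_bundle_apply₂ (F₁ := E) (F₂ := E) hg hV hW
  exact ((mdifferentiableAt_totalSpace _ _).1 h).2

lemma mvfderiv_inner_smul_left (g : RMetric E M) {f : M → ℝ} {V W : VField E M} {x : M}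
    (hf : MDiffAt f x) (hV : MDiffAt (T% V) x) (hW : MDiffAt (T% W) x)
    (v : TangentSpace 𝓘(ℝ, E) x) :
    mvfderiv 𝓘(ℝ, E) (fun y => g.inner y ((f • V) y) (W y)) x v
      = f x * mvfderiv 𝓘(ℝ, E) (fun y => g.inner y (V y) (W y)) x v
        + g.inner x (V x) (W x) * mvfderiv 𝓘(ℝ, E) f x v := by
  have h : (fun y => g.inner y ((f • V) y) (W y))
      = f * (fun y => g.inner y (V y) (W y)) := by
    ext y; simp
  rw [h, mvfderiv_mul hf (mdifferentiableAt_inner g hV hW)]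
  simp

lemma mvfderiv_inner_add_left (g : RMetric E M) {V V' W : VField E M} {x : M}
    (hV : MDiffAt (T% V) x) (hV' : MDiffAt (T% V') x) (hW : MDiffAt (T% W) x) :
    mvfderiv 𝓘(ℝ, E) (fun y => g.inner y ((V + V') y) (W y)) x
      = mvfderiv 𝓘(ℝ, E) (fun y => g.inner y (V y) (W y)) x
        + mvfderiv 𝓘(ℝ, E) (fun y => g.inner y (V' y) (W y)) x := by
  have h : (fun y => g.inner y ((V + V') y) (W y))
      = (fun y => g.inner y (V y) (W y)) + (fun y => g.inner y (V' y) (W y)) := by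
    ext y; simp
  rw [h, mvfderiv_add (mdifferentiableAt_inner g hV hW) (mdifferentiableAt_inner g hV' hW)]

end Basics

variable {E : Type*} [NormedAddCommGroup E] [NormedSpace ℝ E] [FiniteDimensional ℝ E]
  {M : Type*} [TopologicalSpace M] [ChartedSpace E M] [IsManifold 𝓘(ℝ, E) ∞ M]

/-! ### Musical isomorphisms and the gradient -/

/-- The isomorphism `v ↦ g(v, ·)`. -/
def flat (g : RMetric E M) (x : M) :
    TangentSpace 𝓘(ℝ, E) x ≃ₗ[ℝ] (TangentSpace 𝓘(ℝ, E) x →L[ℝ] ℝ) :=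
  LinearMap.linearEquivOfInjective (g.inner x).toLinearMap
    (by
      rw [← LinearMap.ker_eq_bot, LinearMap.ker_eq_bot']
      intro v hv
      by_contra hne
      have h := g.pos x v hne
      have h0 : g.inner x v = 0 := hv
      rw [h0] at h
      simp at h)
    (by
      rw [← (LinearMap.toContinuousLinearMap (𝕜 := ℝ) (E := TangentSpace 𝓘(ℝ, E) x)
        (F' := ℝ)).finrank_eq]
      exact (Subspace.dual_finrank_eq (K := ℝ) (V := TangentSpace 𝓘(ℝ, E) x)).symm)

/-- The inverse isomorphism: `g(α♯, v) = α(v)`. -/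
def sharp (g : RMetric E M) (x : M) :
    (TangentSpace 𝓘(ℝ, E) x →L[ℝ] ℝ) →L[ℝ] TangentSpace 𝓘(ℝ, E) x :=
  LinearMap.toContinuousLinearMap (flat g x).symm.toLinearMap

lemma inner_sharp (g : RMetric E M) (x : M) (α : TangentSpace 𝓘(ℝ, E) x →L[ℝ] ℝ)
    (v : TangentSpace 𝓘(ℝ, E) x) : g.inner x (sharp g x α) v = α v := by
  have h : flat g x ((flat g x).symm α) = α := (flat g x).apply_symm_apply α
  exact congrArg (fun β : TangentSpace 𝓘(ℝ, E) x →L[ℝ] ℝ => β v) h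

lemma eq_of_inner_eq (g : RMetric E M) {x : M} {v w : TangentSpace 𝓘(ℝ, E) x}
    (h : ∀ Z : VField E M, MDiffAt (T% Z) x → g.inner x v (Z x) = g.inner x w (Z x)) : v = w := by
  apply (flat g x).injective
  ext z
  simpa using! h (FiberBundle.extend E z) (FiberBundle.mdifferentiableAt_extend 𝓘(ℝ, E) E z)

/-- The gradient `∇f`. -/
def grad (g : RMetric E M) (f : M → ℝ) : VField E M :=
  fun x => sharp g x (differential E f x)

/-! ### The Levi-Civita connection -/

/-- The right-hand side of the Koszul formula for `2 g(∇_V Y, Z)`. -/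
def koszul (g : RMetric E M) (Y V Z : VField E M) (x : M) : ℝ :=
  mvfderiv 𝓘(ℝ, E) (fun y => g.inner y (Y y) (Z y)) x (V x)
    + mvfderiv 𝓘(ℝ, E) (fun y => g.inner y (V y) (Z y)) x (Y x)
    - mvfderiv 𝓘(ℝ, E) (fun y => g.inner y (V y) (Y y)) x (Z x)
    + g.inner x (mlieBracket 𝓘(ℝ, E) V Y x) (Z x)
    - g.inner x (mlieBracket 𝓘(ℝ, E) V Z x) (Y x)
    - g.inner x (mlieBracket 𝓘(ℝ, E) Y Z x) (V x)

lemma koszul_tensorial_left (g : RMetric E M) {Y Z : VField E M} {x : M}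
    (hY : MDiffAt (T% Y) x) (hZ : MDiffAt (T% Z) x) :
    TensorialAt 𝓘(ℝ, E) E (fun V : VField E M => koszul g Y V Z x) x where
  smul {f V} hf hV := by
    have := FiniteDimensional.complete ℝ E
    simp only [koszul, mvfderiv_inner_smul_left g hf hV hZ, mvfderiv_inner_smul_left g hf hV hY,
      mlieBracket_smul_left hf hV]
    simp
    ring
  add {V V'} hV hV' := by
    have := FiniteDimensional.complete ℝ E
    simp only [koszul, mvfderiv_inner_add_left g hV hV' hZ, mvfderiv_inner_add_left g hV hV' hY,
      mlieBracket_add_left hV hV']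
    simp
    ring

lemma koszul_tensorial_right (g : RMetric E M) {Y V : VField E M} {x : M}
    (hY : MDiffAt (T% Y) x) (hV : MDiffAt (T% V) x) :
    TensorialAt 𝓘(ℝ, E) E (fun Z : VField E M => koszul g Y V Z x) x where
  smul {f Z} hf hZ := by
    have := FiniteDimensional.complete ℝ E
    simp only [koszul, inner_comm_fun g Y, inner_comm_fun g V (f • Z), inner_comm_fun g V Z,
      mvfderiv_inner_smul_left g hf hZ hV, mvfderiv_inner_smul_left g hf hZ hY,
      mlieBracket_smul_right hf hZ]
    simp [g.symm x (Z x)]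
    ring
  add {Z Z'} hZ hZ' := by
    have := FiniteDimensional.complete ℝ E
    simp only [koszul, inner_comm_fun g Y, inner_comm_fun g V (Z + Z'), inner_comm_fun g V Z,
      inner_comm_fun g V Z', mvfderiv_inner_add_left g hZ hZ' hV,
      mvfderiv_inner_add_left g hZ hZ' hY, mlieBracket_add_right hZ hZ']
    simp
    ring

open Classical in
/-- `nabla g Y x v` is `∇_v Y`, given by the Koszul formula wherever `Y` is differentiable
(and `0` by convention elsewhere). -/
def nabla (g : RMetric E M) (Y : VField E M) : EndField E M := fun x =>
  if hY : MDiffAt (T% Y) x then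
    (sharp g x).comp ((1 / 2 : ℝ) • TensorialAt.mkHom₂ (fun V Z : VField E M => koszul g Y V Z x) x
      (fun _ hZ => koszul_tensorial_left g hY hZ) (fun _ hV => koszul_tensorial_right g hY hV))
  else 0

lemma inner_nabla (g : RMetric E M) {Y V Z : VField E M} {x : M}
    (hY : MDiffAt (T% Y) x) (hV : MDiffAt (T% V) x) (hZ : MDiffAt (T% Z) x) :
    g.inner x (nabla g Y x (V x)) (Z x) = 1 / 2 * koszul g Y V Z x := by
  simp only [nabla, hY, dif_pos, ContinuousLinearMap.comp_apply, inner_sharp]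
  have := TensorialAt.mkHom₂_apply (Φ := fun V Z : VField E M => koszul g Y V Z x)
    (fun _ hZ => koszul_tensorial_left g hY hZ) (fun _ hV => koszul_tensorial_right g hY hV) hV hZ
  simp [this]

/-- The Levi-Civita connection of `g`: `leviCivita g Y x v` is `∇_v Y`. -/
def leviCivita (g : RMetric E M) :
    CovariantDerivative 𝓘(ℝ, E) E (fun x : M => TangentSpace 𝓘(ℝ, E) x) where
  toFun := nabla g
  isCovariantDerivativeOnUniv :=
    { add := by
        intro Y Y' x hY hY' _
        have := FiniteDimensional.complete ℝ E
        have hYY := mdifferentiableAt_add_section hY hY'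
        refine endomorphism_ext fun V hV => eq_of_inner_eq g fun Z hZ => ?_
        rw [inner_nabla g hYY hV hZ]
        simp only [add_apply, map_add, inner_nabla g hY hV hZ, inner_nabla g hY' hV hZ]
        simp only [koszul, inner_comm_fun g V (Y + Y'), inner_comm_fun g V Y,
          inner_comm_fun g V Y', mvfderiv_inner_add_left g hY hY' hZ,
          mvfderiv_inner_add_left g hY hY' hV, mlieBracket_add_left hY hY',
          mlieBracket_add_right hY hY']
        simp
        ring
      leibniz := by
        intro Y f x hY hf _
        have := FiniteDimensional.complete ℝ E
        have hfY := hf.smul_section hY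
        refine endomorphism_ext fun V hV => eq_of_inner_eq g fun Z hZ => ?_
        rw [inner_nabla g hfY hV hZ]
        simp only [add_apply, smul_apply, map_add, map_smul,
          ContinuousLinearMap.smulRight_apply, inner_nabla g hY hV hZ]
        simp only [koszul, inner_comm_fun g V (f • Y), inner_comm_fun g V Y,
          mvfderiv_inner_smul_left g hf hY hZ, mvfderiv_inner_smul_left g hf hY hV,
          mlieBracket_smul_left hf hY, mlieBracket_smul_right hf hY]
        simp [g.symm x (Y x) (V x)]
        ring }

/-- The connection is torsion-free. -/
theorem leviCivita_torsion_free (g : RMetric E M) {V Y : VField E M} {x : M}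
    (hV : MDiffAt (T% V) x) (hY : MDiffAt (T% Y) x) :
    leviCivita g Y x (V x) - leviCivita g V x (Y x) = mlieBracket 𝓘(ℝ, E) V Y x := by
  refine eq_of_inner_eq g fun Z hZ => ?_
  have h1 : g.inner x (leviCivita g Y x (V x)) (Z x) = _ := inner_nabla g hY hV hZ
  have h2 : g.inner x (leviCivita g V x (Y x)) (Z x) = _ := inner_nabla g hV hY hZ
  simp only [map_sub, sub_apply, h1, h2]
  simp only [koszul, inner_comm_fun g Y V]
  rw [mlieBracket_swap_apply (V := Y) (W := V)]
  simp
  ring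

/-- The connection is metric. -/
theorem leviCivita_metric (g : RMetric E M) {V Y Z : VField E M} {x : M}
    (hV : MDiffAt (T% V) x) (hY : MDiffAt (T% Y) x) (hZ : MDiffAt (T% Z) x) :
    mvfderiv 𝓘(ℝ, E) (fun y => g.inner y (Y y) (Z y)) x (V x)
      = g.inner x (leviCivita g Y x (V x)) (Z x) + g.inner x (Y x) (leviCivita g Z x (V x)) := by
  have h1 : g.inner x (leviCivita g Y x (V x)) (Z x) = _ := inner_nabla g hY hV hZ
  have h2 : g.inner x (leviCivita g Z x (V x)) (Y x) = _ := inner_nabla g hZ hV hY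
  rw [g.symm x (Y x), h1, h2]
  simp only [koszul, inner_comm_fun g Z Y, inner_comm_fun g V Z]
  rw [mlieBracket_swap_apply (V := Z) (W := Y)]
  simp
  ring

/-- The Hessian `H(v, w) = (∇df)(v, w) = g(∇_v ∇f, w)`. -/
def hessian (g : RMetric E M) (f : M → ℝ) (x : M) (v w : TangentSpace 𝓘(ℝ, E) x) : ℝ :=
  g.inner x (leviCivita g (grad g f) x v) w

/-- The covariant derivative of a field `A` of endomorphisms:
`(∇_v A) w = ∇_v (A W) - A (∇_v W)`, where `W` is a vector field near `x` with `W x = w`. -/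
def covDerivEnd (g : RMetric E M) (A : EndField E M) (x : M) (v w : TangentSpace 𝓘(ℝ, E) x) :
    TangentSpace 𝓘(ℝ, E) x :=
  leviCivita g (fun y => A y (FiberBundle.extend E w y)) x v
    - A x (leviCivita g (FiberBundle.extend E w) x v)

/-- The covariant derivative of a two-form `β`:
`(∇_u β)(v, w) = u (β(V, W)) - β(∇_u V, w) - β(v, ∇_u W)`, where `V`, `W` are vector fields
near `x` with `V x = v`, `W x = w`. -/
def covDerivTwoForm (g : RMetric E M) (β : TwoForm E M) (x : M)
    (u v w : TangentSpace 𝓘(ℝ, E) x) : ℝ :=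
  mvfderiv 𝓘(ℝ, E) (fun y => β y (FiberBundle.extend E v y) (FiberBundle.extend E w y)) x u
    - β x (leviCivita g (FiberBundle.extend E v) x u) w
    - β x v (leviCivita g (FiberBundle.extend E w) x u)

/-! ### Curvature -/

/-- The curvature tensor `R(u, v) w = ∇_U ∇_V W - ∇_V ∇_U W - ∇_[U, V] W` at `x`, where
`U`, `V`, `W` are vector fields, smooth near `x`, with values `u`, `v`, `w` at `x`. -/
def curvature (g : RMetric E M) (x : M) (u v w : TangentSpace 𝓘(ℝ, E) x) :
    TangentSpace 𝓘(ℝ, E) x :=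
  letI U : VField E M := FiberBundle.extend E u
  letI V : VField E M := FiberBundle.extend E v
  letI W : VField E M := FiberBundle.extend E w
  leviCivita g (fun y => leviCivita g W y (V y)) x u
    - leviCivita g (fun y => leviCivita g W y (U y)) x v
    - leviCivita g W x (mlieBracket 𝓘(ℝ, E) U V x)

/-- A basis of the tangent space, used to write traces. -/
def tangentBasis (x : M) :
    Module.Basis (Fin (Module.finrank ℝ (TangentSpace 𝓘(ℝ, E) x))) ℝ (TangentSpace 𝓘(ℝ, E) x) :=
  Module.finBasis ℝ (TangentSpace 𝓘(ℝ, E) x)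

/-- The Ricci tensor `ρ(v, w) = trace (u ↦ R(u, v) w)`: its components with respect to a basis
`b` are `ρ(b_j, b_k) = ∑ i, b^i (R(b_i, b_j) b_k)`. -/
def ricci (g : RMetric E M) (x : M) : LinearMap.BilinForm ℝ (TangentSpace 𝓘(ℝ, E) x) :=
  Matrix.toBilin (tangentBasis x) (Matrix.of fun j k =>
    ∑ i, (tangentBasis x).coord i
      (curvature g x (tangentBasis x i) (tangentBasis x j) (tangentBasis x k)))

/-- The Ricci endomorphism `S`, with `g(S v, w) = ρ(v, w)`. -/
def ricciEnd (g : RMetric E M) : EndField E M := fun x =>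
  LinearMap.toContinuousLinearMap
    ((sharp g x).toLinearMap ∘ₗ
      (LinearMap.toContinuousLinearMap (𝕜 := ℝ) (E := TangentSpace 𝓘(ℝ, E) x)
        (F' := ℝ)).toLinearMap ∘ₗ ricci g x)

lemma inner_ricciEnd (g : RMetric E M) (x : M) (v w : TangentSpace 𝓘(ℝ, E) x) :
    g.inner x (ricciEnd g x v) w = ricci g x v w :=
  inner_sharp g x _ w

/-! ### Exterior derivative, codifferential, Laplacian -/

/-- A one-form is differentiable at `x` if its pairing with each vector field that is
differentiable at `x` is differentiable at `x`. -/
def OneFormDifferentiableAt (α : OneForm E M) (x : M) : Prop :=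
  ∀ Y : VField E M, MDiffAt (T% Y) x → MDiffAt (fun y => α y (Y y)) x

/-- `U (α(V)) - V (α(U)) - α([U, V])`. -/
def extDerivAux (α : OneForm E M) (U V : VField E M) (x : M) : ℝ :=
  mvfderiv 𝓘(ℝ, E) (fun y => α y (V y)) x (U x)
    - mvfderiv 𝓘(ℝ, E) (fun y => α y (U y)) x (V x)
    - α x (mlieBracket 𝓘(ℝ, E) U V x)

lemma extDerivAux_swap (α : OneForm E M) (U V : VField E M) (x : M) :
    extDerivAux α U V x = - extDerivAux α V U x := by
  simp only [extDerivAux]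
  rw [mlieBracket_swap_apply (V := U) (W := V)]
  simp
  ring

lemma extDerivAux_tensorial_left {α : OneForm E M} {V : VField E M} {x : M}
    (hα : OneFormDifferentiableAt α x) :
    TensorialAt 𝓘(ℝ, E) E (fun U : VField E M => extDerivAux α U V x) x where
  smul {f U} hf hU := by
    have := FiniteDimensional.complete ℝ E
    have h : (fun y => α y ((f • U) y)) = f * fun y => α y (U y) := by
      ext y; simp
    simp only [extDerivAux, h, mvfderiv_mul hf (hα U hU), mlieBracket_smul_left hf hU]
    simp
    ring
  add {U U'} hU hU' := by
    have := FiniteDimensional.complete ℝ E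
    have h : (fun y => α y ((U + U') y)) = (fun y => α y (U y)) + fun y => α y (U' y) := by
      ext y; simp
    simp only [extDerivAux, h, mvfderiv_add (hα U hU) (hα U' hU'), mlieBracket_add_left hU hU']
    simp
    ring

lemma extDerivAux_tensorial_right {α : OneForm E M} {U : VField E M} {x : M}
    (hα : OneFormDifferentiableAt α x) :
    TensorialAt 𝓘(ℝ, E) E (fun V : VField E M => extDerivAux α U V x) x where
  smul {f V} hf hV := by
    have h := (extDerivAux_tensorial_left (V := U) hα).smul hf hV
    simp only [extDerivAux_swap α U]
    rw [h]
    simp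
  add {V V'} hV hV' := by
    have h := (extDerivAux_tensorial_left (V := U) hα).add hV hV'
    simp only [extDerivAux_swap α U]
    rw [h]
    ring

open Classical in
/-- The exterior derivative of a one-form,
`dα(U, V) = U (α(V)) - V (α(U)) - α([U, V])`, wherever `α` is differentiable
(and `0` by convention elsewhere). -/
def extDerivOneForm (α : OneForm E M) : TwoForm E M := fun x =>
  if hα : OneFormDifferentiableAt α x then
    TensorialAt.mkHom₂ (fun U V : VField E M => extDerivAux α U V x) x
      (fun _ _ => extDerivAux_tensorial_left hα)
      (fun _ _ => extDerivAux_tensorial_right hα)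
  else 0

/-- The codifferential of a one-form, `δα = - tr (v ↦ ∇_v α♯)`. -/
def codiffOneForm (g : RMetric E M) (α : OneForm E M) : M → ℝ := fun x =>
  - LinearMap.trace ℝ (TangentSpace 𝓘(ℝ, E) x)
      (leviCivita g (fun y => sharp g y (α y)) x).toLinearMap

/-- The codifferential of a two-form, `(δβ)(w) = - ∑ i, (∇_{b_i} β)((b^i)♯, w)` for a basis `b`
of the tangent space; for an orthonormal basis `e` this is `- ∑ i, (∇_{e_i} β)(e_i, w)`. -/
def codiffTwoForm (g : RMetric E M) (β : TwoForm E M) (x : M) (w : TangentSpace 𝓘(ℝ, E) x) : ℝ :=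
  - ∑ i, covDerivTwoForm g β x (tangentBasis x i)
      (sharp g x (LinearMap.toContinuousLinearMap ((tangentBasis x).coord i))) w

/-- The (nonnegative) Laplacian of a function, `Δf = δ df = - tr_g ∇df`. -/
def laplacian (g : RMetric E M) (f : M → ℝ) : M → ℝ :=
  codiffOneForm g (differential E f)

/-- The Hodge Laplacian of a one-form, `Δα = d δα + δ dα`. -/
def hodgeLaplacian (g : RMetric E M) (α : OneForm E M) (x : M) (w : TangentSpace 𝓘(ℝ, E) x) : ℝ :=
  differential E (codiffOneForm g α) x w + codiffTwoForm g (extDerivOneForm α) x w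

/-- `X` is a Killing field: `g(∇_v X, w) + g(v, ∇_w X) = 0`. -/
def IsKilling (g : RMetric E M) (X : VField E M) : Prop :=
  ∀ (x : M) (v w : TangentSpace 𝓘(ℝ, E) x),
    g.inner x (leviCivita g X x v) w + g.inner x v (leviCivita g X x w) = 0

/-! ### Kähler manifolds and special Kähler potentials -/

/-- A Kähler structure `(g, J)` on `M`: a smooth Riemannian metric and a smooth orthogonal almost
complex structure that is parallel for the Levi-Civita connection, `∇_v (J Y) = J (∇_v Y)`. -/
structure KahlerStructure (E : Type*) [NormedAddCommGroup E] [NormedSpace ℝ E]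
    [FiniteDimensional ℝ E] (M : Type*) [TopologicalSpace M] [ChartedSpace E M]
    [IsManifold 𝓘(ℝ, E) ∞ M] where
  g : RMetric E M
  J : EndField E M
  J_smooth : ContMDiff 𝓘(ℝ, E) (𝓘(ℝ, E).prod 𝓘(ℝ, E →L[ℝ] E)) ∞
    (fun x : M => TotalSpace.mk' (E →L[ℝ] E)
      (E := fun x : M => TangentSpace 𝓘(ℝ, E) x →L[ℝ] TangentSpace 𝓘(ℝ, E) x) x (J x))
  J_sq : ∀ (x : M) (v : TangentSpace 𝓘(ℝ, E) x), J x (J x v) = -v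
  J_orthogonal : ∀ (x : M) (v w : TangentSpace 𝓘(ℝ, E) x),
    g.inner x (J x v) (J x w) = g.inner x v w
  J_parallel : ∀ (x : M) (Y : VField E M), MDiffAt (T% Y) x → ∀ v : TangentSpace 𝓘(ℝ, E) x,
    leviCivita g (fun y => J y (Y y)) x v = J x (leviCivita g Y x v)

namespace KahlerStructure

variable (K : KahlerStructure E M)

/-- The field `J∇τ`. -/
def Jgrad (τ : M → ℝ) : VField E M := fun x => K.J x (grad K.g τ x)

/-- `X` is holomorphic: `L_X J = 0`, that is, `[X, J Y] = J [X, Y]`. -/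
def IsHolomorphicField (X : VField E M) : Prop :=
  ∀ (x : M) (Y : VField E M), MDiffAt (T% Y) x →
    mlieBracket 𝓘(ℝ, E) X (fun y => K.J y (Y y)) x = K.J x (mlieBracket 𝓘(ℝ, E) X Y x)

/-- A special Kähler potential: a nonconstant smooth function `τ` such that `X = J∇τ` is a Killing
field and, where `dτ ≠ 0`, each nonzero tangent vector orthogonal to `X` and `J X` is an
eigenvector of `∇dτ`. -/
structure IsSpecialKahlerPotential (τ : M → ℝ) : Prop where
  smooth : ContMDiff 𝓘(ℝ, E) 𝓘(ℝ, ℝ) ∞ τ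
  nonconstant : ¬ ∃ c : ℝ, ∀ x, τ x = c
  killing : IsKilling K.g (K.Jgrad τ)
  eigenvector : ∀ x, differential E τ x ≠ 0 → ∀ v : TangentSpace 𝓘(ℝ, E) x, v ≠ 0 →
    K.g.inner x v (K.Jgrad τ x) = 0 → K.g.inner x v (K.J x (K.Jgrad τ x)) = 0 →
    ∃ μ : ℝ, ∀ w, hessian K.g τ x v w = μ * K.g.inner x v w

/-- `U = {x | dτ(x) ≠ 0}`. -/
def regularSet (_K : KahlerStructure E M) (τ : M → ℝ) : Set M :=
  {x | differential E τ x ≠ 0}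

/-- `Q = g(∇τ, ∇τ)`. -/
def normSqGrad (τ : M → ℝ) : M → ℝ := fun x => K.g.inner x (grad K.g τ x) (grad K.g τ x)

/-- The subspace `𝒱 = span {∇τ, J∇τ}` of the tangent space at `x`. -/
def vertical (τ : M → ℝ) (x : M) : Submodule ℝ (TangentSpace 𝓘(ℝ, E) x) :=
  Submodule.span ℝ {grad K.g τ x, K.Jgrad τ x}

/-- The orthogonal complement `ℋ` of `𝒱`. -/
def horizontal (τ : M → ℝ) (x : M) : Set (TangentSpace 𝓘(ℝ, E) x) :=
  {v | ∀ w ∈ K.vertical τ x, K.g.inner x v w = 0}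

/-- The orthogonal projection onto `𝒱` at the points where `dτ ≠ 0`; there `∇τ` and `J∇τ` form an
orthogonal basis of `𝒱`, both of squared length `Q`. -/
def projV (τ : M → ℝ) (x : M) (v : TangentSpace 𝓘(ℝ, E) x) : TangentSpace 𝓘(ℝ, E) x :=
  (K.g.inner x v (grad K.g τ x) / K.normSqGrad τ x) • grad K.g τ x
    + (K.g.inner x v (K.Jgrad τ x) / K.normSqGrad τ x) • K.Jgrad τ x

/-- The orthogonal projection onto `ℋ` at the points where `dτ ≠ 0`. -/
def projH (τ : M → ℝ) (x : M) (v : TangentSpace 𝓘(ℝ, E) x) : TangentSpace 𝓘(ℝ, E) x :=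
  v - K.projV τ x v

/-- The Kähler form `ω_𝒱(v, w) = g(J v_𝒱, w_𝒱)` of `𝒱`. -/
def omegaV (τ : M → ℝ) (x : M) (v w : TangentSpace 𝓘(ℝ, E) x) : ℝ :=
  K.g.inner x (K.J x (K.projV τ x v)) (K.projV τ x w)

/-- The Kähler form `ω_ℋ(v, w) = g(J v_ℋ, w_ℋ)` of `ℋ`. -/
def omegaH (τ : M → ℝ) (x : M) (v w : TangentSpace 𝓘(ℝ, E) x) : ℝ :=
  K.g.inner x (K.J x (K.projH τ x v)) (K.projH τ x w)

/-- `d^c τ = - dτ ∘ J`. -/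
def dc (τ : M → ℝ) : OneForm E M := fun x => -((differential E τ x).comp (K.J x))

end KahlerStructure

end KahlerGeometry

end

/-! Write `H` for the Hessian endomorphism of `τ` (`hessEnd`). As `J` is parallel, `T = JH`. The
Killing equation makes `JH` skew, and `H` is symmetric, so `H` commutes with `J` (`hessEnd_J`). On
`ℋ` every nonzero vector is an eigenvector, so `H` is a scalar `M` there; it preserves `𝒱`, and a
symmetric map of a plane commuting with `J` is a scalar `Λ`.

The differential identities come from Kostant's identity `∇²_{U,V} X = R(U, X)V`
(`IsKilling.secondNab_eq`), which expresses the derivative of `H` as `-J R(u, X)v`. Tracing it gives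
`d(Δτ) = 2ρ(∇τ, ·)`, and for the dual form `Δψ = 2ρ(X, ·)`. Differentiating the eigenvalue equations
of `H` expresses curvature components through `dΛ` and `dM`. Confronted with the skew symmetries,
with `R(Ju, Jv) = R(u, v)` and with the first Bianchi identity, these components force `dΛ` and `dM`
to be multiples of `dτ` and yield `dM(∇τ) = 2M(Λ - M)`. Since `Δτ = -2Λ - (2n-2)M` on `U`, the form
`ρ(∇τ, ·)` is a multiple of `dτ`; hence `∇τ`, and by `J`-invariance `X`, are Ricci eigenvectors with
one eigenvalue `λ`. Then `S` preserves `ℋ` and commutes with `T`, which is `ΛJ` on `𝒱` and `MJ` on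
`ℋ`. The flow of a Killing field preserves `ρ`, whence `∇_X S = [T, S] = 0`. At critical points the
commutation follows from density of `U`.

The final dichotomy is global and needs `U` to be connected. The components of a Killing field and
of its derivative solve a closed linear first order system, so a Killing field with `X = 0` and `∇X
= 0` at one point vanishes identically. Therefore `H ≠ 0` at each critical point of `τ`, and `U` is
dense. If `A = Hv ≠ 0` at a critical point, the functions `g(∇τ, A)` and `g(∇τ, JA)` have
independent differentials there, so the critical set lies locally in a submanifold of codimension
two, which does not disconnect. On the connected set `U` the equation `Q dM = 2M(Λ - M)dτ`, linear
in `M` with the other factor as coefficient, makes `M` vanish everywhere or nowhere; in the second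
case it combines with `dQ = 2Λ dτ` to `d(Q/M) = 2dτ`. -/

noncomputable section

set_option linter.unusedSectionVars false

namespace KahlerGeometry

open Topology

/-! ### Global smooth vector fields, cut-off frames and tensoriality -/

section SmoothSections

variable {E : Type*} [NormedAddCommGroup E] [NormedSpace ℝ E] [FiniteDimensional ℝ E]
  {M : Type*} [TopologicalSpace M] [ChartedSpace E M] [IsManifold 𝓘(ℝ, E) ∞ M]

/-- Global smooth vector fields. -/
abbrev Sec (E : Type*) [NormedAddCommGroup E] [NormedSpace ℝ E]
    (M : Type*) [TopologicalSpace M] [ChartedSpace E M] [IsManifold 𝓘(ℝ, E) ∞ M] :=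
  ContMDiffSection 𝓘(ℝ, E) E ∞ (fun x : M => TangentSpace 𝓘(ℝ, E) x)

namespace Sec

variable (Y : Sec E M) (x : M)

lemma mdiffAt : MDiffAt (T% fun y => Y y) x := Y.contMDiff.mdifferentiableAt (by simp)

@[simp] lemma add_apply (Y Z : Sec E M) (x : M) : (Y + Z) x = Y x + Z x := rfl
@[simp] lemma sub_apply (Y Z : Sec E M) (x : M) : (Y - Z) x = Y x - Z x := rfl
@[simp] lemma neg_apply (Y : Sec E M) (x : M) : (-Y) x = -Y x := rfl

/-- The product of a smooth function and a smooth vector field. -/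
def fsmul (f : M → ℝ) (hf : ContMDiff 𝓘(ℝ, E) 𝓘(ℝ, ℝ) ∞ f) (Y : Sec E M) : Sec E M :=
  ⟨f • fun y => Y y, hf.smul_section Y.contMDiff⟩

@[simp] lemma fsmul_apply (f : M → ℝ) (hf : ContMDiff 𝓘(ℝ, E) 𝓘(ℝ, ℝ) ∞ f) (Y : Sec E M) (x : M) :
    fsmul f hf Y x = f x • Y x := rfl

lemma sum_apply {ι : Type*} (s : Finset ι) (Y : ι → Sec E M) (x : M) :
    (∑ i ∈ s, Y i) x = ∑ i ∈ s, Y i x := by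
  classical
  induction s using Finset.induction_on with
  | empty => simp
  | insert a s ha ih => simp [Finset.sum_insert ha, ih]

end Sec

/-- A smooth frame near `x` with its dual coframe, both cut off to be globally smooth. Near `x`,
the coframe is the differential of the coordinates of the preferred chart at `x` with respect to
the basis `b` of the model space. -/
structure CutoffFrame {ι : Type*} [Fintype ι] (b : Module.Basis ι ℝ E) (x : M) where
  χ : M → ℝ
  e : ι → Sec E M
  θ : ι → OneForm E M
  χ_smooth : ContMDiff 𝓘(ℝ, E) 𝓘(ℝ, ℝ) ∞ χ
  χ_one : ∀ᶠ y in 𝓝 x, χ y = 1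
  sum_smul : ∀ (y : M) (v : TangentSpace 𝓘(ℝ, E) y), ∑ i, θ i y v • e i y = (χ y) ^ 2 • v
  θ_smooth : ∀ (i : ι) (Y : Sec E M), ContMDiff 𝓘(ℝ, E) 𝓘(ℝ, ℝ) ∞ (fun y => θ i y (Y y))
  dual : ∀ᶠ y in 𝓝 x, ∀ i, ∀ c : ι → ℝ, θ i y (∑ j, c j • e j y) = c i
  θ_eq : ∀ᶠ y in 𝓝 x, ∀ (i : ι) (v : TangentSpace 𝓘(ℝ, E) y),
    θ i y v = b.repr (mfderiv 𝓘(ℝ, E) 𝓘(ℝ, E) (extChartAt 𝓘(ℝ, E) x) y v) i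

variable [T2Space M]

lemma exists_sec_eventuallyEq (x : M) (Y : VField E M) {u : Set M} (hu : IsOpen u) (hx : x ∈ u)
    (hY : ContMDiffOn 𝓘(ℝ, E) 𝓘(ℝ, E).tangent ∞ (T% Y) u) :
    ∃ Z : Sec E M, ∀ᶠ y in 𝓝 x, Z y = Y y := by
  obtain ⟨f, -, hf⟩ := (SmoothBumpFunction.nhds_basis_tsupport (I := 𝓘(ℝ, E)) x).mem_iff.1
    (hu.mem_nhds hx)
  refine ⟨⟨(f : M → ℝ) • Y,
    ContMDiffOn.smul_section_of_tsupport f.contMDiff.contMDiffOn hu hf hY⟩, ?_⟩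
  filter_upwards [f.eventuallyEq_one] with y hy
  simp [hy]

/-- The pointwise tensors are defined through local extensions that need not be globally smooth; a
global field with the same germ allows them to be computed with global sections. -/
lemma exists_sec_extend (x : M) (v : TangentSpace 𝓘(ℝ, E) x) :
    ∃ Y : Sec E M, ∀ᶠ y in 𝓝 x, Y y = FiberBundle.extend E v y := by
  obtain ⟨s, hs, h⟩ := FiberBundle.exists_contMDiffOn_extend (k := ∞) 𝓘(ℝ, E) E v
  obtain ⟨u, hus, hu, hx⟩ := mem_nhds_iff.1 hs
  exact exists_sec_eventuallyEq x _ hu hx (h.mono hus)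

lemma exists_sec_apply_eq (x : M) (v : TangentSpace 𝓘(ℝ, E) x) : ∃ Y : Sec E M, Y x = v := by
  obtain ⟨Y, hY⟩ := exists_sec_extend x v
  exact ⟨Y, by simpa using hY.self_of_nhds⟩

/-- The local frame of the tangent trivialization at `x` and its dual are each multiplied by a bump
function supported in the base set. Frame and coframe both carry the factor, which is why `χ ^ 2`
appears in their contraction. -/
lemma nonempty_cutoffFrame {ι : Type*} [Fintype ι] (b : Module.Basis ι ℝ E) (x : M) :
    Nonempty (CutoffFrame b x) := by
  set t := trivializationAt E (TangentSpace 𝓘(ℝ, E) : M → Type _) x with ht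
  have hbase : t.baseSet = (chartAt E x).source := TangentBundle.trivializationAt_baseSet x
  have hx : x ∈ t.baseSet := FiberBundle.mem_baseSet_trivializationAt' x
  obtain ⟨f, -, hf⟩ := (SmoothBumpFunction.nhds_basis_tsupport (I := 𝓘(ℝ, E)) x).mem_iff.1
    (t.open_baseSet.mem_nhds hx)
  have h0 : ∀ y, y ∉ t.baseSet → f y = 0 := fun y hy =>
    image_eq_zero_of_notMem_tsupport fun h => hy (hf h)
  refine ⟨{ χ := f, e := fun i => ⟨(f : M → ℝ) • t.localFrame b i,
              ContMDiffOn.smul_section_of_tsupport f.contMDiff.contMDiffOn t.open_baseSet hf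
                (t.contMDiffOn_localFrame_baseSet _ b i)⟩
            θ := fun i y => f y • LinearMap.toContinuousLinearMap
              (t.localFrameCoeff 𝓘(ℝ, E) b i y)
            χ_smooth := f.contMDiff
            χ_one := f.eventuallyEq_one
            sum_smul := ?_
            θ_smooth := ?_
            dual := ?_
            θ_eq := ?_ }⟩
  · intro y v
    by_cases hy : y ∈ t.baseSet
    · have h := t.eq_sum_localFrameCoeff_smul (I := 𝓘(ℝ, E)) (b := b)
        (s := fun z => FiberBundle.extend E v z) hy
      simp only [FiberBundle.extend_apply_self] at h
      conv_rhs => rw [h, Finset.smul_sum]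
      refine Finset.sum_congr rfl fun i _ => ?_
      change (f y * t.localFrameCoeff 𝓘(ℝ, E) b i y v) • (f y • t.localFrame b i y)
        = f y ^ 2 • (t.localFrameCoeff 𝓘(ℝ, E) b i y v • t.localFrame b i y)
      simp only [smul_smul]
      congr 1
      ring
    · simp [h0 y hy]
  · intro i Y
    have : ContMDiff 𝓘(ℝ, E) 𝓘(ℝ, ℝ) ∞ (fun y => f y • t.localFrameCoeff 𝓘(ℝ, E) b i y (Y y)) := by
      refine f.contMDiff_smul ?_
      rw [← hbase]
      exact contMDiffOn_baseSet_localFrameCoeff b Y.contMDiff.contMDiffOn i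
    exact this
  · filter_upwards [f.eventuallyEq_one, t.open_baseSet.mem_nhds hx] with y hy hyt i c
    have : ∀ j, (f y • t.localFrame b j y) = t.basisAt b hyt j := by
      intro j
      simp [hy, hyt]
    change f y * (t.localFrameCoeff 𝓘(ℝ, E) b i y (∑ j, c j • (f y • t.localFrame b j y))) = c i
    simp only [this]
    have h2 := t.localFrameCoeff_apply_of_mem_baseSet (I := 𝓘(ℝ, E)) b hyt
      (FiberBundle.extend E (∑ j, c j • t.basisAt b hyt j)) i
    rw [FiberBundle.extend_apply_self] at h2
    rw [h2, Module.Basis.repr_sum_self, hy]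
    simp
  · filter_upwards [f.eventuallyEq_one, t.open_baseSet.mem_nhds hx] with y hy hyt i v
    change f y * (t.localFrameCoeff 𝓘(ℝ, E) b i y v) = _
    have h2 := t.localFrameCoeff_eq_coeff (I := 𝓘(ℝ, E)) (b := b) (s := FiberBundle.extend E v) hyt
      (i := i)
    rw [FiberBundle.extend_apply_self] at h2
    have h3 : t.continuousLinearMapAt ℝ y v = (t ⟨y, v⟩).2 := by
      rw [Bundle.Trivialization.continuousLinearMapAt_apply,
        Bundle.Trivialization.coe_linearMapAt_of_mem _ hyt]
    have h4 : mfderiv 𝓘(ℝ, E) 𝓘(ℝ, E) (extChartAt 𝓘(ℝ, E) x) y v = (t ⟨y, v⟩).2 := by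
      rw [← h3, ← TangentBundle.continuousLinearMapAt_trivializationAt (hbase ▸ hyt)]
      rfl
    rw [h2, h4, hy]
    simp

namespace CutoffFrame

variable {ι : Type*} [Fintype ι] {b : Module.Basis ι ℝ E} {x : M} (F : CutoffFrame b x)

lemma eventually_sum_smul :
    ∀ᶠ y in 𝓝 x, ∀ v : TangentSpace 𝓘(ℝ, E) y, ∑ i, F.θ i y v • F.e i y = v := by
  filter_upwards [F.χ_one] with y hy v
  rw [F.sum_smul, hy]
  simp

lemma eventually_trace_eq : ∀ᶠ y in 𝓝 x,
    ∀ A : TangentSpace 𝓘(ℝ, E) y →ₗ[ℝ] TangentSpace 𝓘(ℝ, E) y,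
      LinearMap.trace ℝ (TangentSpace 𝓘(ℝ, E) y) A = ∑ i, F.θ i y (A (F.e i y)) := by
  filter_upwards [F.eventually_sum_smul] with y hy A
  have hA : A = ∑ i, ((F.θ i y).toLinearMap ∘ₗ A).smulRight (F.e i y) := by
    ext v
    simpa using (hy (A v)).symm
  conv_lhs => rw [hA]
  simp [LinearMap.trace_smulRight]

end CutoffFrame

/-- A `C^∞`-linear operation on smooth vector fields depends only on the value at the point. -/
lemma eq_of_tensorial {A : Type*} [AddCommGroup A] [Module ℝ A] {x : M} (Φ : Sec E M → A)
    (hadd : ∀ Y Z, Φ (Y + Z) = Φ Y + Φ Z)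
    (hsmul : ∀ (f : M → ℝ) (hf : ContMDiff 𝓘(ℝ, E) 𝓘(ℝ, ℝ) ∞ f) (Y : Sec E M),
      Φ (Sec.fsmul f hf Y) = f x • Φ Y) {Y Z : Sec E M} (h : Y x = Z x) : Φ Y = Φ Z := by
  let Φ' : Sec E M →+ A := AddMonoidHom.mk' Φ hadd
  have key : ∀ W : Sec E M, W x = 0 → Φ' W = 0 := by
    intro W hW
    obtain ⟨F⟩ := nonempty_cutoffFrame (Module.finBasis ℝ E) x
    -- `χ² W = ∑ θᵢ(W) eᵢ` holds globally, so linearity gives `Φ W = ∑ θᵢ(W)(x) Φ(eᵢ)`, and every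
    -- coefficient vanishes.
    have h1 : Sec.fsmul (fun y => F.χ y ^ 2) (F.χ_smooth.pow 2) W
        = ∑ i, Sec.fsmul (fun y => F.θ i y (W y)) (F.θ_smooth i W) (F.e i) := by
      ext y
      rw [Sec.sum_apply]
      simp [F.sum_smul]
    have h2 := congrArg Φ' h1
    rw [map_sum] at h2
    change Φ _ = ∑ i, Φ _ at h2
    simp only [hsmul, hW, F.χ_one.self_of_nhds] at h2
    change Φ W = 0
    simpa using h2
  have := key (Y - Z) (by simp [h])
  rw [map_sub, sub_eq_zero] at this
  exact this

end SmoothSections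

/-! ### Lie brackets and covariant derivatives of global fields -/

section Operations

variable {E : Type*} [NormedAddCommGroup E] [NormedSpace ℝ E] [FiniteDimensional ℝ E]
  {M : Type*} [TopologicalSpace M] [ChartedSpace E M] [IsManifold 𝓘(ℝ, E) ∞ M]

/-- Smooth real functions. -/
abbrev SmoothFn (E : Type*) [NormedAddCommGroup E] [NormedSpace ℝ E]
    {M : Type*} [TopologicalSpace M] [ChartedSpace E M] (f : M → ℝ) : Prop :=
  ContMDiff 𝓘(ℝ, E) 𝓘(ℝ, ℝ) ∞ f

lemma SmoothFn.mdiffAt {f : M → ℝ} (hf : SmoothFn E f) (x : M) : MDiffAt f x :=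
  hf.mdifferentiableAt (by simp)

lemma contMDiffAt_inner (g : RMetric E M) {V W : VField E M} {x : M}
    (hV : ContMDiffAt 𝓘(ℝ, E) 𝓘(ℝ, E).tangent ∞ (T% V) x)
    (hW : ContMDiffAt 𝓘(ℝ, E) 𝓘(ℝ, E).tangent ∞ (T% W) x) :
    ContMDiffAt 𝓘(ℝ, E) 𝓘(ℝ, ℝ) ∞ (fun y => g.inner y (V y) (W y)) x := by
  have hg := g.contMDiff x
  have h : ContMDiffAt 𝓘(ℝ, E) (𝓘(ℝ, E).prod 𝓘(ℝ, ℝ)) ∞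
      (fun m => TotalSpace.mk' ℝ (E := Bundle.Trivial M ℝ) m (g.inner m (V m) (W m))) x :=
    ContMDiffAt.clm_bundle_apply₂ (F₁ := E) (F₂ := E) hg hV hW
  exact ((contMDiffAt_totalSpace).1 h).2

lemma smoothFn_inner (g : RMetric E M) (V W : Sec E M) :
    SmoothFn E (fun y => g.inner y (V y) (W y)) :=
  fun _ => contMDiffAt_inner g V.contMDiff.contMDiffAt W.contMDiff.contMDiffAt

lemma smoothFn_differential {f : M → ℝ} (hf : SmoothFn E f) (V : Sec E M) :
    SmoothFn E (fun y => differential E f y (V y)) := by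
  have h := (hf.contMDiff_tangentMap (m := ∞) (by simp)).comp V.contMDiff
  exact (contMDiff_snd_tangentBundle_modelSpace ℝ 𝓘(ℝ, ℝ)).comp h

lemma minSmoothness_nat_le (n : ℕ) : minSmoothness ℝ (n : WithTop ℕ∞) ≤ ∞ := by
  simp only [minSmoothness_of_isRCLikeNormedField]
  exact_mod_cast (le_top : (n : ℕ∞) ≤ ⊤)

lemma isManifold_minSmoothness (n : ℕ) :
    IsManifold 𝓘(ℝ, E) (minSmoothness ℝ (n : WithTop ℕ∞)) M :=
  IsManifold.of_le (n := ∞) (minSmoothness_nat_le n)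

/-- The Lie bracket of smooth vector fields. -/
def brk (V W : Sec E M) : Sec E M :=
  ⟨mlieBracket 𝓘(ℝ, E) (fun y => V y) (fun y => W y), fun x => by
    have := FiniteDimensional.complete ℝ E
    have h1 : IsManifold 𝓘(ℝ, E) (((⊤ : ℕ∞) : WithTop ℕ∞) + 1) M := ‹IsManifold 𝓘(ℝ, E) ∞ M›
    have h2 := isManifold_minSmoothness (E := E) (M := M) 2
    exact ContMDiffAt.mlieBracket_vectorField (m := (⊤ : ℕ∞)) (n := (⊤ : ℕ∞))
      V.contMDiff.contMDiffAt W.contMDiff.contMDiffAt (by simp)⟩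

lemma brk_apply (V W : Sec E M) (x : M) :
    brk V W x = mlieBracket 𝓘(ℝ, E) (fun y => V y) (fun y => W y) x := rfl

lemma brk_swap (V W : Sec E M) : brk V W = - brk W V := by
  ext x
  rw [brk_apply, mlieBracket_swap_apply]
  rfl

lemma brk_add_right (V W W' : Sec E M) : brk V (W + W') = brk V W + brk V W' := by
  have := FiniteDimensional.complete ℝ E
  ext x
  exact mlieBracket_add_right (W.mdiffAt x) (W'.mdiffAt x)

lemma brk_add_left (V V' W : Sec E M) : brk (V + V') W = brk V W + brk V' W := by
  have := FiniteDimensional.complete ℝ E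
  ext x
  exact mlieBracket_add_left (V.mdiffAt x) (V'.mdiffAt x)

lemma brk_fsmul_right (V W : Sec E M) {f : M → ℝ} (hf : SmoothFn E f) :
    brk V (Sec.fsmul f hf W)
      = Sec.fsmul (fun y => differential E f y (V y)) (smoothFn_differential hf V) W
        + Sec.fsmul f hf (brk V W) := by
  have := FiniteDimensional.complete ℝ E
  ext x
  exact mlieBracket_smul_right (hf.mdiffAt x) (W.mdiffAt x)

lemma brk_jacobi (U V W : Sec E M) :
    brk U (brk V W) = brk (brk U V) W + brk V (brk U W) := by
  have := FiniteDimensional.complete ℝ E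
  have h1 := isManifold_minSmoothness (E := E) (M := M) 3
  have h2 := minSmoothness_nat_le 2
  ext x
  exact leibniz_identity_mlieBracket_apply (U.contMDiff.contMDiffAt.of_le h2)
    (V.contMDiff.contMDiffAt.of_le h2) (W.contMDiff.contMDiffAt.of_le h2)

variable [T2Space M]

/-- `V (W f) - W (V f) = [V, W] f`. -/
lemma differential_brk (V W : Sec E M) {f : M → ℝ} (hf : SmoothFn E f) (x : M) :
    differential E (fun y => differential E f y (W y)) x (V x)
      - differential E (fun y => differential E f y (V y)) x (W x)
      = differential E f x (brk V W x) := by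
  by_cases hE : ∃ v : TangentSpace 𝓘(ℝ, E) x, v ≠ 0
  · obtain ⟨v, hv⟩ := hE
    obtain ⟨Z, rfl⟩ := exists_sec_apply_eq x v
    -- The Jacobi identity for `V, W, fZ` minus `f` times the one for `V, W, Z` leaves exactly the
    -- desired identity as coefficient of `Z`; `Z x ≠ 0` allows it to be cancelled.
    have h := congrArg (fun Y : Sec E M => Y x) (brk_jacobi V W (Sec.fsmul f hf Z))
    have h2 := congrArg (fun Y : Sec E M => Y x) (brk_jacobi V W Z)
    simp only [brk_fsmul_right, brk_add_right, Sec.add_apply, Sec.fsmul_apply] at h h2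
    rw [h2] at h
    have h3 : (differential E (fun y => differential E f y (W y)) x (V x)
      - differential E (fun y => differential E f y (V y)) x (W x)
      - differential E f x (brk V W x)) • Z x = 0 := by
      simp only [sub_smul]
      simp only [smul_add] at h
      linear_combination (norm := module) h
    have := (smul_eq_zero.1 h3).resolve_right hv
    linarith
  · push Not at hE
    rw [hE (V x), hE (W x), hE (brk V W x)]
    simp

/-- Cramer's rule for the Gram matrix of a local frame recovers the coefficients of `W` from its
inner products with the frame. This is the source of smoothness for fields defined by duality:
covariant derivatives, gradients and `S V`. -/
lemma contMDiff_of_inner (g : RMetric E M) (W : VField E M)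
    (h : ∀ Z : Sec E M, SmoothFn E (fun y => g.inner y (W y) (Z y))) :
    ContMDiff 𝓘(ℝ, E) 𝓘(ℝ, E).tangent ∞ (T% W) := by
  classical
  intro x
  obtain ⟨F⟩ := nonempty_cutoffFrame (Module.finBasis ℝ E) x
  let G : M → Matrix (Fin (Module.finrank ℝ E)) (Fin (Module.finrank ℝ E)) ℝ :=
    fun y => Matrix.of fun i j => g.inner y (F.e i y) (F.e j y)
  have hG : ∀ i j, SmoothFn E (fun y => G y i j) := fun i j => smoothFn_inner g _ _
  have hdet : ∀ A : M → Matrix (Fin (Module.finrank ℝ E)) (Fin (Module.finrank ℝ E)) ℝ,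
      (∀ i j, SmoothFn E (fun y => A y i j)) → SmoothFn E (fun y => (A y).det) := by
    intro A hA
    simp only [Matrix.det_apply]
    refine contMDiff_finsetSum fun σ _ => ?_
    have : SmoothFn E fun y => ∏ i, A y (σ i) i := contMDiff_finsetProd fun i _ => hA _ _
    exact (contMDiff_const (c := ((Equiv.Perm.sign σ : ℤ) : ℝ))).mul this |>.congr fun y => by
      simp [Units.smul_def]
  have hadj : ∀ i j, SmoothFn E (fun y => (G y).adjugate i j) := by
    intro i j
    simp only [Matrix.adjugate_apply]
    refine hdet (fun y => (G y).updateRow j (Pi.single i 1)) fun k l => ?_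
    by_cases hk : k = j
    · subst hk
      simpa using contMDiff_const
    · simpa [Matrix.updateRow_ne hk] using hG k l
  -- A kernel vector `c` of the Gram matrix gives `∑ cⱼ eⱼ` of length zero, hence zero, and the dual
  -- coframe then reads off `c = 0`.
  have hne : ∀ᶠ y in 𝓝 x, (G y).det ≠ 0 := by
    filter_upwards [F.dual] with y hy h0
    obtain ⟨c, hc, hGc⟩ := Matrix.exists_mulVec_eq_zero_iff.2 h0
    have h1 : g.inner y (∑ j, c j • F.e j y) (∑ j, c j • F.e j y) = 0 := by
      rw [map_sum]
      refine Finset.sum_eq_zero fun i _ => ?_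
      have := congrFun hGc i
      simp only [Matrix.mulVec, dotProduct, G, Matrix.of_apply, Pi.zero_apply] at this
      rw [map_smul, g.symm, map_sum]
      simp only [map_smul, smul_eq_mul, mul_comm (c _) (g.inner y _ _)]
      rw [this, mul_zero]
    have h2 : ∑ j, c j • F.e j y = 0 := by
      by_contra hne
      exact (g.pos y _ hne).ne' h1
    apply hc
    ext i
    rw [← hy i c, h2]
    simp
  have hcoef : ∀ᶠ y in 𝓝 x, W y = ∑ i, ((G y).det⁻¹ *
      ∑ j, (G y).adjugate i j * g.inner y (W y) (F.e j y)) • F.e i y := by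
    filter_upwards [F.eventually_sum_smul, hne] with y hy hd
    have hw : (fun j => g.inner y (W y) (F.e j y)) = (G y).mulVec (fun i => F.θ i y (W y)) := by
      ext j
      conv_lhs => rw [← hy (W y)]
      simp only [map_sum, map_smul, sum_apply, smul_apply, smul_eq_mul,
        Matrix.mulVec, dotProduct, G, Matrix.of_apply]
      refine Finset.sum_congr rfl fun i _ => ?_
      rw [g.symm y (F.e i y), mul_comm]
    conv_lhs => rw [← hy (W y)]
    refine Finset.sum_congr rfl fun i _ => ?_
    congr 1
    have : ∑ j, (G y).adjugate i j * g.inner y (W y) (F.e j y)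
        = ((G y).adjugate.mulVec (fun j => g.inner y (W y) (F.e j y))) i := rfl
    rw [this, hw, Matrix.mulVec_mulVec, Matrix.adjugate_mul, Matrix.smul_mulVec, Matrix.one_mulVec]
    simp [hd]
  have hsm : ∀ i, ContMDiffAt 𝓘(ℝ, E) 𝓘(ℝ, ℝ) ∞ (fun y => (G y).det⁻¹ *
      ∑ j, (G y).adjugate i j * g.inner y (W y) (F.e j y)) x := by
    intro i
    refine ContMDiffAt.mul ((hdet G hG).contMDiffAt.inv₀ hne.self_of_nhds) ?_
    refine ContMDiff.contMDiffAt ?_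
    exact contMDiff_finsetSum fun j _ => (hadj i j).mul (h (F.e j))
  have : ContMDiffAt 𝓘(ℝ, E) 𝓘(ℝ, E).tangent ∞ (T% (fun y => ∑ i, ((G y).det⁻¹ *
      ∑ j, (G y).adjugate i j * g.inner y (W y) (F.e j y)) • F.e i y)) x := by
    refine ContMDiffAt.sum_section fun i _ => ?_
    exact (hsm i).smul_section (F.e i).contMDiff.contMDiffAt
  refine this.congr_of_eventuallyEq ?_
  filter_upwards [hcoef] with y hy
  rw [← hy]

/-- A vector field whose inner products with all smooth fields are smooth, as a smooth field. -/
def Sec.ofInner (g : RMetric E M) (W : VField E M)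
    (h : ∀ Z : Sec E M, SmoothFn E (fun y => g.inner y (W y) (Z y))) : Sec E M :=
  ⟨W, contMDiff_of_inner g W h⟩

/-- The covariant derivative `∇_V W` of smooth fields. -/
def nab (g : RMetric E M) (V W : Sec E M) : Sec E M :=
  Sec.ofInner g (fun y => leviCivita g (fun z => W z) y (V y)) (fun Z => by
    have h : (fun y => g.inner y (leviCivita g (fun z => W z) y (V y)) (Z y))
        = fun y => 1 / 2 * koszul g (fun z => W z) (fun z => V z) (fun z => Z z) y := by
      ext y
      exact inner_nabla g (W.mdiffAt y) (V.mdiffAt y) (Z.mdiffAt y)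
    rw [h]
    refine contMDiff_const.mul ?_
    unfold koszul
    refine ((((ContMDiff.add ?_ ?_).sub ?_).add ?_).sub ?_).sub ?_
    · exact smoothFn_differential (smoothFn_inner g W Z) V
    · exact smoothFn_differential (smoothFn_inner g V Z) W
    · exact smoothFn_differential (smoothFn_inner g V W) Z
    · exact smoothFn_inner g (brk V W) Z
    · exact smoothFn_inner g (brk V Z) W
    · exact smoothFn_inner g (brk W Z) V)

lemma nab_apply (g : RMetric E M) (V W : Sec E M) (x : M) :
    nab g V W x = leviCivita g (fun z => W z) x (V x) := rfl

lemma nab_sub_nab (g : RMetric E M) (V W : Sec E M) : nab g V W - nab g W V = brk V W := by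
  ext x
  exact leviCivita_torsion_free g (V.mdiffAt x) (W.mdiffAt x)

lemma differential_inner (g : RMetric E M) (U V W : Sec E M) (x : M) :
    differential E (fun y => g.inner y (V y) (W y)) x (U x)
      = g.inner x (nab g U V x) (W x) + g.inner x (V x) (nab g U W x) :=
  leviCivita_metric g (U.mdiffAt x) (V.mdiffAt x) (W.mdiffAt x)

lemma nab_add_left (g : RMetric E M) (V V' W : Sec E M) :
    nab g (V + V') W = nab g V W + nab g V' W := by
  ext x; simp [nab_apply]

lemma nab_add_right (g : RMetric E M) (V W W' : Sec E M) :
    nab g V (W + W') = nab g V W + nab g V W' := by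
  ext x
  have := (leviCivita g).isCovariantDerivativeOnUniv.add (W.mdiffAt x) (W'.mdiffAt x)
    (Set.mem_univ x)
  exact congrArg (fun A => A (V x)) this

lemma nab_fsmul_left (g : RMetric E M) (V W : Sec E M) {f : M → ℝ} (hf : SmoothFn E f) :
    nab g (Sec.fsmul f hf V) W = Sec.fsmul f hf (nab g V W) := by
  ext x; simp [nab_apply]

lemma nab_fsmul_right (g : RMetric E M) (V W : Sec E M) {f : M → ℝ} (hf : SmoothFn E f) :
    nab g V (Sec.fsmul f hf W)
      = Sec.fsmul (fun y => differential E f y (V y)) (smoothFn_differential hf V) W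
        + Sec.fsmul f hf (nab g V W) := by
  ext x
  have := (leviCivita g).isCovariantDerivativeOnUniv.leibniz (W.mdiffAt x) (hf.mdiffAt x)
    (Set.mem_univ x)
  have h2 := congrArg (fun A => A (V x)) this
  refine h2.trans ?_
  simp [nab_apply, add_comm]

lemma leviCivita_congr (g : RMetric E M) {V W : VField E M} {x : M} (hV : MDiffAt (T% V) x)
    (h : ∀ᶠ y in 𝓝 x, V y = W y) : leviCivita g V x = leviCivita g W x := by
  have hW : MDiffAt (T% W) x := by
    refine hV.congr_of_eventuallyEq ?_
    filter_upwards [h] with y hy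
    rw [hy]
  exact (leviCivita g).isCovariantDerivativeOnUniv.congr_of_eventuallyEq hV hW Filter.univ_mem h

end Operations

/-! ### Traces of endomorphism fields and their derivatives -/

section Traces

variable {E : Type*} [NormedAddCommGroup E] [NormedSpace ℝ E] [FiniteDimensional ℝ E]
  {M : Type*} [TopologicalSpace M] [ChartedSpace E M] [IsManifold 𝓘(ℝ, E) ∞ M]

/-- The isomorphism `v ↦ g(v, ·)` conjugates `A` to the transpose of `B`. -/
lemma trace_eq_of_adjoint (g : RMetric E M) {x : M}
    {A B : TangentSpace 𝓘(ℝ, E) x →ₗ[ℝ] TangentSpace 𝓘(ℝ, E) x}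
    (h : ∀ v w, g.inner x (A v) w = g.inner x v (B w)) :
    LinearMap.trace ℝ (TangentSpace 𝓘(ℝ, E) x) A = LinearMap.trace ℝ (TangentSpace 𝓘(ℝ, E) x) B := by
  let e : TangentSpace 𝓘(ℝ, E) x ≃ₗ[ℝ] Module.Dual ℝ (TangentSpace 𝓘(ℝ, E) x) :=
    (flat g x).trans (LinearMap.toContinuousLinearMap (𝕜 := ℝ) (E := TangentSpace 𝓘(ℝ, E) x)
      (F' := ℝ)).symm
  have hA : A = e.symm.conj (Module.Dual.transpose (R := ℝ) B) := by
    ext v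
    rw [LinearEquiv.conj_apply_apply, LinearEquiv.symm_symm, LinearEquiv.eq_symm_apply]
    ext w
    exact h v w
  rw [hA, LinearMap.trace_conj', LinearMap.trace_transpose']

lemma trace_eq_zero_of_skew (g : RMetric E M) {x : M}
    {A : TangentSpace 𝓘(ℝ, E) x →ₗ[ℝ] TangentSpace 𝓘(ℝ, E) x}
    (h : ∀ v w, g.inner x (A v) w = -g.inner x v (A w)) :
    LinearMap.trace ℝ (TangentSpace 𝓘(ℝ, E) x) A = 0 := by
  have := trace_eq_of_adjoint g (A := A) (B := -A) (by simpa using h)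
  rw [map_neg] at this
  linarith

lemma differential_congr {f f' : M → ℝ} {x : M} (h : ∀ᶠ y in 𝓝 x, f y = f' y) :
    differential E f x = differential E f' x := by
  ext v
  have : mfderiv 𝓘(ℝ, E) 𝓘(ℝ, ℝ) f x = mfderiv 𝓘(ℝ, E) 𝓘(ℝ, ℝ) f' x :=
    Filter.EventuallyEq.mfderiv_eq h
  have h2 := h.self_of_nhds
  simp only [differential, mvfderiv]
  exact congrArg (fun A : E →L[ℝ] ℝ => A v) this

variable [T2Space M]

lemma smoothFn_trace (A : (y : M) → TangentSpace 𝓘(ℝ, E) y →ₗ[ℝ] TangentSpace 𝓘(ℝ, E) y)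
    (A' : Sec E M → Sec E M) (hA : ∀ Y y, A' Y y = A y (Y y)) :
    SmoothFn E (fun y => LinearMap.trace ℝ (TangentSpace 𝓘(ℝ, E) y) (A y)) := by
  intro x
  obtain ⟨F⟩ := nonempty_cutoffFrame (Module.finBasis ℝ E) x
  have h : SmoothFn E fun y => ∑ i, F.θ i y (A' (F.e i) y) :=
    contMDiff_finsetSum fun i _ => F.θ_smooth i (A' (F.e i))
  refine h.contMDiffAt.congr_of_eventuallyEq ?_
  filter_upwards [F.eventually_trace_eq] with y hy
  rw [hy]
  simp [hA]

/-- The derivative of the trace of a smooth endomorphism field `A` along `X` is the trace of the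
derivative `[D, A]` for each derivation `D` of the module of vector fields over `X`. -/
lemma differential_trace (X : Sec E M) (D : Sec E M → Sec E M)
    (hadd : ∀ Y Z, D (Y + Z) = D Y + D Z)
    (hsmul : ∀ (f : M → ℝ) (hf : SmoothFn E f) (Y : Sec E M) (y : M),
      D (Sec.fsmul f hf Y) y = differential E f y (X y) • Y y + f y • D Y y)
    (A : (y : M) → TangentSpace 𝓘(ℝ, E) y →ₗ[ℝ] TangentSpace 𝓘(ℝ, E) y)
    (A' : Sec E M → Sec E M) (hA : ∀ Y y, A' Y y = A y (Y y)) (x : M)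
    (B : TangentSpace 𝓘(ℝ, E) x →ₗ[ℝ] TangentSpace 𝓘(ℝ, E) x)
    (hB : ∀ Y : Sec E M, B (Y x) = D (A' Y) x - A x (D Y x)) :
    differential E (fun y => LinearMap.trace ℝ (TangentSpace 𝓘(ℝ, E) y) (A y)) x (X x)
      = LinearMap.trace ℝ (TangentSpace 𝓘(ℝ, E) x) B := by
  obtain ⟨F⟩ := nonempty_cutoffFrame (Module.finBasis ℝ E) x
  let D' : Sec E M →+ Sec E M := AddMonoidHom.mk' D hadd
  -- Apply `D` to `χ² Z = ∑ θⱼ(Z) eⱼ` and pair with `θᵢ`. As `χ` is constant near `x`, its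
  -- derivative drops out; the result is the derivative of the components of `Z`.
  have key : ∀ (Z : Sec E M) i, differential E (fun y => F.θ i y (Z y)) x (X x)
      = F.θ i x (D Z x) - ∑ j, F.θ j x (Z x) * F.θ i x (D (F.e j) x) := by
    intro Z i
    have h1 : Sec.fsmul (fun y => F.χ y ^ 2) (F.χ_smooth.pow 2) Z
        = ∑ j, Sec.fsmul (fun y => F.θ j y (Z y)) (F.θ_smooth j Z) (F.e j) := by
      ext y
      rw [Sec.sum_apply]
      simp [F.sum_smul]
    have h2 := congrArg (fun W => D' W x) h1
    simp only [map_sum, Sec.sum_apply] at h2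
    change D _ x = ∑ j, D _ x at h2
    simp only [hsmul] at h2
    have hχ : differential E (fun y => F.χ y ^ 2) x = 0 := by
      rw [differential_congr (f' := fun _ => 1)]
      · exact mvfderiv_const 1
      · filter_upwards [F.χ_one] with y hy
        rw [hy, one_pow]
    rw [hχ, F.χ_one.self_of_nhds, Finset.sum_add_distrib] at h2
    have h3 := congrArg (F.θ i x) h2
    rw [map_add, map_add, F.dual.self_of_nhds i] at h3
    simp only [map_sum, map_smul, smul_eq_mul, zero_apply, zero_smul, map_zero, zero_add, one_pow,
      one_mul] at h3
    rw [h3]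
    ring
  have h1 : differential E (fun y => LinearMap.trace ℝ (TangentSpace 𝓘(ℝ, E) y) (A y)) x
      = differential E (fun y => ∑ i, F.θ i y (A' (F.e i) y)) x := by
    refine differential_congr ?_
    filter_upwards [F.eventually_trace_eq] with y hy
    rw [hy]
    simp [hA]
  have h2 : differential E (fun y => ∑ i, F.θ i y (A' (F.e i) y)) x (X x)
      = ∑ i, differential E (fun y => F.θ i y (A' (F.e i) y)) x (X x) := by
    have : ∀ s : Finset (Fin (Module.finrank ℝ E)),
        differential E (fun y => ∑ i ∈ s, F.θ i y (A' (F.e i) y)) x (X x)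
        = ∑ i ∈ s, differential E (fun y => F.θ i y (A' (F.e i) y)) x (X x) := by
      intro s
      classical
      induction s using Finset.induction_on with
      | empty =>
        simp only [Finset.sum_empty]
        rw [show differential E (fun _ : M => (0 : ℝ)) x = 0 from mvfderiv_const 0]
        rfl
      | insert a s ha ih =>
        simp only [Finset.sum_insert ha]
        rw [← ih]
        have h3 : SmoothFn E fun y => ∑ i ∈ s, F.θ i y (A' (F.e i) y) :=
          contMDiff_finsetSum fun i _ => F.θ_smooth i (A' (F.e i))
        have := mvfderiv_add ((show SmoothFn E _ from F.θ_smooth a (A' (F.e a))).mdiffAt x)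
          (h3.mdiffAt x)
        exact congrArg (fun A => A (X x)) this
    exact this _
  rw [h1, h2, F.eventually_trace_eq.self_of_nhds]
  simp only [key, hB, map_sub, Finset.sum_sub_distrib]
  congr 1
  -- What remains is that the matrices of `A` and of `D` on the frame have the same traced product
  -- in either order.
  have h4 : ∀ i, F.θ i x (A x (D (F.e i) x))
      = ∑ j, F.θ j x (D (F.e i) x) * F.θ i x (A' (F.e j) x) := by
    intro i
    conv_lhs => rw [← F.eventually_sum_smul.self_of_nhds (D (F.e i) x)]
    simp [hA]
  simp only [h4]
  rw [Finset.sum_comm]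
  simp only [mul_comm]

end Traces

/-! ### Symmetries of the curvature and Ricci tensors -/

section Curvature

variable {E : Type*} [NormedAddCommGroup E] [NormedSpace ℝ E] [FiniteDimensional ℝ E]
  {M : Type*} [TopologicalSpace M] [ChartedSpace E M] [IsManifold 𝓘(ℝ, E) ∞ M] [T2Space M]

/-- The curvature `R(U, V) W` of smooth fields. -/
def riem (g : RMetric E M) (U V W : Sec E M) : Sec E M :=
  nab g U (nab g V W) - nab g V (nab g U W) - nab g (brk U V) W

lemma nab_neg_left (g : RMetric E M) (V W : Sec E M) : nab g (-V) W = - nab g V W := by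
  ext x; simp [nab_apply]

lemma nab_sub_left (g : RMetric E M) (V V' W : Sec E M) :
    nab g (V - V') W = nab g V W - nab g V' W := by
  ext x; simp [nab_apply]

lemma nab_sub_right (g : RMetric E M) (V W W' : Sec E M) :
    nab g V (W - W') = nab g V W - nab g V W' := by
  have := nab_add_right g V (W - W') W'
  rw [sub_add_cancel] at this
  rw [this, add_sub_cancel_right]

lemma riem_swap (g : RMetric E M) (U V W : Sec E M) : riem g U V W = - riem g V U W := by
  simp only [riem, brk_swap U V, nab_neg_left]
  abel

lemma riem_add_left (g : RMetric E M) (U U' V W : Sec E M) :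
    riem g (U + U') V W = riem g U V W + riem g U' V W := by
  simp only [riem, nab_add_left, nab_add_right, brk_add_left]
  abel

lemma riem_add_right (g : RMetric E M) (U V W W' : Sec E M) :
    riem g U V (W + W') = riem g U V W + riem g U V W' := by
  simp only [riem, nab_add_right]
  abel

lemma riem_fsmul_right (g : RMetric E M) (U V W : Sec E M) {f : M → ℝ} (hf : SmoothFn E f) :
    riem g U V (Sec.fsmul f hf W) = Sec.fsmul f hf (riem g U V W) := by
  ext x
  have h := differential_brk U V hf x
  simp only [riem, nab_fsmul_right, nab_add_right, Sec.add_apply, Sec.sub_apply, Sec.fsmul_apply,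
    ← h]
  module

lemma riem_fsmul_left (g : RMetric E M) (U V W : Sec E M) {f : M → ℝ} (hf : SmoothFn E f) :
    riem g (Sec.fsmul f hf U) V W = Sec.fsmul f hf (riem g U V W) := by
  ext x
  simp only [riem]
  rw [brk_swap, brk_fsmul_right, nab_neg_left, brk_swap V U]
  simp only [nab_fsmul_left, nab_fsmul_right, nab_add_left, Sec.add_apply, Sec.sub_apply,
    Sec.fsmul_apply, Sec.neg_apply, nab_neg_left]
  module

lemma riem_congr (g : RMetric E M) {U U' V V' W W' : Sec E M} {x : M} (hU : U x = U' x)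
    (hV : V x = V' x) (hW : W x = W' x) : riem g U V W x = riem g U' V' W' x := by
  have h1 : ∀ {U U' V W : Sec E M}, U x = U' x → riem g U V W x = riem g U' V W x := by
    intro U U' V W h
    refine eq_of_tensorial (fun U => riem g U V W x) (fun Y Z => ?_) (fun f hf Y => ?_) h
    · simp [riem_add_left]
    · simp [riem_fsmul_left]
  rw [h1 hU, riem_swap, Sec.neg_apply, h1 hV, ← Sec.neg_apply, ← riem_swap]
  refine eq_of_tensorial (fun W => riem g U' V' W x) (fun Y Z => ?_) (fun f hf Y => ?_) hW
  · simp [riem_add_right]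
  · simp [riem_fsmul_right]

/-- Bridge between curvature defined by local extensions and curvature of global sections:
tensoriality replaces the sections by ones with the germs of the extensions. The algebraic
identities below are proved for sections and transferred through it. -/
lemma riem_apply (g : RMetric E M) (U V W : Sec E M) (x : M) :
    riem g U V W x = curvature g x (U x) (V x) (W x) := by
  obtain ⟨U', hU⟩ := exists_sec_extend x (U x)
  obtain ⟨V', hV⟩ := exists_sec_extend x (V x)
  obtain ⟨W', hW⟩ := exists_sec_extend x (W x)
  have hU0 : U' x = U x := by simpa using hU.self_of_nhds
  have hV0 : V' x = V x := by simpa using hV.self_of_nhds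
  have hW0 : W' x = W x := by simpa using hW.self_of_nhds
  rw [riem_congr g hU0.symm hV0.symm hW0.symm]
  have key : ∀ (Z : Sec E M) (v : TangentSpace 𝓘(ℝ, E) x),
      (∀ᶠ y in 𝓝 x, Z y = FiberBundle.extend E v y) →
      leviCivita g (fun y => leviCivita g (FiberBundle.extend E (W x)) y
        (FiberBundle.extend E v y)) x = leviCivita g (fun y => nab g Z W' y) x := by
    intro Z v hZ
    refine (leviCivita_congr g ((nab g Z W').mdiffAt x) ?_).symm
    filter_upwards [hZ, hW.eventually_nhds] with y hy hWy
    rw [nab_apply, leviCivita_congr g (W'.mdiffAt y) hWy, hy]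
  simp only [curvature]
  rw [key V' (V x) hV, key U' (U x) hU, ← leviCivita_congr g (W'.mdiffAt x) hW]
  simp only [riem, Sec.sub_apply, nab_apply, hU0, hV0, brk_apply]
  congr 2
  exact Filter.EventuallyEq.mlieBracket_vectorField_eq hU hV

variable (g : RMetric E M) {x : M} (u u' v v' w w' z : TangentSpace 𝓘(ℝ, E) x)

lemma curvature_swap : curvature g x u v w = - curvature g x v u w := by
  obtain ⟨U, rfl⟩ := exists_sec_apply_eq x u
  obtain ⟨V, rfl⟩ := exists_sec_apply_eq x v
  obtain ⟨W, rfl⟩ := exists_sec_apply_eq x w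
  simp only [← riem_apply]
  rw [riem_swap]
  rfl

lemma curvature_add_left :
    curvature g x (u + u') v w = curvature g x u v w + curvature g x u' v w := by
  obtain ⟨U, rfl⟩ := exists_sec_apply_eq x u
  obtain ⟨U', rfl⟩ := exists_sec_apply_eq x u'
  obtain ⟨V, rfl⟩ := exists_sec_apply_eq x v
  obtain ⟨W, rfl⟩ := exists_sec_apply_eq x w
  rw [← Sec.add_apply, ← riem_apply, riem_add_left, Sec.add_apply, riem_apply, riem_apply]

lemma curvature_smul_left (c : ℝ) :
    curvature g x (c • u) v w = c • curvature g x u v w := by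
  obtain ⟨U, rfl⟩ := exists_sec_apply_eq x u
  obtain ⟨V, rfl⟩ := exists_sec_apply_eq x v
  obtain ⟨W, rfl⟩ := exists_sec_apply_eq x w
  have h := riem_fsmul_left g U V W (f := fun _ => c) contMDiff_const
  have h2 := congrArg (fun Y : Sec E M => Y x) h
  simpa [riem_apply] using h2

lemma curvature_add_right :
    curvature g x u v (w + w') = curvature g x u v w + curvature g x u v w' := by
  obtain ⟨U, rfl⟩ := exists_sec_apply_eq x u
  obtain ⟨W', rfl⟩ := exists_sec_apply_eq x w'
  obtain ⟨V, rfl⟩ := exists_sec_apply_eq x v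
  obtain ⟨W, rfl⟩ := exists_sec_apply_eq x w
  rw [← Sec.add_apply, ← riem_apply, riem_add_right, Sec.add_apply, riem_apply, riem_apply]

lemma curvature_smul_right (c : ℝ) :
    curvature g x u v (c • w) = c • curvature g x u v w := by
  obtain ⟨U, rfl⟩ := exists_sec_apply_eq x u
  obtain ⟨V, rfl⟩ := exists_sec_apply_eq x v
  obtain ⟨W, rfl⟩ := exists_sec_apply_eq x w
  have h := riem_fsmul_right g U V W (f := fun _ => c) contMDiff_const
  have h2 := congrArg (fun Y : Sec E M => Y x) h
  simpa [riem_apply] using h2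

/-- The endomorphism `u ↦ R(u, v) w`. -/
def curvatureTraceEnd : TangentSpace 𝓘(ℝ, E) x →ₗ[ℝ] TangentSpace 𝓘(ℝ, E) x where
  toFun u := curvature g x u v w
  map_add' _ _ := curvature_add_left g _ _ _ _
  map_smul' _ _ := curvature_smul_left g _ _ _ _

/-- The endomorphism `w ↦ R(u, v) w`. -/
def curvatureEnd : TangentSpace 𝓘(ℝ, E) x →ₗ[ℝ] TangentSpace 𝓘(ℝ, E) x where
  toFun w := curvature g x u v w
  map_add' _ _ := curvature_add_right g _ _ _ _
  map_smul' _ _ := curvature_smul_right g _ _ _ _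

@[simp] lemma curvatureTraceEnd_apply : curvatureTraceEnd g v w u = curvature g x u v w := rfl

@[simp] lemma curvatureEnd_apply : curvatureEnd g u v w = curvature g x u v w := rfl

lemma curvature_neg_left : curvature g x (-u) v w = - curvature g x u v w :=
  map_neg (curvatureTraceEnd g v w) u

lemma curvature_add_mid :
    curvature g x u (v + v') w = curvature g x u v w + curvature g x u v' w := by
  rw [curvature_swap, curvature_add_left, curvature_swap g v u, curvature_swap g v' u]
  abel

lemma curvature_smul_mid (c : ℝ) :
    curvature g x u (c • v) w = c • curvature g x u v w := by
  rw [curvature_swap, curvature_smul_left, curvature_swap g v u]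
  simp

/-- The first Bianchi identity. -/
lemma curvature_bianchi :
    curvature g x u v w + curvature g x v w u + curvature g x w u v = 0 := by
  obtain ⟨U, rfl⟩ := exists_sec_apply_eq x u
  obtain ⟨V, rfl⟩ := exists_sec_apply_eq x v
  obtain ⟨W, rfl⟩ := exists_sec_apply_eq x w
  have h : riem g U V W + riem g V W U + riem g W U V = 0 := by
    have j := brk_jacobi U V W
    simp only [riem, ← nab_sub_nab g, nab_sub_left, nab_sub_right] at j ⊢
    rw [← sub_eq_zero] at j
    rw [← j]
    abel
  have h2 := congrArg (fun Y : Sec E M => Y x) h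
  simpa [riem_apply] using h2

lemma inner_curvature_swap :
    g.inner x (curvature g x u v w) z = - g.inner x w (curvature g x u v z) := by
  obtain ⟨U, rfl⟩ := exists_sec_apply_eq x u
  obtain ⟨V, rfl⟩ := exists_sec_apply_eq x v
  obtain ⟨W, rfl⟩ := exists_sec_apply_eq x w
  obtain ⟨Z, rfl⟩ := exists_sec_apply_eq x z
  have h := differential_brk U V (smoothFn_inner g W Z) x
  simp only [differential_inner] at h
  have hadd : ∀ (P Q R S : Sec E M) (Y : Sec E M),
      differential E (fun y => g.inner y (P y) (Q y) + g.inner y (R y) (S y)) x (Y x)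
      = differential E (fun y => g.inner y (P y) (Q y)) x (Y x)
        + differential E (fun y => g.inner y (R y) (S y)) x (Y x) := fun P Q R S Y =>
    congrArg (fun A => A (Y x)) (mvfderiv_add ((smoothFn_inner g P Q).mdiffAt x)
      ((smoothFn_inner g R S).mdiffAt x))
  simp only [hadd, differential_inner] at h
  simp only [← riem_apply, riem, Sec.sub_apply, map_sub, sub_apply]
  linarith

/-- Four cyclic instances of the first Bianchi identity are added; skewness in the first pair (`s`)
and in the second pair (`t`) cancels all but the two terms compared. -/
lemma inner_curvature_pair :
    g.inner x (curvature g x u v w) z = g.inner x (curvature g x w z u) v := by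
  have b : ∀ a b c d : TangentSpace 𝓘(ℝ, E) x, g.inner x (curvature g x a b c) d
      + g.inner x (curvature g x b c a) d + g.inner x (curvature g x c a b) d = 0 := by
    intro a b c d
    have := congrArg (fun t => g.inner x t d) (curvature_bianchi g a b c)
    simpa using this
  have s : ∀ a b c d : TangentSpace 𝓘(ℝ, E) x, g.inner x (curvature g x a b c) d
      = - g.inner x (curvature g x b a c) d := by
    intro a b c d
    rw [curvature_swap, map_neg]
    rfl
  have t : ∀ a b c d : TangentSpace 𝓘(ℝ, E) x, g.inner x (curvature g x a b c) d
      = - g.inner x (curvature g x a b d) c := by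
    intro a b c d
    rw [inner_curvature_swap, g.symm]
  have h1 := b u v w z
  have h2 := b v w z u
  have h3 := b w z u v
  have h4 := b z u v w
  have e1 := t v w z u
  have e2 := t w z v u
  have e3 := t z v w u
  have e4 := t z u w v
  have e5 := s z u v w
  have e6 := t u v z w
  have e7 := t v z u w
  have e8 := s u w z v
  have e9 := t w u z v
  have e10 := s z v u w
  have e11 := t u z v w
  have e12 := s u z w v
  have e13 := t v w u z
  have e14 := t w u v z
  have e15 := s u v w z
  have e16 := s v z u w
  linarith

lemma ricci_eq_trace :
    ricci g x v w = LinearMap.trace ℝ (TangentSpace 𝓘(ℝ, E) x) (curvatureTraceEnd g v w) := by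
  let B : LinearMap.BilinForm ℝ (TangentSpace 𝓘(ℝ, E) x) := LinearMap.mk₂ ℝ
    (fun v w => LinearMap.trace ℝ (TangentSpace 𝓘(ℝ, E) x) (curvatureTraceEnd g v w))
    (fun v v' w => by
      rw [← map_add]; congr 1; ext u; exact curvature_add_mid g _ _ _ _)
    (fun c v w => by
      rw [← map_smul]; congr 1; ext u; exact curvature_smul_mid g _ _ _ _)
    (fun v w w' => by
      rw [← map_add]; congr 1; ext u; exact curvature_add_right g _ _ _ _)
    (fun c v w => by
      rw [← map_smul]; congr 1; ext u; exact curvature_smul_right g _ _ _ _)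
  have : ricci g x = B := by
    refine LinearMap.BilinForm.ext_basis (tangentBasis x) fun j k => ?_
    rw [ricci, ← LinearMap.BilinForm.toMatrix_apply (tangentBasis x),
      LinearMap.BilinForm.toMatrix_toBilin]
    simp only [Matrix.of_apply, B, LinearMap.mk₂_apply]
    rw [LinearMap.trace_eq_matrix_trace ℝ (tangentBasis x)]
    simp [Matrix.trace, LinearMap.toMatrix_apply]
  rw [this]
  rfl

/-- By the Bianchi identity the two traced endomorphisms differ by `-R(v, w)`, which is skew and so
has trace zero. -/
lemma ricci_symm : ricci g x v w = ricci g x w v := by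
  rw [ricci_eq_trace, ricci_eq_trace, ← sub_eq_zero, ← map_sub]
  refine trace_eq_zero_of_skew g fun a b => ?_
  have h : ∀ u, (curvatureTraceEnd g v w - curvatureTraceEnd g w v) u
      = - curvature g x v w u := by
    intro u
    have := curvature_bianchi g u v w
    rw [curvature_swap g w u] at this
    simp only [LinearMap.sub_apply, curvatureTraceEnd_apply]
    linear_combination (norm := module) this
  rw [h, h, map_neg, map_neg]
  simp only [neg_apply, inner_curvature_swap g v w a b]

end Curvature

/-! ### Killing fields: Kostant's identity, invariance of curvature, the dual one-form -/

section Killing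

variable {E : Type*} [NormedAddCommGroup E] [NormedSpace ℝ E] [FiniteDimensional ℝ E]
  {M : Type*} [TopologicalSpace M] [ChartedSpace E M] [IsManifold 𝓘(ℝ, E) ∞ M]

lemma ext_inner (g : RMetric E M) {x : M} {v w : TangentSpace 𝓘(ℝ, E) x}
    (h : ∀ z, g.inner x v z = g.inner x w z) : v = w :=
  eq_of_inner_eq g fun Z _ => h (Z x)

lemma inner_self_eq_zero_iff (g : RMetric E M) {x : M} {v : TangentSpace 𝓘(ℝ, E) x} :
    g.inner x v v = 0 ↔ v = 0 := by
  refine ⟨fun h => ?_, fun h => by simp [h]⟩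
  by_contra hne
  exact (g.pos x v hne).ne' h

variable [T2Space M] (g : RMetric E M)

lemma brk_sub_right (V W W' : Sec E M) : brk V (W - W') = brk V W - brk V W' := by
  have := brk_add_right V (W - W') W'
  rw [sub_add_cancel] at this
  rw [this, add_sub_cancel_right]

lemma differential_add_apply {f f' : M → ℝ} {x : M} (hf : SmoothFn E f) (hf' : SmoothFn E f')
    (v : TangentSpace 𝓘(ℝ, E) x) :
    differential E (fun y => f y + f' y) x v = differential E f x v + differential E f' x v :=
  congrArg (fun A => A v) (mvfderiv_add (hf.mdiffAt x) (hf'.mdiffAt x))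

/-- The second covariant derivative `(∇_U ∇X) V = ∇_U ∇_V X - ∇_{∇_U V} X`. -/
def secondNab (X U V : Sec E M) : Sec E M := nab g U (nab g V X) - nab g (nab g U V) X

lemma secondNab_sub_swap (X U V : Sec E M) :
    secondNab g X U V - secondNab g X V U = riem g U V X := by
  simp only [secondNab, riem, ← nab_sub_nab g U V, nab_sub_left]
  abel

section

variable {g} {X : Sec E M} (hX : IsKilling g X)
include hX

/-- Differentiating the Killing equation along `U`: the covariant derivative of the skew field `∇X`
is again skew. -/
lemma IsKilling.inner_secondNab (U V W : Sec E M) (x : M) :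
    g.inner x (secondNab g X U V x) (W x) = - g.inner x (V x) (secondNab g X U W x) := by
  have h0 : (fun y => g.inner y (nab g V X y) (W y) + g.inner y (V y) (nab g W X y))
      = fun _ => 0 := by
    ext y
    exact hX y (V y) (W y)
  have h1 : differential E (fun y => g.inner y (nab g V X y) (W y)
      + g.inner y (V y) (nab g W X y)) x (U x) = 0 := by
    rw [h0, show differential E (fun _ : M => (0 : ℝ)) x = 0 from mvfderiv_const 0]
    rfl
  rw [differential_add_apply (smoothFn_inner g _ _) (smoothFn_inner g _ _), differential_inner,
    differential_inner] at h1
  have h2 : g.inner x (nab g V X x) (nab g U W x) + g.inner x (V x) (nab g (nab g U W) X x) = 0 :=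
    hX x (V x) (nab g U W x)
  have h3 : g.inner x (nab g (nab g U V) X x) (W x) + g.inner x (nab g U V x) (nab g W X x) = 0 :=
    hX x (nab g U V x) (W x)
  simp only [secondNab, Sec.sub_apply, map_sub, sub_apply]
  linarith

/-- Kostant's identity for a Killing field. -/
lemma IsKilling.secondNab_eq (U V : Sec E M) : secondNab g X U V = riem g U X V := by
  ext x
  refine ext_inner g fun w => ?_
  obtain ⟨W, rfl⟩ := exists_sec_apply_eq x w
  -- The form `g(∇²_{A,B} X, C)` has prescribed antisymmetrization in `A, B` (`d`) and is skew in
  -- `B, C` (`s`). As for Koszul's formula this determines it, and the Bianchi identity merges the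
  -- three curvature terms into one.
  have d : ∀ A B C : Sec E M, g.inner x (secondNab g X A B x) (C x)
      - g.inner x (secondNab g X B A x) (C x) = g.inner x (riem g A B X x) (C x) := by
    intro A B C
    rw [← secondNab_sub_swap]
    simp
  have s : ∀ A B C : Sec E M, g.inner x (secondNab g X A B x) (C x)
      = - g.inner x (secondNab g X A C x) (B x) := by
    intro A B C
    rw [hX.inner_secondNab, g.symm]
  have hb := congrArg (fun t => g.inner x t (X x)) (curvature_bianchi g (U x) (V x) (W x))
  simp only [map_add, add_apply, map_zero, zero_apply] at hb
  have d1 := d U V W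
  have d2 := d V W U
  have d3 := d W U V
  have s1 := s U V W
  have s2 := s V U W
  have s3 := s W V U
  simp only [riem_apply] at d1 d2 d3 ⊢
  rw [inner_curvature_swap, g.symm x (X x)] at d1 d2 d3
  rw [inner_curvature_pair g (U x) (X x)]
  linarith

/-- Kostant's identity rewritten by means of vanishing torsion: it says `L_X ∇ = 0`. -/
lemma IsKilling.brk_nab (U V : Sec E M) :
    brk X (nab g U V) = nab g (brk X U) V + nab g U (brk X V) := by
  have h := hX.secondNab_eq U V
  have h2 := riem_swap g U X V
  rw [← h] at h2
  simp only [secondNab, riem] at h2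
  rw [← nab_sub_nab g X (nab g U V), ← nab_sub_nab g X V, nab_sub_right]
  linear_combination (norm := abel) h2

lemma IsKilling.brk_riem (U V W : Sec E M) :
    brk X (riem g U V W) = riem g (brk X U) V W + riem g U (brk X V) W + riem g U V (brk X W) := by
  simp only [riem, brk_sub_right, hX.brk_nab, nab_add_right, nab_add_left, brk_jacobi X U V]
  abel

end

/-! ### The Ricci tensor -/

lemma smoothFn_ricci (V W : Sec E M) : SmoothFn E (fun y => ricci g y (V y) (W y)) := by
  simp only [ricci_eq_trace]
  exact smoothFn_trace (fun y => curvatureTraceEnd g (V y) (W y)) (fun U => riem g U V W)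
    fun Y y => riem_apply g _ _ _ y

/-- The field `S V`. -/
def ricciSec (V : Sec E M) : Sec E M :=
  Sec.ofInner g (fun y => ricciEnd g y (V y)) fun Z => by
    simp only [inner_ricciEnd]
    exact smoothFn_ricci g V Z

@[simp] lemma ricciSec_apply (V : Sec E M) (x : M) : ricciSec g V x = ricciEnd g x (V x) := rfl

lemma inner_ricciEnd_symm {x : M} (v w : TangentSpace 𝓘(ℝ, E) x) :
    g.inner x (ricciEnd g x v) w = g.inner x v (ricciEnd g x w) := by
  rw [inner_ricciEnd, ricci_symm, ← inner_ricciEnd, g.symm]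

variable {g}

/-- `L_X R = 0`, traced: this is `differential_trace` with the derivation `L_X`, so that the flow of
`X` preserves `ρ`. -/
lemma IsKilling.differential_ricci {X : Sec E M} (hX : IsKilling g X) (V W : Sec E M) (x : M) :
    differential E (fun y => ricci g y (V y) (W y)) x (X x)
      = ricci g x (brk X V x) (W x) + ricci g x (V x) (brk X W x) := by
  simp only [ricci_eq_trace]
  rw [← map_add]
  refine differential_trace X (brk X) (brk_add_right X)
    (fun f hf Y y => by rw [brk_fsmul_right]; rfl)
    (fun y => curvatureTraceEnd g (V y) (W y)) (fun U => riem g U V W)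
    (fun Y y => riem_apply g _ _ _ y) x _ fun Y => ?_
  simp only [hX.brk_riem, LinearMap.add_apply, curvatureTraceEnd_apply, Sec.add_apply, riem_apply]
  abel

/-- `∇_X S = [∇X, S]` for a Killing field `X`. -/
lemma IsKilling.nab_ricciSec {X : Sec E M} (hX : IsKilling g X) (V : Sec E M) (x : M) :
    nab g X (ricciSec g V) x - ricciEnd g x (nab g X V x)
      = leviCivita g X x (ricciEnd g x (V x)) - ricciEnd g x (leviCivita g X x (V x)) := by
  refine ext_inner g fun w => ?_
  obtain ⟨W, rfl⟩ := exists_sec_apply_eq x w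
  have h := hX.differential_ricci V W x
  have h2 := differential_inner g X (ricciSec g V) W x
  simp only [ricciSec_apply, inner_ricciEnd] at h2
  -- Replacing `[X, ·]` by `∇_X - ∇_· X` turns invariance of `ρ` under the flow into a formula for
  -- `∇_X S`.
  rw [h, ← nab_sub_nab g X V, ← nab_sub_nab g X W] at h2
  have h3 := hX x (ricciEnd g x (V x)) (W x)
  simp only [inner_ricciEnd] at h3
  simp only [Sec.sub_apply, map_sub, sub_apply, LinearMap.sub_apply, nab_apply g V X,
    nab_apply g W X, inner_ricciEnd] at h2 ⊢
  linarith

variable (g)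

lemma exists_covDerivEnd_eq (A : EndField E M) (A' : Sec E M → Sec E M)
    (hA : ∀ Y y, A' Y y = A y (Y y)) (x : M) (w : TangentSpace 𝓘(ℝ, E) x) :
    ∃ W : Sec E M, W x = w ∧ ∀ v, covDerivEnd g A x v w
      = leviCivita g (fun y => A' W y) x v - A x (leviCivita g (fun y => W y) x v) := by
  obtain ⟨W, hW⟩ := exists_sec_extend x w
  refine ⟨W, by simpa using hW.self_of_nhds, fun v => ?_⟩
  rw [leviCivita_congr g (W.mdiffAt x) hW, leviCivita_congr g ((A' W).mdiffAt x)
    (W := fun y => A y (FiberBundle.extend E w y))]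
  · rfl
  · filter_upwards [hW] with y hy
    rw [hA, hy]

/-! ### The one-form dual to a Killing field -/

lemma extDerivOneForm_apply {α : OneForm E M} {x : M} (hα : OneFormDifferentiableAt α x)
    (V W : Sec E M) :
    extDerivOneForm α x (V x) (W x) = extDerivAux α (fun y => V y) (fun y => W y) x := by
  rw [extDerivOneForm, dif_pos hα]
  exact TensorialAt.mkHom₂_apply (fun _ _ => extDerivAux_tensorial_left hα)
    (fun _ _ => extDerivAux_tensorial_right hα) (V.mdiffAt x) (W.mdiffAt x)

section

variable {g} {X : Sec E M} (hX : IsKilling g X) {ψ : OneForm E M}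
  (hψ : ∀ x, ψ x = g.inner x (X x))
include hX hψ

lemma IsKilling.extDerivOneForm_eq (x : M) (v w : TangentSpace 𝓘(ℝ, E) x) :
    extDerivOneForm ψ x v w = 2 * g.inner x (leviCivita g X x v) w := by
  obtain ⟨V, rfl⟩ := exists_sec_apply_eq x v
  obtain ⟨W, rfl⟩ := exists_sec_apply_eq x w
  have hd : OneFormDifferentiableAt ψ x := by
    intro Y hY
    simp only [hψ]
    exact mdifferentiableAt_inner g (X.mdiffAt x) hY
  rw [extDerivOneForm_apply hd]
  have h1 := differential_inner g V X W x
  have h2 := differential_inner g W X V x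
  have h3 := hX x (V x) (W x)
  have h4 := g.symm x (V x) (leviCivita g X x (W x))
  simp only [extDerivAux, hψ, ← brk_apply, ← nab_sub_nab g V W, Sec.sub_apply, map_sub] at *
  rw [nab_apply g V X] at h1
  rw [nab_apply g W X] at h2
  linarith

/-- `∇X` is skew, hence has trace zero. -/
lemma IsKilling.codiffOneForm_eq_zero : codiffOneForm g ψ = 0 := by
  ext x
  have h : (fun y => sharp g y (ψ y)) = fun y => X y := by
    ext y
    refine ext_inner g fun z => ?_
    rw [inner_sharp, hψ]
  rw [codiffOneForm, h, trace_eq_zero_of_skew g]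
  · simp
  · intro v w
    have := hX x v w
    simp only [ContinuousLinearMap.coe_coe]
    linarith

/-- Since `dψ = 2g(∇X ·, ·)`, its covariant derivative is twice the second derivative of `X`, to
which Kostant's identity applies. -/
lemma IsKilling.covDerivTwoForm_eq (x : M) (u v w : TangentSpace 𝓘(ℝ, E) x) :
    covDerivTwoForm g (extDerivOneForm ψ) x u v w
      = 2 * g.inner x (curvature g x u (X x) v) w := by
  obtain ⟨U, rfl⟩ := exists_sec_apply_eq x u
  obtain ⟨V, hV⟩ := exists_sec_extend x v
  obtain ⟨W, hW⟩ := exists_sec_extend x w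
  obtain rfl : V x = v := by simpa using hV.self_of_nhds
  obtain rfl : W x = w := by simpa using hW.self_of_nhds
  have h1 : differential E (fun y => extDerivOneForm ψ y (FiberBundle.extend E (V x) y)
      (FiberBundle.extend E (W x) y)) x
      = differential E (fun y => 2 * g.inner y (nab g V X y) (W y)) x := by
    refine differential_congr ?_
    filter_upwards [hV, hW] with y hVy hWy
    rw [hX.extDerivOneForm_eq hψ, ← hVy, ← hWy]
    rfl
  have h2 : differential E (fun y => 2 * g.inner y (nab g V X y) (W y)) x (U x)
      = 2 * differential E (fun y => g.inner y (nab g V X y) (W y)) x (U x) := by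
    have : (fun y => 2 * g.inner y (nab g V X y) (W y))
        = fun y => g.inner y (nab g V X y) (W y) + g.inner y (nab g V X y) (W y) := by
      ext y; ring
    rw [this, differential_add_apply (smoothFn_inner g _ _) (smoothFn_inner g _ _)]
    ring
  have h3 := congrArg (fun Y : Sec E M => g.inner x (Y x) (W x)) (hX.secondNab_eq U V)
  simp only [secondNab, Sec.sub_apply, map_sub, sub_apply, riem_apply] at h3
  have h4 := hX.extDerivOneForm_eq hψ x (leviCivita g (fun y => V y) x (U x)) (W x)
  have h5 := hX.extDerivOneForm_eq hψ x (V x) (leviCivita g (fun y => W y) x (U x))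
  rw [covDerivTwoForm, ← leviCivita_congr g (V.mdiffAt x) hV,
    ← leviCivita_congr g (W.mdiffAt x) hW, h4, h5]
  change differential E _ x (U x) - _ - _ = _
  rw [h1, h2, differential_inner]
  simp only [nab_apply] at h3 ⊢
  linarith

/-- As `δψ = 0`, only `δdψ` contributes. Skewness of `R(u, X)` turns each summand into a diagonal
entry of `u ↦ R(u, X)w`, whose trace is the Ricci tensor. -/
lemma IsKilling.hodgeLaplacian_eq (x : M) (w : TangentSpace 𝓘(ℝ, E) x) :
    hodgeLaplacian g ψ x w = 2 * ricci g x (X x) w := by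
  rw [hodgeLaplacian, hX.codiffOneForm_eq_zero hψ, codiffTwoForm]
  have h0 : differential E (0 : M → ℝ) x w = 0 := by
    rw [show differential E (0 : M → ℝ) x = 0 from mvfderiv_const 0]
    rfl
  rw [h0, zero_add, ricci_eq_trace, LinearMap.trace_eq_matrix_trace ℝ (tangentBasis x),
    Matrix.trace, Finset.mul_sum, ← Finset.sum_neg_distrib]
  refine Finset.sum_congr rfl fun i _ => ?_
  rw [hX.covDerivTwoForm_eq hψ, inner_curvature_swap, inner_sharp]
  simp [LinearMap.toMatrix_apply]

end

end Killing

/-! ### Curvature identities of a Kähler structure -/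

namespace KahlerStructure

variable {E : Type*} [NormedAddCommGroup E] [NormedSpace ℝ E] [FiniteDimensional ℝ E]
  {M : Type*} [TopologicalSpace M] [ChartedSpace E M] [IsManifold 𝓘(ℝ, E) ∞ M]
  (K : KahlerStructure E M)

/-- The field `J Y`. -/
def Jsec (Y : Sec E M) : Sec E M :=
  ⟨fun y => K.J y (Y y), ContMDiff.clm_bundle_apply K.J_smooth Y.contMDiff⟩

@[simp] lemma Jsec_apply (Y : Sec E M) (x : M) : K.Jsec Y x = K.J x (Y x) := rfl

lemma inner_J_left {x : M} (v w : TangentSpace 𝓘(ℝ, E) x) :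
    K.g.inner x (K.J x v) w = - K.g.inner x v (K.J x w) := by
  rw [← K.J_orthogonal x v, K.J_sq]
  simp

lemma inner_J_self {x : M} (v : TangentSpace 𝓘(ℝ, E) x) :
    K.g.inner x v (K.J x v) = 0 := by
  have h1 := K.inner_J_left v v
  have h2 := K.g.symm x (K.J x v) v
  linarith

variable [T2Space M]

lemma nab_Jsec (V Y : Sec E M) : nab K.g V (K.Jsec Y) = K.Jsec (nab K.g V Y) := by
  ext x
  exact K.J_parallel x _ (Y.mdiffAt x) (V x)

variable {x : M} (u v w : TangentSpace 𝓘(ℝ, E) x)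

lemma curvature_J_right : curvature K.g x u v (K.J x w) = K.J x (curvature K.g x u v w) := by
  obtain ⟨U, rfl⟩ := exists_sec_apply_eq x u
  obtain ⟨V, rfl⟩ := exists_sec_apply_eq x v
  obtain ⟨W, rfl⟩ := exists_sec_apply_eq x w
  rw [← Jsec_apply, ← riem_apply, ← riem_apply, ← Jsec_apply]
  congr 1
  ext y
  simp [riem, nab_Jsec]

/-- `R(u, v)` commutes with `J`, that is, `R` is `J`-invariant in its last pair; pair symmetry moves
this to the first pair. -/
lemma curvature_J_J : curvature K.g x (K.J x u) (K.J x v) w = curvature K.g x u v w := by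
  refine ext_inner K.g fun z => ?_
  rw [inner_curvature_pair, curvature_J_right, K.J_orthogonal, ← inner_curvature_pair]

/-- The endomorphism `u ↦ R(u, Jv)Jw` is the conjugate of `u ↦ R(u, v)w` by `J`, so the traces
agree. -/
lemma ricci_J_J : ricci K.g x (K.J x v) (K.J x w) = ricci K.g x v w := by
  rw [ricci_eq_trace, ricci_eq_trace]
  have h : curvatureTraceEnd K.g (K.J x v) (K.J x w)
      = -((K.J x).toLinearMap ∘ₗ curvatureTraceEnd K.g v w ∘ₗ (K.J x).toLinearMap) := by
    ext u
    have := K.curvature_J_J (K.J x u) v w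
    rw [K.J_sq, curvature_neg_left] at this
    simp [curvature_J_right, ← this]
  have hJ : (K.J x).toLinearMap ∘ₗ (K.J x).toLinearMap = -LinearMap.id := by
    ext u; simp [K.J_sq]
  rw [h, map_neg, LinearMap.trace_comp_comm', LinearMap.comp_assoc, hJ]
  simp [LinearMap.comp_neg]

lemma ricciEnd_J : ricciEnd K.g x (K.J x v) = K.J x (ricciEnd K.g x v) := by
  refine ext_inner K.g fun z => ?_
  rw [K.inner_J_left, inner_ricciEnd, inner_ricciEnd, ← K.ricci_J_J v, K.J_sq]
  simp

/-- `tr (J ∘ R(v, J w)) = 2 ρ(v, w)`. -/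
lemma trace_J_curvature :
    LinearMap.trace ℝ (TangentSpace 𝓘(ℝ, E) x)
      ((K.J x).toLinearMap ∘ₗ curvatureEnd K.g v (K.J x w)) = 2 * ricci K.g x v w := by
  have hJ : (K.J x).toLinearMap ∘ₗ (K.J x).toLinearMap = -LinearMap.id := by
    ext u; simp [K.J_sq]
  have h : (K.J x).toLinearMap ∘ₗ curvatureEnd K.g v (K.J x w)
      = curvatureTraceEnd K.g w v
        - ((K.J x).toLinearMap ∘ₗ curvatureTraceEnd K.g v w ∘ₗ (K.J x).toLinearMap) := by
    ext u
    -- Bianchi splits `J R(v, Jw)` into two endomorphisms; both have Ricci traces, the second after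
    -- conjugation by `J`.
    have h1 := curvature_bianchi K.g v (K.J x w) (K.J x u)
    rw [curvature_swap K.g (K.J x w), K.curvature_J_J, K.curvature_J_right,
      K.curvature_J_right] at h1
    simp only [LinearMap.comp_apply, LinearMap.sub_apply, curvatureEnd_apply,
      curvatureTraceEnd_apply, ContinuousLinearMap.coe_coe]
    linear_combination (norm := module) h1
  rw [h, map_sub, LinearMap.trace_comp_comm', LinearMap.comp_assoc, hJ, ← ricci_eq_trace,
    LinearMap.comp_neg, map_neg, LinearMap.comp_id, ← ricci_eq_trace, ricci_symm]
  ring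

end KahlerStructure

/-! ### Gradients and Hessians -/

section Gradient

variable {E : Type*} [NormedAddCommGroup E] [NormedSpace ℝ E] [FiniteDimensional ℝ E]
  {M : Type*} [TopologicalSpace M] [ChartedSpace E M] [IsManifold 𝓘(ℝ, E) ∞ M]

lemma inner_grad (g : RMetric E M) (f : M → ℝ) (x : M) (v : TangentSpace 𝓘(ℝ, E) x) :
    g.inner x (grad g f x) v = differential E f x v :=
  inner_sharp g x _ v

lemma grad_eq_zero_iff (g : RMetric E M) (f : M → ℝ) (x : M) :
    grad g f x = 0 ↔ differential E f x = 0 := by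
  constructor
  · intro h
    ext v
    rw [← inner_grad g, h]
    simp
  · intro h
    rw [← inner_self_eq_zero_iff g, inner_grad, h]
    rfl

lemma exists_ne_zero_orthogonal (g : RMetric E M) (x : M) {k : ℕ} (hk : k < Module.finrank ℝ E)
    (w : Fin k → TangentSpace 𝓘(ℝ, E) x) :
    ∃ v : TangentSpace 𝓘(ℝ, E) x, v ≠ 0 ∧ ∀ i, g.inner x v (w i) = 0 := by
  let L : TangentSpace 𝓘(ℝ, E) x →ₗ[ℝ] (Fin k → ℝ) :=
    LinearMap.pi fun i => (g.inner x (w i)).toLinearMap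
  have h : LinearMap.ker L ≠ ⊥ := by
    refine LinearMap.ker_ne_bot_of_finrank_lt ?_
    rw [Module.finrank_fin_fun]
    exact hk
  obtain ⟨v, hv, hne⟩ := Submodule.exists_mem_ne_zero_of_ne_bot h
  refine ⟨v, hne, fun i => ?_⟩
  rw [g.symm]
  exact congrFun hv i

/-- The Hessian as an endomorphism field. -/
def hessEnd (g : RMetric E M) (f : M → ℝ) : EndField E M := leviCivita g (grad g f)

variable [T2Space M]

/-- The gradient of a smooth function as a smooth field. -/
def gradSec (g : RMetric E M) {f : M → ℝ} (hf : SmoothFn E f) : Sec E M :=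
  Sec.ofInner g (grad g f) fun Z => by
    simp only [inner_grad]
    exact smoothFn_differential hf Z

@[simp] lemma gradSec_apply (g : RMetric E M) {f : M → ℝ} (hf : SmoothFn E f) (x : M) :
    gradSec g hf x = grad g f x := rfl

lemma nab_gradSec_apply (g : RMetric E M) {f : M → ℝ} (hf : SmoothFn E f) (V : Sec E M) (x : M) :
    nab g V (gradSec g hf) x = hessEnd g f x (V x) := rfl

/-- Symmetry of the Hessian: torsion-freeness together with `V(Wf) - W(Vf) = [V, W]f`. -/
lemma inner_hessEnd (g : RMetric E M) {f : M → ℝ} (hf : SmoothFn E f) {x : M}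
    (v w : TangentSpace 𝓘(ℝ, E) x) :
    g.inner x (hessEnd g f x v) w = g.inner x v (hessEnd g f x w) := by
  obtain ⟨V, rfl⟩ := exists_sec_apply_eq x v
  obtain ⟨W, rfl⟩ := exists_sec_apply_eq x w
  have h := differential_brk V W hf x
  have h1 := differential_inner g V (gradSec g hf) W x
  have h2 := differential_inner g W (gradSec g hf) V x
  simp only [gradSec_apply, inner_grad, nab_gradSec_apply] at h1 h2
  rw [h1, h2, ← nab_sub_nab g V W, Sec.sub_apply, map_sub, g.symm x (hessEnd g f x (W x))] at h
  linarith

lemma differential_inner_grad_self (g : RMetric E M) {f : M → ℝ} (hf : SmoothFn E f) (x : M)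
    (v : TangentSpace 𝓘(ℝ, E) x) :
    differential E (fun y => g.inner y (grad g f y) (grad g f y)) x v
      = 2 * g.inner x v (hessEnd g f x (grad g f x)) := by
  obtain ⟨V, rfl⟩ := exists_sec_apply_eq x v
  have h := differential_inner g V (gradSec g hf) (gradSec g hf) x
  simp only [gradSec_apply, nab_gradSec_apply] at h
  rw [h, g.symm x (grad g f x), inner_hessEnd g hf]
  ring

/-- A Leibniz rule for a factor that is only differentiable at `x`: the eigenvalue functions are
smooth only on `U`, so global multiplication `Sec.fsmul` is not available for them. -/
lemma leviCivita_eq_of_eventually_smul (g : RMetric E M) {Z W : Sec E M} {f : M → ℝ} {x : M}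
    (hf : MDiffAt f x) (h : ∀ᶠ y in 𝓝 x, Z y = f y • W y) (v : TangentSpace 𝓘(ℝ, E) x) :
    leviCivita g (fun y => Z y) x v
      = differential E f x v • W x + f x • leviCivita g (fun y => W y) x v := by
  have h1 := leviCivita_congr g (W := f • fun y => W y) (Z.mdiffAt x) h
  have h2 := (leviCivita g).isCovariantDerivativeOnUniv.leibniz (W.mdiffAt x) hf
    (Set.mem_univ x)
  rw [h1]
  refine (congrArg (fun A => A v) h2).trans ?_
  simp [add_comm]

lemma laplacian_eq (g : RMetric E M) (f : M → ℝ) :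
    laplacian g f = fun y =>
      -LinearMap.trace ℝ (TangentSpace 𝓘(ℝ, E) y) (hessEnd g f y).toLinearMap := rfl

lemma smoothFn_trace_hessEnd (g : RMetric E M) {f : M → ℝ} (hf : SmoothFn E f) :
    SmoothFn E fun y =>
      LinearMap.trace ℝ (TangentSpace 𝓘(ℝ, E) y) (hessEnd g f y).toLinearMap :=
  smoothFn_trace (fun y => (hessEnd g f y).toLinearMap) (fun V => nab g V (gradSec g hf))
    fun _ _ => rfl

end Gradient

/-! ### The Hessian of a special Kähler potential and its covariant derivative -/

namespace KahlerStructure.IsSpecialKahlerPotential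

variable {E : Type*} [NormedAddCommGroup E] [NormedSpace ℝ E] [FiniteDimensional ℝ E]
  {M : Type*} [TopologicalSpace M] [ChartedSpace E M] [IsManifold 𝓘(ℝ, E) ∞ M] [T2Space M]
  {K : KahlerStructure E M} {τ : M → ℝ} (hτ : K.IsSpecialKahlerPotential τ)
include hτ

/-- The gradient of the potential as a smooth field. -/
def gradField : Sec E M := gradSec K.g hτ.smooth

/-- The Killing field of the potential as a smooth field. -/
def killingField : Sec E M := K.Jsec hτ.gradField

@[simp] lemma gradField_apply (x : M) : hτ.gradField x = grad K.g τ x := rfl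

@[simp] lemma killingField_apply (x : M) : hτ.killingField x = K.Jgrad τ x := rfl

lemma isKilling_killingField : IsKilling K.g hτ.killingField := hτ.killing

lemma leviCivita_Jgrad {x : M} (v : TangentSpace 𝓘(ℝ, E) x) :
    leviCivita K.g (K.Jgrad τ) x v = K.J x (hessEnd K.g τ x v) :=
  K.J_parallel x _ (hτ.gradField.mdiffAt x) v

/-- The Killing condition says that `JH` is skew; with `H` symmetric and `J` skew this is `HJ = JH`.
-/
lemma hessEnd_J {x : M} (v : TangentSpace 𝓘(ℝ, E) x) :
    hessEnd K.g τ x (K.J x v) = K.J x (hessEnd K.g τ x v) := by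
  refine ext_inner K.g fun z => ?_
  have h := hτ.killing x v z
  rw [hτ.leviCivita_Jgrad, hτ.leviCivita_Jgrad] at h
  rw [inner_hessEnd K.g hτ.smooth, K.inner_J_left]
  have h1 := K.inner_J_left v (hessEnd K.g τ x z)
  have h2 := K.inner_J_left (hessEnd K.g τ x v) z
  linarith

/-- The covariant derivative of the Hessian, in terms of the curvature. -/
lemma secondNab_gradField (U V : Sec E M) (x : M) :
    secondNab K.g hτ.gradField U V x
      = -K.J x (curvature K.g x (U x) (K.Jgrad τ x) (V x)) := by
  have h1 : K.Jsec (secondNab K.g hτ.gradField U V) = secondNab K.g hτ.killingField U V := by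
    have : ∀ Y Z : Sec E M, K.Jsec (Y - Z) = K.Jsec Y - K.Jsec Z := by
      intro Y Z
      ext y
      simp
    simp only [secondNab, this, killingField, K.nab_Jsec]
  have h2 := congrArg (fun Y : Sec E M => K.J x (Y x))
    (h1.trans (hτ.isKilling_killingField.secondNab_eq U V))
  simp only [Jsec_apply, K.J_sq, riem_apply, killingField_apply] at h2
  rw [← h2, neg_neg]

/-- `-tr(∇_v H)` equals `tr(J ∘ R(v, J∇τ))`, which the Kähler identity `trace_J_curvature` evaluates
as `2ρ(v, ∇τ)`. -/
lemma differential_laplacian (x : M) (v : TangentSpace 𝓘(ℝ, E) x) :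
    differential E (laplacian K.g τ) x v = 2 * ricci K.g x (grad K.g τ x) v := by
  obtain ⟨V, rfl⟩ := exists_sec_apply_eq x v
  have h := differential_trace V (nab K.g V) (nab_add_right K.g V)
    (fun f hf Y y => by rw [nab_fsmul_right]; rfl)
    (fun y => (hessEnd K.g τ y).toLinearMap) (fun U => nab K.g U hτ.gradField)
    (fun Y y => rfl) x
    (-((K.J x).toLinearMap ∘ₗ curvatureEnd K.g (V x) (K.J x (grad K.g τ x))))
    (fun Y => by
      have := hτ.secondNab_gradField V Y x
      simp only [secondNab, Sec.sub_apply] at this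
      exact this.symm)
  rw [map_neg, K.trace_J_curvature, ricci_symm] at h
  have h2 : differential E (fun y =>
      -LinearMap.trace ℝ (TangentSpace 𝓘(ℝ, E) y) (hessEnd K.g τ y).toLinearMap) x
      = -differential E (fun y =>
        LinearMap.trace ℝ (TangentSpace 𝓘(ℝ, E) y) (hessEnd K.g τ y).toLinearMap) x :=
    mvfderiv_neg
  rw [laplacian_eq, h2, neg_apply, h, neg_neg]

/-! ### The derivative of the Hessian as a tensor -/

omit hτ in
/-- The tensor `-J R(u, J∇τ) v`, which is the covariant derivative of the Hessian. -/
def _root_.KahlerGeometry.KahlerStructure.dHess (K : KahlerStructure E M) (τ : M → ℝ) (x : M)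
    (u v : TangentSpace 𝓘(ℝ, E) x) : TangentSpace 𝓘(ℝ, E) x :=
  -K.J x (curvature K.g x u (K.Jgrad τ x) v)

lemma dHess_sub_swap {x : M} (u v : TangentSpace 𝓘(ℝ, E) x) :
    K.dHess τ x u v - K.dHess τ x v u = curvature K.g x u v (grad K.g τ x) := by
  obtain ⟨U, rfl⟩ := exists_sec_apply_eq x u
  obtain ⟨V, rfl⟩ := exists_sec_apply_eq x v
  have h := congrArg (fun Y : Sec E M => Y x) (secondNab_sub_swap K.g hτ.gradField U V)
  simp only [Sec.sub_apply, hτ.secondNab_gradField, riem_apply, gradField_apply] at h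
  exact h

omit hτ in
lemma inner_dHess {x : M} (u v w : TangentSpace 𝓘(ℝ, E) x) :
    K.g.inner x (K.dHess τ x u v) w = K.g.inner x v (K.dHess τ x u w) := by
  have h1 := K.inner_J_left (curvature K.g x u (K.Jgrad τ x) v) w
  have h2 := inner_curvature_swap K.g u (K.Jgrad τ x) v (K.J x w)
  rw [K.curvature_J_right] at h2
  simp only [KahlerStructure.dHess, map_neg, neg_apply]
  linarith

omit hτ in
lemma dHess_J_right {x : M} (u v : TangentSpace 𝓘(ℝ, E) x) :
    K.dHess τ x u (K.J x v) = K.J x (K.dHess τ x u v) := by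
  simp [KahlerStructure.dHess, K.curvature_J_right]

omit hτ in
lemma J_dHess {x : M} (u v : TangentSpace 𝓘(ℝ, E) x) :
    K.J x (K.dHess τ x u v) = curvature K.g x u (K.Jgrad τ x) v := by
  simp [KahlerStructure.dHess, K.J_sq]

omit hτ in
lemma dHess_Jgrad {x : M} (v : TangentSpace 𝓘(ℝ, E) x) :
    K.dHess τ x (K.Jgrad τ x) v = 0 := by
  have h := curvature_swap K.g (K.Jgrad τ x) (K.Jgrad τ x) v
  have h2 : curvature K.g x (K.Jgrad τ x) (K.Jgrad τ x) v = 0 := by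
    have h3 := eq_neg_iff_add_eq_zero.1 h
    rw [← two_smul ℝ] at h3
    exact (smul_eq_zero.1 h3).resolve_left two_ne_zero
  simp [KahlerStructure.dHess, h2]

lemma leviCivita_hessEnd (U V : Sec E M) (x : M) :
    leviCivita K.g (fun y => hessEnd K.g τ y (V y)) x (U x)
      = K.dHess τ x (U x) (V x)
        + hessEnd K.g τ x (leviCivita K.g (fun y => V y) x (U x)) := by
  have h := hτ.secondNab_gradField U V x
  simp only [secondNab, Sec.sub_apply] at h
  rw [sub_eq_iff_eq_add] at h
  exact h

end KahlerStructure.IsSpecialKahlerPotential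

/-! ### Eigenvalues of the Hessian on the vertical and horizontal spaces -/

namespace KahlerStructure

variable {E : Type*} [NormedAddCommGroup E] [NormedSpace ℝ E] [FiniteDimensional ℝ E]
  {M : Type*} [TopologicalSpace M] [ChartedSpace E M] [IsManifold 𝓘(ℝ, E) ∞ M]
  (K : KahlerStructure E M) (τ : M → ℝ)

/-- The eigenvalue function of the Hessian on `𝒱`. -/
def eigV (x : M) : ℝ :=
  K.g.inner x (hessEnd K.g τ x (grad K.g τ x)) (grad K.g τ x) / K.normSqGrad τ x

/-- The eigenvalue function of the Hessian on `ℋ`. -/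
def eigH (x : M) : ℝ :=
  (LinearMap.trace ℝ (TangentSpace 𝓘(ℝ, E) x) (hessEnd K.g τ x).toLinearMap - 2 * K.eigV τ x)
    / (Module.finrank ℝ E - 2)

/-- The eigenvalue function of the Ricci endomorphism on `𝒱`. -/
def eigRic (x : M) : ℝ := ricci K.g x (grad K.g τ x) (grad K.g τ x) / K.normSqGrad τ x

variable {τ} {x : M}

/-- The vector `v` is orthogonal to `∇τ` and `J∇τ`. -/
def IsHor (K : KahlerStructure E M) (τ : M → ℝ) {x : M} (v : TangentSpace 𝓘(ℝ, E) x) : Prop :=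
  K.g.inner x v (grad K.g τ x) = 0 ∧ K.g.inner x v (K.Jgrad τ x) = 0

lemma normSqGrad_eq_zero_iff : K.normSqGrad τ x = 0 ↔ differential E τ x = 0 := by
  rw [normSqGrad, inner_self_eq_zero_iff, grad_eq_zero_iff]

lemma inner_grad_Jgrad : K.g.inner x (grad K.g τ x) (K.Jgrad τ x) = 0 := K.inner_J_self _

lemma inner_Jgrad_grad : K.g.inner x (K.Jgrad τ x) (grad K.g τ x) = 0 := by
  rw [K.g.symm, K.inner_grad_Jgrad]

lemma inner_Jgrad_Jgrad : K.g.inner x (K.Jgrad τ x) (K.Jgrad τ x) = K.normSqGrad τ x :=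
  K.J_orthogonal x _ _

lemma J_Jgrad : K.J x (K.Jgrad τ x) = - grad K.g τ x := K.J_sq x _

lemma mem_horizontal_iff (v : TangentSpace 𝓘(ℝ, E) x) :
    v ∈ K.horizontal τ x ↔ K.IsHor τ v := by
  constructor
  · intro h
    exact ⟨h _ (Submodule.subset_span (by simp)), h _ (Submodule.subset_span (by simp))⟩
  · rintro ⟨h1, h2⟩ w hw
    obtain ⟨a, b, rfl⟩ := Submodule.mem_span_pair.1 hw
    simp [h1, h2]

variable {K}

lemma IsHor.J {v : TangentSpace 𝓘(ℝ, E) x} (hv : K.IsHor τ v) : K.IsHor τ (K.J x v) := by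
  refine ⟨?_, ?_⟩
  · rw [K.inner_J_left]
    exact neg_eq_zero.2 hv.2
  · rw [K.inner_J_left, K.J_Jgrad, map_neg, hv.1, neg_zero, neg_zero]

variable (K)

lemma isHor_projH (hx : K.normSqGrad τ x ≠ 0) (v : TangentSpace 𝓘(ℝ, E) x) :
    K.IsHor τ (K.projH τ x v) := by
  have h1 : K.g.inner x (grad K.g τ x) (grad K.g τ x) = K.normSqGrad τ x := rfl
  constructor
  · simp [projH, projV, h1, inner_Jgrad_grad, hx]
  · simp [projH, projV, inner_grad_Jgrad, inner_Jgrad_Jgrad, hx]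

lemma projV_add_projH (v : TangentSpace 𝓘(ℝ, E) x) : K.projV τ x v + K.projH τ x v = v := by
  simp [projH]

lemma projV_mem (v : TangentSpace 𝓘(ℝ, E) x) : K.projV τ x v ∈ K.vertical τ x :=
  Submodule.mem_span_pair.2 ⟨_, _, rfl⟩

lemma apply_eq_of_isHor {F : Type*} [AddCommGroup F] [Module ℝ F] (hx : K.normSqGrad τ x ≠ 0)
    (A : TangentSpace 𝓘(ℝ, E) x →ₗ[ℝ] F) (hX : A (K.Jgrad τ x) = 0)
    (hH : ∀ v, K.IsHor τ v → A v = 0) (v : TangentSpace 𝓘(ℝ, E) x) :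
    A v = (K.g.inner x v (grad K.g τ x) / K.normSqGrad τ x) • A (grad K.g τ x) := by
  conv_lhs => rw [← K.projV_add_projH (τ := τ) v]
  rw [map_add, hH _ (K.isHor_projH hx v), projV, map_add, map_smul, map_smul, hX]
  simp

/-- Four linear conditions in real dimension at least six. With `u' = Ju` it supplies a horizontal
vector orthogonal to the complex line of `u`. -/
lemma exists_isHor_orthogonal (hdim : 6 ≤ Module.finrank ℝ E) (u u' : TangentSpace 𝓘(ℝ, E) x) :
    ∃ v : TangentSpace 𝓘(ℝ, E) x, v ≠ 0 ∧ K.IsHor τ v ∧ K.g.inner x v u = 0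
      ∧ K.g.inner x v u' = 0 := by
  obtain ⟨v, hv, h⟩ := exists_ne_zero_orthogonal K.g x (k := 4) (by omega)
    ![grad K.g τ x, K.Jgrad τ x, u, u']
  exact ⟨v, hv, ⟨h 0, h 1⟩, h 2, h 3⟩

namespace IsSpecialKahlerPotential

variable {K} [T2Space M] (hτ : K.IsSpecialKahlerPotential τ)
include hτ

lemma smoothFn_normSqGrad : SmoothFn E (K.normSqGrad τ) :=
  smoothFn_inner K.g hτ.gradField hτ.gradField

lemma eventually_normSqGrad_ne_zero (hx : K.normSqGrad τ x ≠ 0) :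
    ∀ᶠ y in 𝓝 x, K.normSqGrad τ y ≠ 0 :=
  hτ.smoothFn_normSqGrad.continuous.continuousAt.eventually_ne hx

lemma contMDiffAt_eigV (hx : K.normSqGrad τ x ≠ 0) :
    ContMDiffAt 𝓘(ℝ, E) 𝓘(ℝ, ℝ) ∞ (K.eigV τ) x :=
  (smoothFn_inner K.g (nab K.g hτ.gradField hτ.gradField) hτ.gradField).contMDiffAt.div₀
    hτ.smoothFn_normSqGrad.contMDiffAt hx

lemma contMDiffAt_eigRic (hx : K.normSqGrad τ x ≠ 0) :
    ContMDiffAt 𝓘(ℝ, E) 𝓘(ℝ, ℝ) ∞ (K.eigRic τ) x :=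
  (smoothFn_ricci K.g hτ.gradField hτ.gradField).contMDiffAt.div₀
    hτ.smoothFn_normSqGrad.contMDiffAt hx

lemma contMDiffAt_eigH (hx : K.normSqGrad τ x ≠ 0) :
    ContMDiffAt 𝓘(ℝ, E) 𝓘(ℝ, ℝ) ∞ (K.eigH τ) x := by
  have h := ((smoothFn_trace_hessEnd K.g hτ.smooth).contMDiffAt (x := x)).sub
    ((contMDiffAt_const (c := (2 : ℝ))).mul (hτ.contMDiffAt_eigV hx))
  have h2 := h.mul (contMDiffAt_const (c := ((Module.finrank ℝ E : ℝ) - 2)⁻¹))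
  exact h2

/-- A linear map for which every nonzero vector of a subspace is an eigenvector is scalar on it: for
independent `v`, `w'` the eigenvector `v + w'` forces equal eigenvalues. -/
lemma exists_hessEnd_eq_smul (hdim : 6 ≤ Module.finrank ℝ E) (hx : K.normSqGrad τ x ≠ 0) :
    ∃ μ : ℝ, ∀ v, K.IsHor τ v → hessEnd K.g τ x v = μ • v := by
  have hd : differential E τ x ≠ 0 := fun h => hx (K.normSqGrad_eq_zero_iff.2 h)
  have key : ∀ v, v ≠ 0 → K.IsHor τ v → ∃ μ : ℝ, hessEnd K.g τ x v = μ • v := by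
    intro v hv hh
    obtain ⟨μ, h⟩ := hτ.eigenvector x hd v hv hh.2 (by rw [K.J_Jgrad, map_neg, hh.1, neg_zero])
    refine ⟨μ, ext_inner K.g fun z => ?_⟩
    rw [map_smul]
    exact h z
  obtain ⟨v, hv, hvh, -, -⟩ := K.exists_isHor_orthogonal (τ := τ) hdim 0 (0 : TangentSpace 𝓘(ℝ, E) x)
  obtain ⟨μ, hμ⟩ := key v hv hvh
  refine ⟨μ, fun w hw => ?_⟩
  have hvv : K.g.inner x v v ≠ 0 := fun h => hv ((inner_self_eq_zero_iff K.g).1 h)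
  set c : ℝ := K.g.inner x w v / K.g.inner x v v with hc
  set w' := w - c • v with hw'
  have hww : w = c • v + w' := by rw [hw']; abel
  have horth : K.g.inner x w' v = 0 := by
    simp [hw', hc, hvv]
  have hw'h : K.IsHor τ w' := by
    constructor
    · simp [hw', hw.1, hvh.1]
    · simp [hw', hw.2, hvh.2]
  have hmain : hessEnd K.g τ x w' = μ • w' := by
    by_cases h0 : w' = 0
    · simp [h0]
    obtain ⟨ν, hν⟩ := key w' h0 hw'h
    have hs0 : v + w' ≠ 0 := by
      intro h
      have := congrArg (fun t => K.g.inner x t v) h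
      simp [horth, hvv] at this
    obtain ⟨σ, hσ⟩ := key (v + w') hs0
      ⟨by simp [hvh.1, hw'h.1], by simp [hvh.2, hw'h.2]⟩
    rw [map_add, hμ, hν] at hσ
    have hw'w' : K.g.inner x w' w' ≠ 0 := fun h => h0 ((inner_self_eq_zero_iff K.g).1 h)
    have e1 := congrArg (fun t => K.g.inner x t v) hσ
    have e2 := congrArg (fun t => K.g.inner x t w') hσ
    have horth' : K.g.inner x v w' = 0 := by rw [K.g.symm, horth]
    simp [horth, horth', hvv, hw'w'] at e1 e2
    rw [hν, e1, e2]
  rw [hww, map_add, map_smul, hμ, hmain]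
  module

/-- `H∇τ` is orthogonal to `X` because `JH` is skew, and to `ℋ` because `H` is symmetric and scalar
on `ℋ`. -/
lemma hessEnd_grad (hdim : 6 ≤ Module.finrank ℝ E) (hx : K.normSqGrad τ x ≠ 0) :
    hessEnd K.g τ x (grad K.g τ x) = K.eigV τ x • grad K.g τ x := by
  obtain ⟨μ, hμ⟩ := hτ.exists_hessEnd_eq_smul hdim hx
  refine ext_inner K.g fun z => ?_
  have h1 : K.g.inner x (hessEnd K.g τ x (grad K.g τ x)) (K.Jgrad τ x) = 0 := by
    have e1 := inner_hessEnd K.g hτ.smooth (grad K.g τ x) (K.Jgrad τ x)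
    have e2 := K.inner_J_left (grad K.g τ x) (hessEnd K.g τ x (grad K.g τ x))
    have e3 : hessEnd K.g τ x (K.Jgrad τ x) = K.J x (hessEnd K.g τ x (grad K.g τ x)) :=
      hτ.hessEnd_J _
    have e4 : K.g.inner x (K.J x (grad K.g τ x)) (hessEnd K.g τ x (grad K.g τ x))
      = K.g.inner x (hessEnd K.g τ x (grad K.g τ x)) (K.Jgrad τ x) := K.g.symm _ _ _
    rw [e3] at e1
    linarith
  have h2 : ∀ v, K.IsHor τ v → K.g.inner x (hessEnd K.g τ x (grad K.g τ x)) v = 0 := by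
    intro v hv
    rw [inner_hessEnd K.g hτ.smooth, hμ v hv, map_smul, K.g.symm, hv.1, smul_zero]
  have h3 := K.apply_eq_of_isHor hx
    (K.g.inner x (hessEnd K.g τ x (grad K.g τ x))).toLinearMap h1 h2 z
  simp only [ContinuousLinearMap.coe_coe] at h3
  rw [h3, map_smul, smul_apply, K.g.symm x z, eigV]
  simp only [smul_eq_mul]
  ring

lemma hessEnd_Jgrad (hdim : 6 ≤ Module.finrank ℝ E) (hx : K.normSqGrad τ x ≠ 0) :
    hessEnd K.g τ x (K.Jgrad τ x) = K.eigV τ x • K.Jgrad τ x := by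
  rw [Jgrad, hτ.hessEnd_J, hτ.hessEnd_grad hdim hx, map_smul]

lemma hessEnd_vertical (hdim : 6 ≤ Module.finrank ℝ E) (hx : K.normSqGrad τ x ≠ 0)
    {v : TangentSpace 𝓘(ℝ, E) x} (hv : v ∈ K.vertical τ x) :
    hessEnd K.g τ x v = K.eigV τ x • v := by
  obtain ⟨a, b, rfl⟩ := Submodule.mem_span_pair.1 hv
  rw [map_add, map_smul, map_smul, hτ.hessEnd_grad hdim hx, hτ.hessEnd_Jgrad hdim hx]
  module

lemma trace_hessEnd_eq_of_smul (hdim : 6 ≤ Module.finrank ℝ E) (hx : K.normSqGrad τ x ≠ 0) {μ : ℝ}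
    (hμ : ∀ v, K.IsHor τ v → hessEnd K.g τ x v = μ • v) :
    LinearMap.trace ℝ (TangentSpace 𝓘(ℝ, E) x) (hessEnd K.g τ x).toLinearMap
      = (Module.finrank ℝ E - 2) * μ + 2 * K.eigV τ x := by
  -- `φ w` is the rank-one map `v ↦ Q⁻¹ g(w, v) w`; its values at `∇τ` and `J∇τ` add up to the
  -- projection onto `𝒱`, each with trace one.
  let φ : TangentSpace 𝓘(ℝ, E) x → (TangentSpace 𝓘(ℝ, E) x →ₗ[ℝ] TangentSpace 𝓘(ℝ, E) x) :=
    fun w => (((K.normSqGrad τ x)⁻¹ • K.g.inner x w).toLinearMap).smulRight w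
  have h : (hessEnd K.g τ x).toLinearMap = μ • LinearMap.id
      + (K.eigV τ x - μ) • (φ (grad K.g τ x) + φ (K.Jgrad τ x)) := by
    ext v
    have hp : (φ (grad K.g τ x) + φ (K.Jgrad τ x)) v = K.projV τ x v := by
      simp only [φ, projV, LinearMap.add_apply, LinearMap.smulRight_apply,
        ContinuousLinearMap.coe_coe, smul_apply, smul_eq_mul, K.g.symm x v, div_eq_inv_mul]
    rw [LinearMap.add_apply, LinearMap.smul_apply, LinearMap.smul_apply, hp]
    simp only [ContinuousLinearMap.coe_coe, LinearMap.id_apply]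
    conv_lhs => rw [← K.projV_add_projH (τ := τ) v, map_add,
      hτ.hessEnd_vertical hdim hx (K.projV_mem v), hμ _ (K.isHor_projH hx v), projH]
    module
  have h1 : LinearMap.trace ℝ (TangentSpace 𝓘(ℝ, E) x) (φ (grad K.g τ x)) = 1 := by
    rw [LinearMap.trace_smulRight]
    exact inv_mul_cancel₀ hx
  have h2 : LinearMap.trace ℝ (TangentSpace 𝓘(ℝ, E) x) (φ (K.Jgrad τ x)) = 1 := by
    rw [LinearMap.trace_smulRight]
    simp [K.inner_Jgrad_Jgrad, hx]
  have h3 : (Module.finrank ℝ (TangentSpace 𝓘(ℝ, E) x) : ℝ) = Module.finrank ℝ E := rfl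
  rw [h, map_add, map_smul, map_smul, map_add, h1, h2, LinearMap.trace_id, h3]
  simp only [smul_eq_mul]
  ring

/-- The pointwise eigenvalue is identified with `eigH` by the trace. Defining `eigH` from the trace
makes its smoothness evident without a choice of horizontal frame. -/
lemma hessEnd_horizontal (hdim : 6 ≤ Module.finrank ℝ E) (hx : K.normSqGrad τ x ≠ 0)
    {v : TangentSpace 𝓘(ℝ, E) x} (hv : K.IsHor τ v) :
    hessEnd K.g τ x v = K.eigH τ x • v := by
  obtain ⟨μ, hμ⟩ := hτ.exists_hessEnd_eq_smul hdim hx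
  have h := hτ.trace_hessEnd_eq_of_smul hdim hx hμ
  have hn : (Module.finrank ℝ E : ℝ) - 2 ≠ 0 := by
    have : (6 : ℝ) ≤ Module.finrank ℝ E := by exact_mod_cast hdim
    linarith
  rw [hμ v hv, eigH, h]
  congr 1
  field_simp
  ring

lemma trace_hessEnd (hdim : 6 ≤ Module.finrank ℝ E) (hx : K.normSqGrad τ x ≠ 0) :
    LinearMap.trace ℝ (TangentSpace 𝓘(ℝ, E) x) (hessEnd K.g τ x).toLinearMap
      = (Module.finrank ℝ E - 2) * K.eigH τ x + 2 * K.eigV τ x :=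
  hτ.trace_hessEnd_eq_of_smul hdim hx fun _ hv => hτ.hessEnd_horizontal hdim hx hv

/-! ### Derivatives of the eigenvalue functions -/

/-- Differentiate `H∇τ = Λ∇τ` along `u`, using `∇_u ∇τ = Hu`. -/
lemma dHess_grad (hdim : 6 ≤ Module.finrank ℝ E) (hx : K.normSqGrad τ x ≠ 0)
    (u : TangentSpace 𝓘(ℝ, E) x) :
    K.dHess τ x u (grad K.g τ x) = differential E (K.eigV τ) x u • grad K.g τ x
      + K.eigV τ x • hessEnd K.g τ x u - hessEnd K.g τ x (hessEnd K.g τ x u) := by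
  obtain ⟨U, rfl⟩ := exists_sec_apply_eq x u
  have h1 := hτ.leviCivita_hessEnd U hτ.gradField x
  have h2 := leviCivita_eq_of_eventually_smul K.g (Z := nab K.g hτ.gradField hτ.gradField)
    (W := hτ.gradField) ((hτ.contMDiffAt_eigV hx).mdifferentiableAt (by simp))
    (by
      filter_upwards [hτ.eventually_normSqGrad_ne_zero hx] with y hy
      exact hτ.hessEnd_grad hdim hy) (U x)
  have h3 := h1.symm.trans h2
  exact eq_sub_of_add_eq h3

/-- Differentiate `HW = M W` for a horizontal field `W` and pair with a horizontal vector; the terms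
containing `∇_u W` cancel by symmetry of `H`. -/
lemma inner_dHess_horizontal (hdim : 6 ≤ Module.finrank ℝ E) (hx : K.normSqGrad τ x ≠ 0)
    (u : TangentSpace 𝓘(ℝ, E) x) {v w : TangentSpace 𝓘(ℝ, E) x} (hv : K.IsHor τ v)
    (hw : K.IsHor τ w) :
    K.g.inner x (K.dHess τ x u v) w = differential E (K.eigH τ) x u * K.g.inner x v w := by
  obtain ⟨U, rfl⟩ := exists_sec_apply_eq x u
  obtain ⟨V, rfl⟩ := exists_sec_apply_eq x v
  -- `W` is `Q` times the horizontal part of `V`; the factor `Q` clears denominators, so `W` is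
  -- smooth on all of `M`.
  let W : Sec E M := Sec.fsmul _ hτ.smoothFn_normSqGrad V
    - Sec.fsmul _ (smoothFn_inner K.g V hτ.gradField) hτ.gradField
    - Sec.fsmul _ (smoothFn_inner K.g V hτ.killingField) hτ.killingField
  have hWx : W x = K.normSqGrad τ x • V x := by
    have e1 := hv.1
    have e2 := hv.2
    simp [W, e1, e2]
  have hWh : ∀ y, K.IsHor τ (W y) := by
    intro y
    have h1 : K.g.inner y (grad K.g τ y) (grad K.g τ y) = K.normSqGrad τ y := rfl
    constructor
    · simp [W, h1, K.inner_Jgrad_grad]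
      ring
    · simp [W, K.inner_grad_Jgrad, K.inner_Jgrad_Jgrad]
      ring
  have h1 := hτ.leviCivita_hessEnd U W x
  have h2 := leviCivita_eq_of_eventually_smul K.g (Z := nab K.g W hτ.gradField)
    (W := W) ((hτ.contMDiffAt_eigH hx).mdifferentiableAt (by simp))
    (by
      filter_upwards [hτ.eventually_normSqGrad_ne_zero hx] with y hy
      exact hτ.hessEnd_horizontal hdim hy (hWh y)) (U x)
  have h3 := congrArg (fun t => K.g.inner x t w) (h1.symm.trans h2)
  simp only [map_add, add_apply, map_smul, smul_apply] at h3
  rw [inner_hessEnd K.g hτ.smooth, hτ.hessEnd_horizontal hdim hx hw, map_smul] at h3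
  have h4 := add_right_cancel h3
  rw [hWx] at h4
  have h5 : K.dHess τ x (U x) (K.normSqGrad τ x • V x)
      = K.normSqGrad τ x • K.dHess τ x (U x) (V x) := by
    simp [dHess, curvature_smul_right]
  rw [h5] at h4
  simp only [map_smul, smul_apply, smul_eq_mul] at h4
  apply mul_left_cancel₀ hx
  linarith

lemma dHess_grad_horizontal (hdim : 6 ≤ Module.finrank ℝ E) (hx : K.normSqGrad τ x ≠ 0)
    {u : TangentSpace 𝓘(ℝ, E) x} (hu : K.IsHor τ u) :
    K.dHess τ x u (grad K.g τ x) = differential E (K.eigV τ) x u • grad K.g τ x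
      + (K.eigV τ x * K.eigH τ x - K.eigH τ x ^ 2) • u := by
  rw [hτ.dHess_grad hdim hx, hτ.hessEnd_horizontal hdim hx hu, map_smul,
    hτ.hessEnd_horizontal hdim hx hu]
  module

lemma dHess_grad_grad (hdim : 6 ≤ Module.finrank ℝ E) (hx : K.normSqGrad τ x ≠ 0) :
    K.dHess τ x (grad K.g τ x) (grad K.g τ x)
      = differential E (K.eigV τ) x (grad K.g τ x) • grad K.g τ x := by
  rw [hτ.dHess_grad hdim hx, hτ.hessEnd_grad hdim hx, map_smul, hτ.hessEnd_grad hdim hx]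
  module

/-- `∇_X H = -J R(X, X) = 0`, so the eigenvalues of `H` are constant along `X`; likewise for `eigH`
below. -/
lemma differential_eigV_Jgrad (hdim : 6 ≤ Module.finrank ℝ E) (hx : K.normSqGrad τ x ≠ 0) :
    differential E (K.eigV τ) x (K.Jgrad τ x) = 0 := by
  have h := hτ.dHess_grad hdim hx (K.Jgrad τ x)
  rw [dHess_Jgrad, hτ.hessEnd_Jgrad hdim hx, map_smul, hτ.hessEnd_Jgrad hdim hx] at h
  have h2 := congrArg (fun t => K.g.inner x t (grad K.g τ x)) h
  simp at h2
  exact h2.resolve_right hx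

lemma differential_eigH_Jgrad (hdim : 6 ≤ Module.finrank ℝ E) (hx : K.normSqGrad τ x ≠ 0) :
    differential E (K.eigH τ) x (K.Jgrad τ x) = 0 := by
  obtain ⟨v, hv, hvh, -, -⟩ := K.exists_isHor_orthogonal (τ := τ) hdim 0 (0 : TangentSpace 𝓘(ℝ, E) x)
  have h := hτ.inner_dHess_horizontal hdim hx (K.Jgrad τ x) hvh hvh
  rw [dHess_Jgrad, map_zero, zero_apply, eq_comm, mul_eq_zero] at h
  exact h.resolve_right fun h => hv ((inner_self_eq_zero_iff K.g).1 h)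

/-- Pair `(∇_u H)∇τ - (∇_{∇τ} H)u = R(u, ∇τ)∇τ` with `∇τ`. The right side vanishes by skewness, the
second term because `(∇_{∇τ} H)∇τ` is a multiple of `∇τ`, and `dΛ(u) Q` remains. -/
lemma differential_eigV_horizontal (hdim : 6 ≤ Module.finrank ℝ E) (hx : K.normSqGrad τ x ≠ 0)
    {u : TangentSpace 𝓘(ℝ, E) x} (hu : K.IsHor τ u) :
    differential E (K.eigV τ) x u = 0 := by
  have h1 := congrArg (fun t => K.g.inner x t (grad K.g τ x))
    (hτ.dHess_sub_swap u (grad K.g τ x))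
  have h2 : K.g.inner x (curvature K.g x u (grad K.g τ x) (grad K.g τ x)) (grad K.g τ x) = 0 := by
    have e1 := inner_curvature_swap K.g u (grad K.g τ x) (grad K.g τ x) (grad K.g τ x)
    rw [K.g.symm] at e1
    have e2 := K.g.symm x (grad K.g τ x) (curvature K.g x u (grad K.g τ x) (grad K.g τ x))
    linarith
  simp only [map_sub, sub_apply] at h1
  rw [h2, inner_dHess (u := grad K.g τ x), hτ.dHess_grad_grad hdim hx,
    hτ.dHess_grad_horizontal hdim hx hu] at h1
  simp [hu.1] at h1
  exact h1.resolve_right hx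

/-- With horizontal `v ≠ 0` orthogonal to `u` and `Ju`, compare `g(R(u, v)∇τ, v) = dM(u)|v|²` with
the same component of `R(Ju, Jv) = R(u, v)`, in which `g(Jv, v)` and `g(Ju, v)` both vanish. -/
lemma differential_eigH_horizontal (hdim : 6 ≤ Module.finrank ℝ E) (hx : K.normSqGrad τ x ≠ 0)
    {u : TangentSpace 𝓘(ℝ, E) x} (hu : K.IsHor τ u) :
    differential E (K.eigH τ) x u = 0 := by
  obtain ⟨v, hv, hvh, h1, h2⟩ := K.exists_isHor_orthogonal (τ := τ) hdim u (K.J x u)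
  have key : ∀ a b, K.IsHor τ a → K.IsHor τ b →
      K.g.inner x (curvature K.g x a b (grad K.g τ x)) v
        = differential E (K.eigH τ) x a * K.g.inner x b v
          - differential E (K.eigH τ) x b * K.g.inner x a v := by
    intro a b ha hb
    rw [← hτ.dHess_sub_swap, map_sub, sub_apply, hτ.inner_dHess_horizontal hdim hx a hb hvh,
      hτ.inner_dHess_horizontal hdim hx b ha hvh]
  have e1 := key u v hu hvh
  have e2 := key _ _ hu.J hvh.J
  rw [K.curvature_J_J, e1, K.g.symm x (K.J x v) v, K.inner_J_self, K.g.symm x (K.J x u) v, h2,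
    K.g.symm x u v, h1] at e2
  simp only [mul_zero, sub_zero, mul_eq_zero] at e2
  exact e2.resolve_right fun h => hv ((inner_self_eq_zero_iff K.g).1 h)

/-- Bianchi identity for `∇τ, X, u` with `u` horizontal, paired with `Ju`: one term is `dM(∇τ)|u|²`
and each of the other two is `-(ΛM - M²)|u|²`. -/
lemma differential_eigH_grad (hdim : 6 ≤ Module.finrank ℝ E) (hx : K.normSqGrad τ x ≠ 0) :
    differential E (K.eigH τ) x (grad K.g τ x)
      = 2 * K.eigH τ x * (K.eigV τ x - K.eigH τ x) := by
  obtain ⟨u, hu0, hu, -, -⟩ := K.exists_isHor_orthogonal (τ := τ) hdim 0 (0 : TangentSpace 𝓘(ℝ, E) x)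
  have hb := congrArg (fun t => K.g.inner x t (K.J x u))
    (curvature_bianchi K.g (grad K.g τ x) (K.Jgrad τ x) u)
  have e1 : K.g.inner x (curvature K.g x (grad K.g τ x) (K.Jgrad τ x) u) (K.J x u)
      = differential E (K.eigH τ) x (grad K.g τ x) * K.g.inner x u u := by
    rw [← J_dHess, K.J_orthogonal, hτ.inner_dHess_horizontal hdim hx _ hu hu]
  have e2 : K.g.inner x (curvature K.g x (K.Jgrad τ x) u (grad K.g τ x)) (K.J x u)
      = -((K.eigV τ x * K.eigH τ x - K.eigH τ x ^ 2) * K.g.inner x u u) := by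
    have := hu.1
    rw [K.g.symm] at this
    rw [curvature_swap, map_neg, neg_apply, ← J_dHess, K.J_orthogonal,
      hτ.dHess_grad_horizontal hdim hx hu]
    simp [this]
  have e3 : K.g.inner x (curvature K.g x u (grad K.g τ x) (K.Jgrad τ x)) (K.J x u)
      = -((K.eigV τ x * K.eigH τ x - K.eigH τ x ^ 2) * K.g.inner x u u) := by
    have h1 : curvature K.g x u (grad K.g τ x) (K.Jgrad τ x)
        = curvature K.g x (K.J x u) (K.Jgrad τ x) (K.Jgrad τ x) := (K.curvature_J_J _ _ _).symm
    have h2 : K.dHess τ x (K.J x u) (K.Jgrad τ x) = K.J x (K.dHess τ x (K.J x u) (grad K.g τ x)) :=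
      dHess_J_right _ _
    have h3 := hu.J.1
    rw [K.g.symm] at h3
    rw [h1, ← J_dHess, h2, K.J_sq, hτ.dHess_grad_horizontal hdim hx hu.J]
    simp [h3, K.J_orthogonal]
  simp only [map_add, add_apply, map_zero, zero_apply] at hb
  rw [e1, e2, e3] at hb
  have hne : K.g.inner x u u ≠ 0 := fun h => hu0 ((inner_self_eq_zero_iff K.g).1 h)
  apply mul_right_cancel₀ hne
  linarith

lemma normSqGrad_smul_differential_eigV (hdim : 6 ≤ Module.finrank ℝ E)
    (hx : K.normSqGrad τ x ≠ 0) :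
    K.normSqGrad τ x • differential E (K.eigV τ) x
      = differential E (K.eigV τ) x (grad K.g τ x) • differential E τ x := by
  ext v
  have h := K.apply_eq_of_isHor hx (differential E (K.eigV τ) x).toLinearMap
    (hτ.differential_eigV_Jgrad hdim hx) (fun _ hv => hτ.differential_eigV_horizontal hdim hx hv) v
  simp only [ContinuousLinearMap.coe_coe] at h
  rw [smul_apply, smul_apply, h, ← inner_grad K.g τ, K.g.symm x v]
  simp only [smul_eq_mul]
  field_simp

lemma normSqGrad_smul_differential_eigH (hdim : 6 ≤ Module.finrank ℝ E)
    (hx : K.normSqGrad τ x ≠ 0) :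
    K.normSqGrad τ x • differential E (K.eigH τ) x
      = (2 * K.eigH τ x * (K.eigV τ x - K.eigH τ x)) • differential E τ x := by
  ext v
  have h := K.apply_eq_of_isHor hx (differential E (K.eigH τ) x).toLinearMap
    (hτ.differential_eigH_Jgrad hdim hx) (fun _ hv => hτ.differential_eigH_horizontal hdim hx hv) v
  simp only [ContinuousLinearMap.coe_coe] at h
  rw [smul_apply, smul_apply, h, ← inner_grad K.g τ, K.g.symm x v, hτ.differential_eigH_grad hdim hx]
  simp only [smul_eq_mul]
  field_simp

end IsSpecialKahlerPotential

end KahlerStructure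

/-! ### Ricci eigenvectors, commutation of `S` and `T`, and the form `d^cτ` -/

namespace KahlerStructure.IsSpecialKahlerPotential

variable {E : Type*} [NormedAddCommGroup E] [NormedSpace ℝ E] [FiniteDimensional ℝ E]
  {M : Type*} [TopologicalSpace M] [ChartedSpace E M] [IsManifold 𝓘(ℝ, E) ∞ M] [T2Space M]
  {K : KahlerStructure E M} {τ : M → ℝ} {x : M} (hτ : K.IsSpecialKahlerPotential τ)
include hτ

/-! ### The Ricci endomorphism -/

lemma eventually_laplacian_eq (hdim : 6 ≤ Module.finrank ℝ E) (hx : K.normSqGrad τ x ≠ 0) :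
    ∀ᶠ y in 𝓝 x, laplacian K.g τ y
      = (2 - Module.finrank ℝ E) * K.eigH τ y + (-2) * K.eigV τ y := by
  filter_upwards [hτ.eventually_normSqGrad_ne_zero hx] with y hy
  simp only [laplacian_eq]
  rw [hτ.trace_hessEnd hdim hy]
  ring

lemma differential_laplacian_eq (hdim : 6 ≤ Module.finrank ℝ E) (hx : K.normSqGrad τ x ≠ 0) :
    differential E (laplacian K.g τ) x
      = (2 - Module.finrank ℝ E : ℝ) • differential E (K.eigH τ) x
        + (-2 : ℝ) • differential E (K.eigV τ) x := by
  have h1 := (hτ.contMDiffAt_eigH hx).mdifferentiableAt (by simp)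
  have h2 := (hτ.contMDiffAt_eigV hx).mdifferentiableAt (by simp)
  rw [differential_congr (hτ.eventually_laplacian_eq hdim hx)]
  have h3 : MDiffAt (fun _ : M => (2 - Module.finrank ℝ E : ℝ)) x := mdifferentiableAt_const
  have h4 : MDiffAt (fun _ : M => (-2 : ℝ)) x := mdifferentiableAt_const
  have e := mvfderiv_add (I := 𝓘(ℝ, E)) (h3.mul h1) (h4.mul h2)
  rw [mvfderiv_mul h3 h1, mvfderiv_mul h4 h2, mvfderiv_const, mvfderiv_const, smul_zero, smul_zero,
    add_zero, add_zero] at e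
  exact e

/-- `2ρ(∇τ, ·) = d(Δτ)`, and locally `Δτ` is a constant-coefficient combination of `M` and `Λ`,
whose differentials are multiples of `dτ`. -/
lemma ricciEnd_grad (hdim : 6 ≤ Module.finrank ℝ E) (hx : K.normSqGrad τ x ≠ 0) :
    ricciEnd K.g x (grad K.g τ x) = K.eigRic τ x • grad K.g τ x := by
  obtain ⟨a, ha⟩ : ∃ a : ℝ, ∀ v, ricci K.g x (grad K.g τ x) v
      = a * differential E τ x v := by
    refine ⟨((2 - Module.finrank ℝ E) * (2 * K.eigH τ x * (K.eigV τ x - K.eigH τ x))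
      + (-2) * differential E (K.eigV τ) x (grad K.g τ x)) / (2 * K.normSqGrad τ x), fun v => ?_⟩
    have h := congrArg (fun α => α v) (hτ.differential_laplacian_eq hdim hx)
    have h1 := congrArg (fun α => α v) (hτ.normSqGrad_smul_differential_eigV hdim hx)
    have h2 := congrArg (fun α => α v) (hτ.normSqGrad_smul_differential_eigH hdim hx)
    simp only [hτ.differential_laplacian, add_apply, smul_apply, smul_eq_mul] at h h1 h2
    field_simp
    linear_combination (1 / 2) * (K.normSqGrad τ x * h
      + (2 - (Module.finrank ℝ E : ℝ)) * h2 - 2 * h1)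
  have hQ : K.g.inner x (grad K.g τ x) (grad K.g τ x) = K.normSqGrad τ x := rfl
  have hlam : K.eigRic τ x = a := by
    rw [eigRic, ha, ← inner_grad K.g τ, hQ]
    field_simp
  refine ext_inner K.g fun z => ?_
  rw [inner_ricciEnd, ha, hlam, map_smul, smul_apply, inner_grad, smul_eq_mul]

lemma ricciEnd_Jgrad (hdim : 6 ≤ Module.finrank ℝ E) (hx : K.normSqGrad τ x ≠ 0) :
    ricciEnd K.g x (K.Jgrad τ x) = K.eigRic τ x • K.Jgrad τ x := by
  rw [Jgrad, K.ricciEnd_J, hτ.ricciEnd_grad hdim hx, map_smul]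

lemma differential_laplacian_eq_smul (hdim : 6 ≤ Module.finrank ℝ E)
    (hx : K.normSqGrad τ x ≠ 0) :
    differential E (laplacian K.g τ) x = (2 * K.eigRic τ x) • differential E τ x := by
  ext v
  rw [hτ.differential_laplacian, ← inner_ricciEnd, hτ.ricciEnd_grad hdim hx, map_smul, smul_apply,
    inner_grad, smul_apply, smul_eq_mul, smul_eq_mul, mul_assoc]

lemma differential_normSqGrad (hdim : 6 ≤ Module.finrank ℝ E) (hx : K.normSqGrad τ x ≠ 0) :
    differential E (K.normSqGrad τ) x = (2 * K.eigV τ x) • differential E τ x := by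
  ext v
  refine (differential_inner_grad_self K.g hτ.smooth x v).trans ?_
  rw [hτ.hessEnd_grad hdim hx, map_smul, K.g.symm, inner_grad, smul_apply, smul_eq_mul, smul_eq_mul,
    mul_assoc]

/-! ### The endomorphism `T = ∇X` -/

lemma leviCivita_Jgrad_vertical (hdim : 6 ≤ Module.finrank ℝ E) (hx : K.normSqGrad τ x ≠ 0)
    {v : TangentSpace 𝓘(ℝ, E) x} (hv : v ∈ K.vertical τ x) :
    leviCivita K.g (K.Jgrad τ) x v = K.eigV τ x • K.J x v := by
  rw [hτ.leviCivita_Jgrad, hτ.hessEnd_vertical hdim hx hv, map_smul]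

lemma leviCivita_Jgrad_horizontal (hdim : 6 ≤ Module.finrank ℝ E) (hx : K.normSqGrad τ x ≠ 0)
    {v : TangentSpace 𝓘(ℝ, E) x} (hv : K.IsHor τ v) :
    leviCivita K.g (K.Jgrad τ) x v = K.eigH τ x • K.J x v := by
  rw [hτ.leviCivita_Jgrad, hτ.hessEnd_horizontal hdim hx hv, map_smul]

lemma ricciEnd_vertical (hdim : 6 ≤ Module.finrank ℝ E) (hx : K.normSqGrad τ x ≠ 0)
    {v : TangentSpace 𝓘(ℝ, E) x} (hv : v ∈ K.vertical τ x) :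
    ricciEnd K.g x v = K.eigRic τ x • v := by
  obtain ⟨a, b, rfl⟩ := Submodule.mem_span_pair.1 hv
  rw [map_add, map_smul, map_smul, hτ.ricciEnd_grad hdim hx, hτ.ricciEnd_Jgrad hdim hx]
  module

lemma isHor_ricciEnd (hdim : 6 ≤ Module.finrank ℝ E) (hx : K.normSqGrad τ x ≠ 0)
    {v : TangentSpace 𝓘(ℝ, E) x} (hv : K.IsHor τ v) : K.IsHor τ (ricciEnd K.g x v) := by
  constructor
  · rw [inner_ricciEnd_symm, hτ.ricciEnd_grad hdim hx, map_smul, hv.1, smul_zero]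
  · rw [inner_ricciEnd_symm, hτ.ricciEnd_Jgrad hdim hx, map_smul, hv.2, smul_zero]

omit hτ [T2Space M] in
lemma J_mem_vertical {v : TangentSpace 𝓘(ℝ, E) x} (hv : v ∈ K.vertical τ x) :
    K.J x v ∈ K.vertical τ x := by
  obtain ⟨a, b, rfl⟩ := Submodule.mem_span_pair.1 hv
  have h : K.J x (grad K.g τ x) = K.Jgrad τ x := rfl
  refine Submodule.mem_span_pair.2 ⟨-b, a, ?_⟩
  rw [map_add, map_smul, map_smul, h, K.J_Jgrad]
  module

/-- On `𝒱` and `ℋ`, both preserved by `S`, the map `T` is a multiple of `J`, and `S` commutes with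
`J`. -/
lemma ricciEnd_leviCivita_of_ne_zero (hdim : 6 ≤ Module.finrank ℝ E) (hx : K.normSqGrad τ x ≠ 0)
    (v : TangentSpace 𝓘(ℝ, E) x) :
    ricciEnd K.g x (leviCivita K.g (K.Jgrad τ) x v)
      = leviCivita K.g (K.Jgrad τ) x (ricciEnd K.g x v) := by
  have hV := K.projV_mem (τ := τ) v
  have hH := K.isHor_projH hx v
  rw [← K.projV_add_projH (τ := τ) v]
  simp only [map_add]
  rw [hτ.leviCivita_Jgrad_vertical hdim hx hV, hτ.leviCivita_Jgrad_horizontal hdim hx hH,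
    hτ.leviCivita_Jgrad_horizontal hdim hx (hτ.isHor_ricciEnd hdim hx hH),
    hτ.ricciEnd_vertical hdim hx hV, map_smul (leviCivita K.g (K.Jgrad τ) x),
    hτ.leviCivita_Jgrad_vertical hdim hx hV, map_smul, map_smul,
    hτ.ricciEnd_vertical hdim hx (J_mem_vertical hV), K.ricciEnd_J, smul_comm]

lemma ricciEnd_leviCivita (hdim : 6 ≤ Module.finrank ℝ E)
    (hd : Dense {x | K.normSqGrad τ x ≠ 0}) (v : TangentSpace 𝓘(ℝ, E) x) :
    ricciEnd K.g x (leviCivita K.g (K.Jgrad τ) x v)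
      = leviCivita K.g (K.Jgrad τ) x (ricciEnd K.g x v) := by
  refine ext_inner K.g fun w => ?_
  obtain ⟨V, rfl⟩ := exists_sec_apply_eq x v
  obtain ⟨W, rfl⟩ := exists_sec_apply_eq x w
  have hc1 := (smoothFn_inner K.g (ricciSec K.g (nab K.g V hτ.killingField)) W).continuous
  have hc2 := (smoothFn_inner K.g (nab K.g (ricciSec K.g V) hτ.killingField) W).continuous
  refine congrFun (hc1.ext_on hd hc2 fun y hy => ?_) x
  exact congrArg (fun t => K.g.inner y t (W y)) (hτ.ricciEnd_leviCivita_of_ne_zero hdim hy (V y))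

/-- For a Killing field `∇_X S = [∇X, S]`, and this commutator vanishes. -/
lemma covDerivEnd_ricciEnd_Jgrad (hdim : 6 ≤ Module.finrank ℝ E)
    (hd : Dense {x | K.normSqGrad τ x ≠ 0}) (w : TangentSpace 𝓘(ℝ, E) x) :
    covDerivEnd K.g (ricciEnd K.g) x (K.Jgrad τ x) w = 0 := by
  obtain ⟨W, -, hW⟩ := exists_covDerivEnd_eq K.g (ricciEnd K.g) (ricciSec K.g)
    (fun _ _ => rfl) x w
  have h := hτ.isKilling_killingField.nab_ricciSec W x
  rw [hW]
  refine h.trans (sub_eq_zero.2 ?_)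
  exact (hτ.ricciEnd_leviCivita hdim hd (W x)).symm

/-! ### The one-form `d^cτ` -/

omit [T2Space M] hτ in
lemma _root_.KahlerGeometry.KahlerStructure.dc_apply (K : KahlerStructure E M) (x : M) :
    K.dc τ x = K.g.inner x (K.Jgrad τ x) := by
  ext v
  rw [Jgrad, K.inner_J_left, inner_grad]
  rfl

lemma inner_leviCivita_eq_omega (hdim : 6 ≤ Module.finrank ℝ E) (hx : K.normSqGrad τ x ≠ 0)
    (v w : TangentSpace 𝓘(ℝ, E) x) :
    K.g.inner x (leviCivita K.g (K.Jgrad τ) x v) w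
      = K.eigV τ x * K.omegaV τ x v w + K.eigH τ x * K.omegaH τ x v w := by
  have hort : ∀ {a b : TangentSpace 𝓘(ℝ, E) x}, a ∈ K.vertical τ x → K.IsHor τ b →
      K.g.inner x b a = 0 := fun ha hb => (K.mem_horizontal_iff _).2 hb _ ha
  have hV := K.projV_mem (τ := τ) v
  have hH := K.isHor_projH hx v
  have h1 := hort (K.projV_mem w) hH.J
  have h2 := hort (J_mem_vertical hV) (K.isHor_projH hx w)
  rw [K.g.symm] at h2
  have h3 : K.g.inner x (K.J x (K.projV τ x v)) w = K.omegaV τ x v w := by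
    conv_lhs => rw [← K.projV_add_projH (τ := τ) w, map_add, h2, add_zero]
    rfl
  have h4 : K.g.inner x (K.J x (K.projH τ x v)) w = K.omegaH τ x v w := by
    conv_lhs => rw [← K.projV_add_projH (τ := τ) w, map_add, h1, zero_add]
    rfl
  conv_lhs => rw [← K.projV_add_projH (τ := τ) v]
  rw [map_add, hτ.leviCivita_Jgrad_vertical hdim hx hV, hτ.leviCivita_Jgrad_horizontal hdim hx hH]
  simp [h3, h4]

end KahlerStructure.IsSpecialKahlerPotential

/-! ### Linear first order systems along chart segments -/

section Chart

variable {E : Type*} [NormedAddCommGroup E] [NormedSpace ℝ E] [FiniteDimensional ℝ E]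
  {M : Type*} [TopologicalSpace M] [ChartedSpace E M] [IsManifold 𝓘(ℝ, E) ∞ M]

/-- The derivative at `z` of the inverse of the preferred chart at `p`. -/
def chartSymmDeriv (p : M) (z : E) :
    E →L[ℝ] TangentSpace 𝓘(ℝ, E) ((extChartAt 𝓘(ℝ, E) p).symm z) :=
  mfderiv[Set.range 𝓘(ℝ, E)] (extChartAt 𝓘(ℝ, E) p).symm z

variable {p : M} {z : E}

lemma mfderiv_chartSymmDeriv (hz : z ∈ (extChartAt 𝓘(ℝ, E) p).target) (w : E) :
    mfderiv 𝓘(ℝ, E) 𝓘(ℝ, E) (extChartAt 𝓘(ℝ, E) p) ((extChartAt 𝓘(ℝ, E) p).symm z)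
      (chartSymmDeriv p z w) = w :=
  congrArg (fun A : E →L[ℝ] E => A w) (mfderiv_extChartAt_comp_mfderivWithin_extChartAt_symm hz)

lemma chartSymmDeriv_surjective (hz : z ∈ (extChartAt 𝓘(ℝ, E) p).target) :
    Function.Surjective (chartSymmDeriv p z) := fun v =>
  ⟨mfderiv 𝓘(ℝ, E) 𝓘(ℝ, E) (extChartAt 𝓘(ℝ, E) p) ((extChartAt 𝓘(ℝ, E) p).symm z) v,
    congrArg (fun A : E →L[ℝ] E => A v)
      (mfderivWithin_extChartAt_symm_comp_mfderiv_extChartAt hz)⟩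

lemma hasFDerivAt_comp_extChartAt_symm {f : M → ℝ} (hz : z ∈ (extChartAt 𝓘(ℝ, E) p).target)
    (hf : MDiffAt f ((extChartAt 𝓘(ℝ, E) p).symm z)) :
    HasFDerivAt (f ∘ (extChartAt 𝓘(ℝ, E) p).symm)
      ((differential E f ((extChartAt 𝓘(ℝ, E) p).symm z)).comp (chartSymmDeriv p z)) z := by
  have h := (mdifferentiableWithinAt_extChartAt_symm (I := 𝓘(ℝ, E)) hz).hasMFDerivWithinAt
  have h2 := hf.hasMFDerivAt.comp_hasMFDerivWithinAt z h
  rw [modelWithCornersSelf_coe, Set.range_id, hasMFDerivWithinAt_univ] at h2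
  have h3 := h2.hasFDerivAt
  rw [chartSymmDeriv, modelWithCornersSelf_coe, Set.range_id]
  exact h3

lemma eventually_extChartAt_symm {P : M → Prop} (h : ∀ᶠ y in 𝓝 p, P y) :
    ∀ᶠ z in 𝓝 (extChartAt 𝓘(ℝ, E) p p), z ∈ (extChartAt 𝓘(ℝ, E) p).target
      ∧ P ((extChartAt 𝓘(ℝ, E) p).symm z) := by
  have hc := continuousAt_extChartAt_symm (I := 𝓘(ℝ, E)) p
  rw [ContinuousAt, extChartAt_to_inv] at hc
  filter_upwards [extChartAt_target_mem_nhds (I := 𝓘(ℝ, E)) p, hc.eventually h] with z h1 h2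
  exact ⟨h1, h2⟩

/-- Unique continuation: a solution of a homogeneous linear first order system which vanishes
at a point vanishes near that point. -/
lemma CutoffFrame.eventually_eq_zero {ι κ : Type*} [Fintype ι] [Fintype κ]
    {b : Module.Basis ι ℝ E} (F : CutoffFrame b p) (h : κ → M → ℝ)
    (hd : ∀ᶠ y in 𝓝 p, ∀ a, MDiffAt (h a) y) (c : ι → κ → κ → M → ℝ)
    (hc : ∀ i a d, ContinuousAt (c i a d) p)
    (hs : ∀ᶠ y in 𝓝 p, ∀ i a, differential E (h a) y (F.e i y) = ∑ d, c i a d y * h d y)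
    (h0 : ∀ a, h a p = 0) [T2Space M] : ∀ᶠ y in 𝓝 p, ∀ a, h a y = 0 := by
  set φ := extChartAt 𝓘(ℝ, E) p with hφ
  -- One constant bounding all coefficients near `p`; the `+ 1` leaves room for continuity.
  set C : ℝ := ∑ i, ∑ a, ∑ d, (|c i a d p| + 1) with hC
  have hcb : ∀ᶠ y in 𝓝 p, ∀ i a d, |c i a d y| ≤ C := by
    have h1 : ∀ i a d, |c i a d p| + 1 ≤ C := by
      intro i a d
      have hpos : ∀ i a d, 0 ≤ |c i a d p| + 1 := fun i a d => by positivity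
      calc |c i a d p| + 1 ≤ ∑ d, (|c i a d p| + 1) :=
            Finset.single_le_sum (fun d _ => hpos i a d) (Finset.mem_univ d)
        _ ≤ ∑ a, ∑ d, (|c i a d p| + 1) :=
            Finset.single_le_sum (f := fun a => ∑ d, (|c i a d p| + 1))
              (fun a _ => Finset.sum_nonneg fun d _ => hpos i a d) (Finset.mem_univ a)
        _ ≤ C := Finset.single_le_sum (f := fun i => ∑ a, ∑ d, (|c i a d p| + 1))
              (fun i _ => Finset.sum_nonneg fun a _ => Finset.sum_nonneg fun d _ => hpos i a d)
              (Finset.mem_univ i)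
    simp only [Filter.eventually_all]
    intro i a d
    filter_upwards [(hc i a d).abs.eventually (Iio_mem_nhds (lt_add_one |c i a d p|))] with y hy
    exact (le_of_lt hy).trans (h1 i a d)
  obtain ⟨r, hr, hball⟩ := Metric.eventually_nhds_iff_ball.1
    (eventually_extChartAt_symm (E := E) (p := p)
      (hd.and (hs.and (hcb.and (F.eventually_sum_smul.and F.θ_eq)))))
  -- Along the chart segment from `φ p` to `z` the coframe, being the differential of the
  -- coordinates, has constant values `b.repr w` on the velocity. The system becomes a linear ODE
  -- with zero initial value, and a Grönwall estimate finishes.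
  have key : ∀ z ∈ Metric.ball (φ p) r, ∀ a, h a (φ.symm z) = 0 := by
    intro z hz
    set w := z - φ p with hw
    have hγ : ∀ t ∈ Set.Icc (0 : ℝ) 1, φ p + t • w ∈ Metric.ball (φ p) r := by
      intro t ht
      exact (convex_ball (φ p) r).add_smul_sub_mem (Metric.mem_ball_self hr) hz ht
    let u : ℝ → κ → ℝ := fun t a => h a (φ.symm (φ p + t • w))
    let u' : ℝ → κ → ℝ := fun t a => ∑ i, b.repr w i *
      ∑ d, c i a d (φ.symm (φ p + t • w)) * u t d
    have hder : ∀ t ∈ Set.Icc (0 : ℝ) 1, HasDerivAt u (u' t) t := by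
      intro t ht
      rw [hasDerivAt_pi]
      intro a
      obtain ⟨hzt, hdt, hst, -, hsum, hθ⟩ := hball _ (hγ t ht)
      have h1 := hasFDerivAt_comp_extChartAt_symm hzt (hdt a)
      have h2 : HasDerivAt (fun t : ℝ => φ p + t • w) w t := by
        simpa using ((hasDerivAt_id t).smul_const w).const_add (φ p)
      have h3 := h1.comp_hasDerivAt t h2
      refine h3.congr_deriv ?_
      rw [ContinuousLinearMap.comp_apply]
      conv_lhs => rw [← hsum (chartSymmDeriv p (φ p + t • w) w)]
      rw [map_sum]
      refine Finset.sum_congr rfl fun i _ => ?_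
      rw [map_smul, hst i a, hθ, mfderiv_chartSymmDeriv hzt, smul_eq_mul]
    have hbound : ∀ t ∈ Set.Ico (0 : ℝ) 1,
        ‖u' t‖ ≤ (∑ i, |b.repr w i| * (Fintype.card κ * C)) * ‖u t‖ := by
      intro t ht
      obtain ⟨-, -, -, hct, -, -⟩ := hball _ (hγ t ⟨ht.1, ht.2.le⟩)
      have hC0 : ∀ i a d, 0 ≤ C := fun i a d => (abs_nonneg _).trans (hct i a d)
      refine (pi_norm_le_iff_of_nonneg ?_).2 fun a => ?_
      · refine mul_nonneg (Finset.sum_nonneg fun i _ => mul_nonneg (abs_nonneg _) ?_)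
          (norm_nonneg _)
        rcases isEmpty_or_nonempty κ with hκ | ⟨⟨a⟩⟩
        · simp
        · exact mul_nonneg (Nat.cast_nonneg _) (hC0 i a a)
      · rw [Finset.sum_mul]
        refine (norm_sum_le _ _).trans (Finset.sum_le_sum fun i _ => ?_)
        rw [norm_mul, Real.norm_eq_abs, mul_assoc]
        refine mul_le_mul_of_nonneg_left ?_ (abs_nonneg _)
        calc ‖∑ d, c i a d (φ.symm (φ p + t • w)) * u t d‖
            ≤ ∑ d : κ, C * ‖u t‖ := by
              refine (norm_sum_le _ _).trans (Finset.sum_le_sum fun d _ => ?_)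
              rw [norm_mul]
              exact mul_le_mul (hct i a d) (norm_le_pi_norm (u t) d) (norm_nonneg _) (hC0 i a d)
          _ = Fintype.card κ * C * ‖u t‖ := by
              rw [Finset.sum_const, Finset.card_univ, nsmul_eq_mul, mul_assoc]
    have hu0 : u 0 = 0 := by
      ext a
      simp [u, hφ, h0]
    have h1 := eq_zero_of_abs_deriv_le_mul_abs_self_of_eq_zero_right
      (fun t ht => (hder t ht).continuousAt.continuousWithinAt)
      (fun t ht => (hder t ⟨ht.1, ht.2.le⟩).hasDerivWithinAt) hu0 hbound 1 (by simp)
    intro a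
    have := congrFun h1 a
    simpa [u, hw] using this
  filter_upwards [(continuousAt_extChartAt p).eventually (Metric.ball_mem_nhds (φ p) hr),
    extChartAt_source_mem_nhds (I := 𝓘(ℝ, E)) p] with y hy hys a
  have := key _ hy a
  rwa [φ.left_inv hys] at this

end Chart

/-! ### Unique continuation for Killing fields -/

section UniqueContinuation

variable {E : Type*} [NormedAddCommGroup E] [NormedSpace ℝ E] [FiniteDimensional ℝ E]
  {M : Type*} [TopologicalSpace M] [ChartedSpace E M] [IsManifold 𝓘(ℝ, E) ∞ M] [T2Space M]
  {p : M}

lemma eventually_eq_of_differential_eq_zero {f : M → ℝ}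
    (hf : ∀ᶠ y in 𝓝 p, MDiffAt f y ∧ differential E f y = 0) : ∀ᶠ y in 𝓝 p, f y = f p := by
  obtain ⟨F⟩ := nonempty_cutoffFrame (Module.finBasis ℝ E) p
  have h := F.eventually_eq_zero (κ := Unit) (fun _ y => f y - f p)
    (hf.mono fun y hy _ => hy.1.sub mdifferentiableAt_const) (fun _ _ _ _ => 0)
    (fun _ _ _ => continuousAt_const)
    (hf.mono fun y hy i _ => by
      have h1 : differential E (fun y => f y - f p) y = differential E f y := by
        have := mvfderiv_sub (I := 𝓘(ℝ, E)) hy.1 (mdifferentiableAt_const (c := f p))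
        rw [mvfderiv_const, sub_zero] at this
        exact this
      rw [h1, hy.2]
      simp) (fun _ => sub_self _)
  filter_upwards [h] with y hy
  exact sub_eq_zero.1 (hy ())

namespace CutoffFrame

variable {ι : Type*} [Fintype ι] {b : Module.Basis ι ℝ E} (F : CutoffFrame b p)

/-- Expand `Y` in the frame and apply the Leibniz rule: the components of `Y` differentiate with the
connection coefficients as correction. -/
lemma eventually_differential_coframe (g : RMetric E M) (Y : Sec E M) :
    ∀ᶠ y in 𝓝 p, ∀ i k, differential E (fun z => F.θ k z (Y z)) y (F.e i y)
      = F.θ k y (nab g (F.e i) Y y)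
        + ∑ l, -F.θ k y (nab g (F.e i) (F.e l) y) * F.θ l y (Y y) := by
  filter_upwards [F.eventually_sum_smul.eventually_nhds, F.dual] with y hy hdual i k
  have h1 : leviCivita g (fun z => Y z) y
      = leviCivita g (fun z => (∑ l, Sec.fsmul _ (F.θ_smooth l Y) (F.e l)) z) y := by
    refine leviCivita_congr g (Y.mdiffAt y) ?_
    filter_upwards [hy] with z hz
    rw [Sec.sum_apply]
    exact (hz (Y z)).symm
  let Φ : Sec E M →+ Sec E M := AddMonoidHom.mk' (nab g (F.e i)) (nab_add_right g (F.e i))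
  have h2 : nab g (F.e i) Y y = ∑ l, (differential E (fun z => F.θ l z (Y z)) y (F.e i y) • F.e l y
      + F.θ l y (Y y) • nab g (F.e i) (F.e l) y) := by
    rw [nab_apply, h1, ← nab_apply]
    change Φ _ y = _
    rw [map_sum, Sec.sum_apply]
    refine Finset.sum_congr rfl fun l _ => ?_
    change nab g _ _ y = _
    rw [nab_fsmul_right]
    rfl
  rw [h2, Finset.sum_add_distrib, map_add, hdual]
  simp [map_sum, Finset.sum_neg_distrib, mul_comm]

end CutoffFrame

variable {g : RMetric E M} {X : Sec E M} (hX : IsKilling g X)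
include hX

/-- Kostant's identity expresses the derivative of `∇X` through `X` and `∇X`, so the components of
both solve a closed homogeneous linear system. -/
lemma IsKilling.eventually_eq_zero (h1 : X p = 0) (h2 : leviCivita g X p = 0) :
    ∀ᶠ y in 𝓝 p, X y = 0 := by
  classical
  obtain ⟨F⟩ := nonempty_cutoffFrame (Module.finBasis ℝ E) p
  let n := Module.finrank ℝ E
  let h : Fin n ⊕ Fin n × Fin n → M → ℝ := Sum.elim (fun k y => F.θ k y (X y))
    (fun a y => F.θ a.2 y (nab g (F.e a.1) X y))
  -- The rows for `X` contain connection coefficients and the unknown `∇_{eᵢ} X` itself. The rows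
  -- for `∇X` contain the curvature, the term from `∇_{∇_{eᵢ} eⱼ} X`, and connection coefficients.
  let c : Fin n → Fin n ⊕ Fin n × Fin n → Fin n ⊕ Fin n × Fin n → M → ℝ := fun i =>
    Sum.elim
      (fun k => Sum.elim (fun l y => -F.θ k y (nab g (F.e i) (F.e l) y))
        (fun d _ => if d.1 = i then if d.2 = k then 1 else 0 else 0))
      (fun a => Sum.elim (fun l y => F.θ a.2 y (riem g (F.e i) (F.e l) (F.e a.1) y))
        (fun d y => (if d.2 = a.2 then F.θ d.1 y (nab g (F.e i) (F.e a.1) y) else 0)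
          + if d.1 = a.1 then -F.θ a.2 y (nab g (F.e i) (F.e d.2) y) else 0))
  have hθ : ∀ k (Y : Sec E M), Continuous fun y => F.θ k y (Y y) := fun k Y =>
    (F.θ_smooth k Y).continuous
  have key := F.eventually_eq_zero h ?_ c ?_ ?_ ?_
  · filter_upwards [key, F.eventually_sum_smul] with y hy hsum
    rw [← hsum (X y)]
    refine Finset.sum_eq_zero fun i _ => ?_
    have := hy (Sum.inl i)
    simp only [h, Sum.elim_inl] at this
    rw [this, zero_smul]
  · refine Filter.Eventually.of_forall fun y a => ?_
    rcases a with k | ⟨j, k⟩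
    · exact SmoothFn.mdiffAt (F.θ_smooth k X) y
    · exact SmoothFn.mdiffAt (F.θ_smooth k (nab g (F.e j) X)) y
  · intro i a d
    rcases a with k | ⟨j, k⟩ <;> rcases d with l | ⟨j', l⟩
    · exact (hθ _ _).neg.continuousAt
    · exact continuousAt_const
    · exact (hθ _ _).continuousAt
    · simp only [c, Sum.elim_inr]
      refine ContinuousAt.add ?_ ?_
      · split_ifs
        · exact (hθ _ _).continuousAt
        · exact continuousAt_const
      · split_ifs
        · exact (hθ _ _).neg.continuousAt
        · exact continuousAt_const
  · filter_upwards [F.eventually_differential_coframe g X,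
      Filter.eventually_all.2 fun j => F.eventually_differential_coframe g (nab g (F.e j) X),
      F.eventually_sum_smul] with y hy hy' hsum i a
    rcases a with k | ⟨j, k⟩
    · simp only [h, c, Sum.elim_inl, Fintype.sum_sum_type, Sum.elim_inr, Fintype.sum_prod_type]
      rw [hy i k, add_comm]
      congr 1
      simp [n]
    · have hK := congrArg (fun Y : Sec E M => F.θ k y (Y y)) (hX.secondNab_eq (F.e i) (F.e j))
      simp only [secondNab, Sec.sub_apply, map_sub] at hK
      rw [sub_eq_iff_eq_add] at hK
      have e1 : F.θ k y (riem g (F.e i) X (F.e j) y)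
          = ∑ l, F.θ k y (riem g (F.e i) (F.e l) (F.e j) y) * F.θ l y (X y) := by
        rw [riem_apply]
        conv_lhs => rw [← hsum (X y)]
        have : ∀ v, curvature g y (F.e i y) v (F.e j y)
            = -curvatureTraceEnd g (F.e i y) (F.e j y) v := fun v => by
          rw [curvatureTraceEnd_apply, curvature_swap]
        simp only [this, riem_apply, map_sum, map_smul, map_neg, smul_eq_mul,
          Finset.sum_neg_distrib, mul_neg, mul_comm]
      have e2 : F.θ k y (nab g (nab g (F.e i) (F.e j)) X y)
          = ∑ l, F.θ l y (nab g (F.e i) (F.e j) y) * F.θ k y (nab g (F.e l) X y) := by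
        rw [nab_apply]
        conv_lhs => rw [← hsum (nab g (F.e i) (F.e j) y)]
        simp only [map_sum, map_smul, smul_eq_mul]
        rfl
      simp only [h, c, Sum.elim_inl, Fintype.sum_sum_type, Sum.elim_inr, Fintype.sum_prod_type]
      rw [hy' j i k, hK, e1, e2]
      rw [add_assoc]
      congr 1
      simp [add_mul, Finset.sum_add_distrib, n]
  · intro a
    rcases a with k | ⟨j, k⟩
    · simp [h, h1]
    · simp only [h, Sum.elim_inr, nab_apply]
      erw [h2]
      simp

/-- The set where `X` and `∇X` both vanish is closed by continuity and open by the local statement.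
-/
lemma IsKilling.eq_zero [ConnectedSpace M] (h1 : X p = 0) (h2 : leviCivita g X p = 0) (y : M) :
    X y = 0 := by
  let Z : Set M := {y | X y = 0 ∧ ∀ V : Sec E M, nab g V X y = 0}
  have hzero : ∀ W : Sec E M, IsClosed {y | W y = 0} := by
    intro W
    have h : {y | W y = 0} = (fun y => g.inner y (W y) (W y)) ⁻¹' {0} := by
      ext y
      exact (inner_self_eq_zero_iff g).symm
    rw [h]
    exact isClosed_singleton.preimage (smoothFn_inner g W W).continuous
  have hclosed : IsClosed Z := by
    have h : Z = {y | X y = 0} ∩ ⋂ V : Sec E M, {y | nab g V X y = 0} := by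
      ext y
      simp [Z]
    rw [h]
    exact (hzero X).inter (isClosed_iInter fun V => hzero _)
  have hopen : IsOpen Z := by
    rw [isOpen_iff_mem_nhds]
    rintro y ⟨hy1, hy2⟩
    have hT : leviCivita g X y = 0 := by
      ext v
      obtain ⟨V, rfl⟩ := exists_sec_apply_eq y v
      exact hy2 V
    have h := hX.eventually_eq_zero hy1 hT
    filter_upwards [h.eventually_nhds] with z hz
    refine ⟨hz.self_of_nhds, fun V => ?_⟩
    rw [nab_apply, leviCivita_eq_of_eventually_smul g (Z := X) (W := X) (f := fun _ => 0)
      mdifferentiableAt_const (by filter_upwards [hz] with w hw; rw [hw, smul_zero])]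
    rw [show differential E (fun _ : M => (0 : ℝ)) z = 0 from mvfderiv_const 0]
    simp
  have hp : p ∈ Z := ⟨h1, fun V => by
    rw [nab_apply]
    erw [h2]
    rfl⟩
  have := IsClopen.eq_univ ⟨hclosed, hopen⟩ ⟨p, hp⟩
  exact (this ▸ Set.mem_univ y : y ∈ Z).1

end UniqueContinuation

/-! ### Complements of sets of codimension two -/

section Topology

/-- Polar coordinates: the punctured ball is the image of an interval times the unit sphere,
connected in dimension above one. -/
lemma isPreconnected_ball_diff_singleton {F : Type*} [NormedAddCommGroup F] [NormedSpace ℝ F]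
    (hF : 1 < Module.rank ℝ F) (r : ℝ) : IsPreconnected (Metric.ball (0 : F) r \ {0}) := by
  have h : Metric.ball (0 : F) r \ {0}
      = (fun q : ℝ × F => q.1 • q.2) '' (Set.Ioo 0 r ×ˢ Metric.sphere (0 : F) 1) := by
    ext v
    constructor
    · rintro ⟨hv, hv0⟩
      have hn : 0 < ‖v‖ := norm_pos_iff.2 hv0
      refine ⟨(‖v‖, ‖v‖⁻¹ • v), ⟨⟨hn, by simpa using hv⟩, ?_⟩, ?_⟩
      · simp [norm_smul, hn.ne']
      · simp [smul_smul, hn.ne']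
    · rintro ⟨⟨t, w⟩, ⟨⟨ht0, htr⟩, hw⟩, rfl⟩
      have hw1 : ‖w‖ = 1 := by simpa using hw
      have hn : ‖t • w‖ = t := by rw [norm_smul, hw1, mul_one, Real.norm_of_nonneg ht0.le]
      refine ⟨by simpa [hn] using htr, fun h0 => ?_⟩
      have h1 : t • w = 0 := h0
      rw [h1, norm_zero] at hn
      exact ht0.ne hn
  rw [h]
  exact (isPreconnected_Ioo.prod (isPreconnected_sphere hF 0 1)).image _
    (continuous_fst.smul continuous_snd).continuousOn

/-- A dense subset of a connected space that is connected near each point is connected. -/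
lemma isPreconnected_of_dense {Y : Type*} [TopologicalSpace Y] [PreconnectedSpace Y] {U : Set Y}
    (hd : Dense U) (h : ∀ p, ∃ N ∈ 𝓝 p, IsPreconnected (N ∩ U)) : IsPreconnected U := by
  refine isPreconnected_of_forall_constant fun f hf x hx y hy => ?_
  by_contra hne
  -- For a nonconstant continuous `f : U → Bool`, the closures of its two fibres cover `Y` by
  -- density and are disjoint because `f` is constant on `N ∩ U` near each point; this contradicts
  -- connectedness of `Y`.
  let C : Bool → Set Y := fun b => closure {z ∈ U | f z = b}
  have hdisj : ∀ p, p ∈ C (f x) → p ∈ C (f y) → False := by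
    intro p h1 h2
    obtain ⟨N, hN, hNU⟩ := h p
    obtain ⟨a, haN, haU, ha⟩ := mem_closure_iff_nhds.1 h1 N hN
    obtain ⟨b, hbN, hbU, hb⟩ := mem_closure_iff_nhds.1 h2 N hN
    have := hNU.constant (hf.mono Set.inter_subset_right) ⟨haN, haU⟩ ⟨hbN, hbU⟩
    exact hne (by rw [← ha, ← hb, this])
  have hcover : ∀ p, p ∈ C (f x) ∨ p ∈ C (f y) := by
    intro p
    have hU : U ⊆ {z ∈ U | f z = f x} ∪ {z ∈ U | f z = f y} := by
      intro z hz
      rcases Bool.eq_or_eq_not (f z) (f x) with h1 | h1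
      · exact Or.inl ⟨hz, h1⟩
      · exact Or.inr ⟨hz, h1.trans (Bool.eq_not.2 (Ne.symm hne)).symm⟩
    have := closure_mono hU (hd p)
    rwa [closure_union] at this
  have hcompl : (C (f x))ᶜ = C (f y) := by
    ext p
    exact ⟨fun hp => (hcover p).resolve_left hp, fun hp hp' => hdisj p hp' hp⟩
  have hclopen : IsClopen (C (f x)) :=
    ⟨isClosed_closure, isClosed_compl_iff.1 (hcompl ▸ isClosed_closure)⟩
  have huniv := hclopen.eq_univ ⟨x, subset_closure ⟨hx, rfl⟩⟩
  exact hdisj y (huniv ▸ Set.mem_univ y) (subset_closure ⟨hy, rfl⟩)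

variable {E : Type*} [NormedAddCommGroup E] [NormedSpace ℝ E] [FiniteDimensional ℝ E]

/-- Near a point at which a map to the plane is a submersion, the complement of the zero set is
connected and dense. -/
lemma exists_isPreconnected_of_hasStrictFDerivAt {f : E → ℝ × ℝ} {f' : E →L[ℝ] ℝ × ℝ} {a : E}
    (hf : HasStrictFDerivAt f f' a) (hf' : f'.range = ⊤) (ha : f a = 0) {V : Set E}
    (hV : V ∈ 𝓝 a) :
    ∃ N N' : Set E, N ∈ 𝓝 a ∧ N ⊆ V ∧ N' ⊆ N ∧ N ⊆ closure N' ∧ IsPreconnected N'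
      ∧ ∀ z ∈ N', f z ≠ 0 := by
  have := FiniteDimensional.complete ℝ E
  -- The implicit function chart turns `f` into the projection to the plane. The complement of the
  -- zero set in a ball becomes a punctured disc times a ball in the kernel.
  let e := hf.implicitToOpenPartialHomeomorph f f' hf'
  have hea : e a = (0, 0) := by
    rw [← ha]
    exact hf.implicitToOpenPartialHomeomorph_self hf'
  have has : a ∈ e.source := hf.mem_implicitToOpenPartialHomeomorph_source hf'
  have hfst : ∀ z, (e z).1 = f z := fun z => hf.implicitToOpenPartialHomeomorph_fst hf' z
  have hW : e.target ∩ e.symm ⁻¹' V ∈ 𝓝 (e a) := by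
    refine Filter.inter_mem (e.open_target.mem_nhds (e.map_source has)) ?_
    have := e.continuousAt_symm (e.map_source has)
    rw [ContinuousAt, e.left_inv has] at this
    exact this hV
  rw [hea] at hW
  obtain ⟨r, hr, hB⟩ := Metric.mem_nhds_iff.1 hW
  set B : Set ((ℝ × ℝ) × f'.ker) := Metric.ball (0, 0) r with hBdef
  let B' : Set ((ℝ × ℝ) × f'.ker) := B ∩ Prod.fst ⁻¹' {0}ᶜ
  have hcont : ContinuousOn e.symm B := e.continuousOn_symm.mono fun q hq => (hB hq).1
  refine ⟨e.symm '' B, e.symm '' B', ?_, ?_, Set.image_mono Set.inter_subset_left, ?_, ?_, ?_⟩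
  · have h1 : ∀ᶠ z in 𝓝 a, e z ∈ B := by
      refine (e.continuousAt has).eventually (Metric.isOpen_ball.mem_nhds ?_)
      rw [hea]
      exact Metric.mem_ball_self hr
    filter_upwards [h1, e.open_source.mem_nhds has] with z hz hzs
    exact ⟨e z, hz, e.left_inv hzs⟩
  · rintro _ ⟨q, hq, rfl⟩
    exact (hB hq).2
  · rintro _ ⟨q, hq, rfl⟩
    have hdense : Dense (Prod.fst ⁻¹' {0}ᶜ : Set ((ℝ × ℝ) × f'.ker)) :=
      (dense_compl_singleton (0 : ℝ × ℝ)).preimage isOpenMap_fst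
    exact ((hcont q hq).mono Set.inter_subset_left).mem_closure_image
      (hdense.open_subset_closure_inter Metric.isOpen_ball hq)
  · refine IsPreconnected.image ?_ _ (hcont.mono Set.inter_subset_left)
    have : B' = (Metric.ball (0 : ℝ × ℝ) r \ {0}) ×ˢ Metric.ball (0 : f'.ker) r := by
      ext q
      simp [B', B, ← ball_prod_same]
      tauto
    rw [this]
    refine (isPreconnected_ball_diff_singleton ?_ r).prod Metric.isPreconnected_ball
    rw [rank_prod', Module.rank_self, one_add_one_eq_two]
    exact Cardinal.one_lt_two
  · rintro _ ⟨q, hq, rfl⟩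
    rw [← hfst, e.right_inv (hB hq.1).1]
    exact hq.2

variable {M : Type*} [TopologicalSpace M] [ChartedSpace E M] [IsManifold 𝓘(ℝ, E) ∞ M] {p : M}

lemma exists_isPreconnected_of_surjective {f₁ f₂ : M → ℝ}
    (hf₁ : ContMDiff 𝓘(ℝ, E) 𝓘(ℝ, ℝ) ∞ f₁) (hf₂ : ContMDiff 𝓘(ℝ, E) 𝓘(ℝ, ℝ) ∞ f₂) (h₁ : f₁ p = 0)
    (h₂ : f₂ p = 0)
    (hs : ∀ a b : ℝ, ∃ v, differential E f₁ p v = a ∧ differential E f₂ p v = b) :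
    ∃ N N' : Set M, N ∈ 𝓝 p ∧ N' ⊆ N ∧ N ⊆ closure N' ∧ IsPreconnected N'
      ∧ ∀ y ∈ N', f₁ y ≠ 0 ∨ f₂ y ≠ 0 := by
  set φ := extChartAt 𝓘(ℝ, E) p with hφ
  have hz : φ p ∈ φ.target := mem_extChartAt_target p
  have hpp : φ.symm (φ p) = p := extChartAt_to_inv p
  have hsm : ∀ f : M → ℝ, ContMDiff 𝓘(ℝ, E) 𝓘(ℝ, ℝ) ∞ f → ContDiffAt ℝ ∞ (f ∘ φ.symm) (φ p) := by
    intro f hf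
    have h1 : ContMDiffAt 𝓘(ℝ, E) 𝓘(ℝ, E) ∞ φ.symm (φ p) :=
      (contMDiffOn_extChartAt_symm p).contMDiffAt (extChartAt_target_mem_nhds p)
    exact (hf.contMDiffAt.comp _ h1).contDiffAt
  have hst : ∀ f : M → ℝ, ContMDiff 𝓘(ℝ, E) 𝓘(ℝ, ℝ) ∞ f →
      HasStrictFDerivAt (f ∘ φ.symm)
        ((differential E f (φ.symm (φ p))).comp (chartSymmDeriv p (φ p))) (φ p) := fun f hf =>
    (hsm f hf).hasStrictFDerivAt' (hasFDerivAt_comp_extChartAt_symm hz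
      (hf.mdifferentiableAt (by simp))) (by simp)
  have hF := (hst f₁ hf₁).prodMk (hst f₂ hf₂)
  obtain ⟨N, N', hN, hNV, hN', hcl, hpre, hne⟩ := exists_isPreconnected_of_hasStrictFDerivAt hF
    (by
      refine LinearMap.range_eq_top.2 ?_
      rintro ⟨a, b⟩
      rw [← hpp] at hs
      obtain ⟨v, hv₁, hv₂⟩ := hs a b
      obtain ⟨w, rfl⟩ := chartSymmDeriv_surjective hz v
      exact ⟨w, Prod.ext hv₁ hv₂⟩)
    (by simp [hpp, h₁, h₂]) (extChartAt_target_mem_nhds p)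
  have hcont : ContinuousOn φ.symm N := (continuousOn_extChartAt_symm p).mono hNV
  refine ⟨φ.symm '' N, φ.symm '' N', ?_, Set.image_mono hN', ?_, hpre.image _ (hcont.mono hN'), ?_⟩
  · filter_upwards [(continuousAt_extChartAt p).eventually hN,
      extChartAt_source_mem_nhds (I := 𝓘(ℝ, E)) p] with y hy hys
    exact ⟨φ y, hy, φ.left_inv hys⟩
  · rintro _ ⟨z, hz, rfl⟩
    exact ((hcont z hz).mono hN').mem_closure_image (hcl hz)
  · rintro _ ⟨z, hz, rfl⟩
    by_contra! h
    exact hne z hz (Prod.ext h.1 h.2)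

end Topology

/-! ### Density and connectedness of the regular set; the dichotomy for `M` -/

namespace KahlerStructure.IsSpecialKahlerPotential

variable {E : Type*} [NormedAddCommGroup E] [NormedSpace ℝ E] [FiniteDimensional ℝ E]
  {M : Type*} [TopologicalSpace M] [ChartedSpace E M] [IsManifold 𝓘(ℝ, E) ∞ M] [T2Space M]
  {K : KahlerStructure E M} {τ : M → ℝ} {x : M} (hτ : K.IsSpecialKahlerPotential τ)
include hτ

/-! ### The regular set -/

lemma isOpen_normSqGrad_ne_zero : IsOpen {x | K.normSqGrad τ x ≠ 0} :=
  isOpen_ne_fun hτ.smoothFn_normSqGrad.continuous continuous_const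

/-- At a critical point `X = 0`; if also `∇X = 0`, unique continuation gives `X = 0` everywhere, and
`τ` would be constant. -/
lemma leviCivita_Jgrad_ne_zero [ConnectedSpace M] (hx : K.normSqGrad τ x = 0) :
    leviCivita K.g (K.Jgrad τ) x ≠ 0 := by
  intro h
  have hgrad : grad K.g τ x = 0 := (inner_self_eq_zero_iff K.g).1 hx
  have hX : K.Jgrad τ x = 0 := by rw [Jgrad, hgrad, map_zero]
  have h0 := hτ.isKilling_killingField.eq_zero hX h
  have hd : ∀ y, differential E τ y = 0 := fun y => by
    rw [← K.normSqGrad_eq_zero_iff, ← K.inner_Jgrad_Jgrad, ← hτ.killingField_apply, h0 y]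
    simp
  have hlc : IsLocallyConstant τ := (IsLocallyConstant.iff_eventually_eq τ).2 fun y =>
    eventually_eq_of_differential_eq_zero
      (Filter.Eventually.of_forall fun z => ⟨SmoothFn.mdiffAt hτ.smooth z, hd z⟩)
  exact hτ.nonconstant ⟨τ x, fun y => hlc.apply_eq_of_preconnectedSpace y x⟩

lemma dense_normSqGrad_ne_zero [ConnectedSpace M] : Dense {x | K.normSqGrad τ x ≠ 0} := by
  intro p
  by_contra hp
  have h0 : ∀ᶠ y in 𝓝 p, K.normSqGrad τ y = 0 := by
    filter_upwards [isClosed_closure.isOpen_compl.mem_nhds hp] with y hy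
    by_contra h
    exact hy (subset_closure h)
  refine hτ.leviCivita_Jgrad_ne_zero h0.self_of_nhds ?_
  ext v
  refine (leviCivita_eq_of_eventually_smul K.g (Z := hτ.killingField) (W := hτ.killingField)
    (f := fun _ => 0) mdifferentiableAt_const ?_ v).trans ?_
  · filter_upwards [h0] with y hy
    rw [zero_smul, ← inner_self_eq_zero_iff K.g]
    exact K.inner_Jgrad_Jgrad.trans hy
  · rw [show differential E (fun _ : M => (0 : ℝ)) p = 0 from mvfderiv_const 0]
    simp

/-- At a critical point take `A` with value `Hv ≠ 0`. The pair `g(∇τ, A)`, `g(∇τ, JA)` vanishes on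
the critical set and is a submersion at the point, since `H` commutes with `J` and so maps `v, Jv`
to the orthogonal pair `A, JA`. -/
lemma exists_isPreconnected_inter [ConnectedSpace M] (p : M) :
    ∃ N ∈ 𝓝 p, IsPreconnected (N ∩ {x | K.normSqGrad τ x ≠ 0}) := by
  by_cases hp : K.normSqGrad τ p = 0
  · have hgrad : grad K.g τ p = 0 := (inner_self_eq_zero_iff K.g).1 hp
    obtain ⟨v, hv⟩ : ∃ v, hessEnd K.g τ p v ≠ 0 := by
      by_contra! h
      refine hτ.leviCivita_Jgrad_ne_zero hp ?_
      ext v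
      rw [hτ.leviCivita_Jgrad, h, map_zero]
      rfl
    obtain ⟨A, hA⟩ := exists_sec_apply_eq p (hessEnd K.g τ p v)
    have hpos : K.g.inner p (A p) (A p) ≠ 0 := fun h => hv (by
      rw [← hA, (inner_self_eq_zero_iff K.g).1 h])
    have hder : ∀ (B : Sec E M) (w : TangentSpace 𝓘(ℝ, E) p),
        differential E (fun y => K.g.inner y (hτ.gradField y) (B y)) p w
          = K.g.inner p (hessEnd K.g τ p w) (B p) := by
      intro B w
      obtain ⟨W, rfl⟩ := exists_sec_apply_eq p w
      rw [differential_inner, hτ.gradField_apply, hgrad, map_zero, zero_apply, add_zero]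
      rfl
    obtain ⟨N, N', hN, hN', hcl, hpre, hne⟩ := exists_isPreconnected_of_surjective (p := p)
      (smoothFn_inner K.g hτ.gradField A) (smoothFn_inner K.g hτ.gradField (K.Jsec A))
      (by simp [hgrad]) (by simp [hgrad]) (fun a b => by
        refine ⟨(a / K.g.inner p (A p) (A p)) • v + (b / K.g.inner p (A p) (A p)) • K.J p v, ?_⟩
        have h1 : K.g.inner p (A p) (K.J p (A p)) = 0 := K.inner_J_self _
        have h2 : K.g.inner p (K.J p (A p)) (A p) = 0 := by rw [K.g.symm, h1]
        rw [hder, hder, map_add, map_smul, map_smul, hτ.hessEnd_J, ← hA]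
        simp [h1, h2, K.J_orthogonal, hpos])
    -- The part of `U` in `N` lies between the preconnected `N'` and its closure, and is therefore
    -- preconnected.
    refine ⟨N, hN, hpre.subset_closure (fun y hy => ⟨hN' hy, fun h => ?_⟩)
      (Set.inter_subset_left.trans hcl)⟩
    have hg : grad K.g τ y = 0 := (inner_self_eq_zero_iff K.g).1 h
    rcases hne y hy with h1 | h1 <;> simp [hg] at h1
  · have := ChartedSpace.locallyConnectedSpace E M
    obtain ⟨N, hNU, hNo, hpN, hN⟩ := locallyConnectedSpace_iff_subsets_isOpen_isConnected.1 this p _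
      (hτ.isOpen_normSqGrad_ne_zero.mem_nhds hp)
    refine ⟨N, hNo.mem_nhds hpN, ?_⟩
    rw [Set.inter_eq_left.2 hNU]
    exact hN.isPreconnected

lemma isPreconnected_normSqGrad_ne_zero [ConnectedSpace M] :
    IsPreconnected {x | K.normSqGrad τ x ≠ 0} :=
  isPreconnected_of_dense hτ.dense_normSqGrad_ne_zero hτ.exists_isPreconnected_inter

/-! ### Integration of the equation for the horizontal eigenvalue function -/

/-- The equation `dM = (2(Λ - M)/Q) M dτ` is treated as linear in `M` with a known continuous
coefficient, so unique continuation applies. -/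
lemma eventually_eigH_eq_zero (hdim : 6 ≤ Module.finrank ℝ E) (hx : K.normSqGrad τ x ≠ 0)
    (h : K.eigH τ x = 0) : ∀ᶠ y in 𝓝 x, K.eigH τ y = 0 := by
  obtain ⟨F⟩ := nonempty_cutoffFrame (Module.finBasis ℝ E) x
  have key := F.eventually_eq_zero (κ := Unit) (fun _ => K.eigH τ) ?_
    (fun i _ _ y => 2 * (K.eigV τ y - K.eigH τ y) / K.normSqGrad τ y
      * differential E τ y (F.e i y)) ?_ ?_ (fun _ => h)
  · filter_upwards [key] with y hy
    exact hy ()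
  · filter_upwards [hτ.eventually_normSqGrad_ne_zero hx] with y hy _
    exact (hτ.contMDiffAt_eigH hy).mdifferentiableAt (by simp)
  · intro i _ _
    exact ((((hτ.contMDiffAt_eigV hx).continuousAt.sub
      (hτ.contMDiffAt_eigH hx).continuousAt).const_mul 2).div
        hτ.smoothFn_normSqGrad.continuous.continuousAt hx).mul
      (smoothFn_differential hτ.smooth (F.e i)).continuous.continuousAt
  · filter_upwards [hτ.eventually_normSqGrad_ne_zero hx] with y hy i _
    have := congrArg (fun α => α (F.e i y)) (hτ.normSqGrad_smul_differential_eigH hdim hy)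
    simp only [smul_apply, smul_eq_mul] at this
    simp only [Finset.univ_unique, Finset.sum_singleton]
    field_simp
    linarith

lemma differential_potential_eq_zero (hdim : 6 ≤ Module.finrank ℝ E)
    (hx : K.normSqGrad τ x ≠ 0) (h : K.eigH τ x ≠ 0) :
    MDiffAt (fun y => K.normSqGrad τ y / K.eigH τ y - 2 * τ y) x ∧
      differential E (fun y => K.normSqGrad τ y / K.eigH τ y - 2 * τ y) x = 0 := by
  set G : M → ℝ := fun y => K.normSqGrad τ y / K.eigH τ y - 2 * τ y with hG
  have hτd := SmoothFn.mdiffAt hτ.smooth x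
  have hHd := (hτ.contMDiffAt_eigH hx).mdifferentiableAt (n := ∞) (by simp)
  have hGd : MDiffAt G x := by
    have h1 : ContMDiffAt 𝓘(ℝ, E) 𝓘(ℝ, ℝ) ∞ G x :=
      (hτ.smoothFn_normSqGrad.contMDiffAt.div₀ (hτ.contMDiffAt_eigH hx) h).sub
        ((contMDiffAt_const (c := (2 : ℝ))).mul hτ.smooth.contMDiffAt)
    exact h1.mdifferentiableAt (by simp)
  refine ⟨hGd, ?_⟩
  have h2 : MDiffAt (fun _ : M => (2 : ℝ)) x := mdifferentiableAt_const
  -- With `G = Q/M - 2τ`, the product form `Q = M(G + 2τ)` is differentiated instead of the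
  -- quotient; the equations for `dQ` and `dM` then leave `M dG = 0`.
  have hQ : differential E (K.normSqGrad τ) x
      = differential E (K.eigH τ * (G + (fun _ => (2 : ℝ)) * τ)) x := by
    refine differential_congr ?_
    filter_upwards [(hτ.contMDiffAt_eigH hx).continuousAt.eventually_ne h] with y hy
    simp [hG]
    field_simp
  have e : differential E (K.eigH τ * (G + (fun _ => (2 : ℝ)) * τ)) x
      = K.eigH τ x • (differential E G x + (2 : ℝ) • differential E τ x)
        + (K.normSqGrad τ x / K.eigH τ x) • differential E (K.eigH τ) x := by
    have e1 := mvfderiv_mul (I := 𝓘(ℝ, E)) hHd (hGd.add (h2.mul hτd))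
    rw [mvfderiv_add hGd (h2.mul hτd), mvfderiv_mul h2 hτd, mvfderiv_const, smul_zero,
      add_zero] at e1
    refine e1.trans ?_
    simp [hG]
  rw [hτ.differential_normSqGrad hdim hx, e] at hQ
  ext v
  have h3 := congrArg (fun α => α v) hQ
  have h4 := congrArg (fun α => α v) (hτ.normSqGrad_smul_differential_eigH hdim hx)
  simp only [add_apply, smul_apply, smul_eq_mul, zero_apply] at h3 h4 ⊢
  apply (mul_eq_zero.1 _).resolve_left h
  field_simp at h3
  apply (mul_eq_zero.1 _).resolve_left h
  linear_combination -h3 - h4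

lemma eigH_eq_zero_or [ConnectedSpace M] (hdim : 6 ≤ Module.finrank ℝ E) :
    (∀ x, K.normSqGrad τ x ≠ 0 → K.eigH τ x = 0) ∨
      ∃ c : ℝ, ∀ x, K.normSqGrad τ x ≠ 0 →
        K.eigH τ x ≠ 0 ∧ K.normSqGrad τ x / K.eigH τ x = 2 * (τ x - c) := by
  have hpre := hτ.isPreconnected_normSqGrad_ne_zero
  -- A level set that is open in `U` is also closed in `U` by continuity, so it is empty or all of
  -- the connected set `U`.
  have hprop : ∀ f : M → ℝ, ContinuousOn f {x | K.normSqGrad τ x ≠ 0} → ∀ a : ℝ,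
      (∀ x, K.normSqGrad τ x ≠ 0 → f x = a → ∀ᶠ y in 𝓝 x, f y = a) →
      ∀ x, K.normSqGrad τ x ≠ 0 → f x = a → ∀ y, K.normSqGrad τ y ≠ 0 → f y = a := by
    intro f hf a hloc x hx hfx y hy
    have hopen : IsOpen {z | K.normSqGrad τ z ≠ 0 ∧ f z = a} := by
      rw [isOpen_iff_mem_nhds]
      rintro z ⟨hz, hfz⟩
      exact (hτ.eventually_normSqGrad_ne_zero hz).and (hloc z hz hfz)
    refine (hpre.subset_of_closure_inter_subset hopen ⟨x, hx, hx, hfx⟩ ?_ hy).2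
    rintro z ⟨hz, hzU⟩
    refine ⟨hzU, ?_⟩
    have hfz := hf.continuousAt (hτ.isOpen_normSqGrad_ne_zero.mem_nhds hzU)
    by_contra hne
    obtain ⟨w, hw, -, hw'⟩ := mem_closure_iff_nhds.1 hz _ (hfz.eventually_ne hne)
    exact hw hw'
  by_cases hex : ∃ x, K.normSqGrad τ x ≠ 0 ∧ K.eigH τ x = 0
  · obtain ⟨x, hx, hx0⟩ := hex
    exact Or.inl (hprop _ (fun y hy => (hτ.contMDiffAt_eigH hy).continuousAt.continuousWithinAt) 0
      (fun y hy h => hτ.eventually_eigH_eq_zero hdim hy h) x hx hx0)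
  · push Not at hex
    obtain ⟨x, hx⟩ := hτ.dense_normSqGrad_ne_zero.nonempty
    have h := hprop (fun y => K.normSqGrad τ y / K.eigH τ y - 2 * τ y)
      (fun y hy => (hτ.differential_potential_eq_zero hdim hy
        (hex y hy)).1.continuousAt.continuousWithinAt)
      (K.normSqGrad τ x / K.eigH τ x - 2 * τ x)
      (fun y hy hyx => by
        rw [← hyx]
        refine eventually_eq_of_differential_eq_zero (E := E) ?_
        filter_upwards [hτ.eventually_normSqGrad_ne_zero hy] with z hz
        exact hτ.differential_potential_eq_zero hdim hz (hex z hz)) x hx rfl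
    -- The constant value of `Q/M - 2τ` is `-2c`.
    refine Or.inr ⟨-(K.normSqGrad τ x / K.eigH τ x - 2 * τ x) / 2, fun y hy => ⟨hex y hy, ?_⟩⟩
    have := h y hy
    linarith

end KahlerStructure.IsSpecialKahlerPotential

end KahlerGeometry

end

/-! ### Assembly of the theorem -/

theorem theorem3p3
    {E : Type*} [NormedAddCommGroup E] [NormedSpace ℝ E] [FiniteDimensional ℝ E]
    {M : Type*} [TopologicalSpace M] [ChartedSpace E M] [IsManifold 𝓘(ℝ, E) ∞ M]
    [T2Space M] [SecondCountableTopology M] [ConnectedSpace M]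
    (hdim : 6 ≤ Module.finrank ℝ E)
    (K : KahlerGeometry.KahlerStructure E M) (τ : M → ℝ)
    (hτ : K.IsSpecialKahlerPotential τ)
    (X : KahlerGeometry.VField E M) (hX : X = K.Jgrad τ)
    (hol : K.IsHolomorphicField X)
    (T S : KahlerGeometry.EndField E M)
    (hT : T = KahlerGeometry.leviCivita K.g X) (hS : S = KahlerGeometry.ricciEnd K.g)
    (U : Set M) (hU : U = K.regularSet τ)
    (Q : M → ℝ) (hQ : Q = K.normSqGrad τ)
    (ψ : KahlerGeometry.OneForm E M) (hψ : ∀ x, ψ x = K.g.inner x (X x)) :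
    ∃ lam Lam Mu : M → ℝ,
      ContMDiffOn 𝓘(ℝ, E) 𝓘(ℝ, ℝ) ∞ lam U ∧
      ContMDiffOn 𝓘(ℝ, E) 𝓘(ℝ, ℝ) ∞ Lam U ∧
      ContMDiffOn 𝓘(ℝ, E) 𝓘(ℝ, ℝ) ∞ Mu U ∧
      -- `J ∘ T` is `-Λ` on `𝒱` and `-M` on `ℋ`
      (∀ x ∈ U, ∀ v ∈ K.vertical τ x, K.J x (T x v) = -(Lam x • v)) ∧
      (∀ x ∈ U, ∀ v ∈ K.horizontal τ x, K.J x (T x v) = -(Mu x • v)) ∧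
      -- (a)
      (∀ x ∈ U, S x (X x) = lam x • X x) ∧
      (∀ x ∈ U, KahlerGeometry.differential E (KahlerGeometry.laplacian K.g τ) x
        = (2 * lam x) • KahlerGeometry.differential E τ x) ∧
      -- (b)
      (∀ x, (S x).comp (T x) = (T x).comp (S x)) ∧
      (∀ x w, KahlerGeometry.covDerivEnd K.g S x (X x) w = 0) ∧
      -- (c)
      (∀ x ∈ U, KahlerGeometry.differential E Q x
        = (2 * Lam x) • KahlerGeometry.differential E τ x) ∧
      -- `ψ = d^c τ`, its exterior derivative and its Hodge Laplacian
      ψ = K.dc τ ∧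
      (∀ x v w, KahlerGeometry.extDerivOneForm ψ x v w = 2 * K.g.inner x (T x v) w) ∧
      (∀ x w, KahlerGeometry.hodgeLaplacian K.g ψ x w
        = 2 * KahlerGeometry.ricci K.g x (X x) w) ∧
      (∀ x ∈ U, ∀ w, KahlerGeometry.hodgeLaplacian K.g ψ x w = 2 * lam x * ψ x w) ∧
      (∀ x ∈ U, ∀ v w, KahlerGeometry.extDerivOneForm (K.dc τ) x v w
        = 2 * Lam x * K.omegaV τ x v w + 2 * Mu x * K.omegaH τ x v w) ∧
      -- the equations for the eigenvalue function `M`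
      (∀ x ∈ U, Q x • KahlerGeometry.differential E Mu x
        = (2 * Mu x * (Lam x - Mu x)) • KahlerGeometry.differential E τ x) ∧
      ((∀ x ∈ U, Mu x = 0) ∨
        ∃ c : ℝ, ∀ x ∈ U, Mu x ≠ 0 ∧ Q x / Mu x = 2 * (τ x - c)) := by
  subst hX hT hS hU hQ
  have hU : ∀ {x}, x ∈ K.regularSet τ → K.normSqGrad τ x ≠ 0 := fun {x} hx h =>
    hx (K.normSqGrad_eq_zero_iff.1 h)
  have hd := hτ.dense_normSqGrad_ne_zero
  have hX := hτ.isKilling_killingField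
  have hψ' : ψ = K.dc τ := funext fun x => (hψ x).trans (K.dc_apply x).symm
  -- `λ` and `Λ` are the Rayleigh quotients at `∇τ` of the Ricci tensor and the Hessian; `M` is what
  -- remains of the Hessian trace after removing `2Λ`, divided by `2n - 2`.
  refine ⟨K.eigRic τ, K.eigV τ, K.eigH τ,
    fun x hx => (hτ.contMDiffAt_eigRic (hU hx)).contMDiffWithinAt,
    fun x hx => (hτ.contMDiffAt_eigV (hU hx)).contMDiffWithinAt,
    fun x hx => (hτ.contMDiffAt_eigH (hU hx)).contMDiffWithinAt, ?_, ?_,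
    fun x hx => hτ.ricciEnd_Jgrad hdim (hU hx),
    fun x hx => hτ.differential_laplacian_eq_smul hdim (hU hx), ?_,
    fun x w => hτ.covDerivEnd_ricciEnd_Jgrad hdim hd w,
    fun x hx => hτ.differential_normSqGrad hdim (hU hx), hψ', ?_, ?_, ?_, ?_,
    fun x hx => hτ.normSqGrad_smul_differential_eigH hdim (hU hx), ?_⟩
  · intro x hx v hv
    rw [hτ.leviCivita_Jgrad_vertical hdim (hU hx) hv, map_smul, K.J_sq, smul_neg]
  · intro x hx v hv
    rw [hτ.leviCivita_Jgrad_horizontal hdim (hU hx) ((K.mem_horizontal_iff v).1 hv), map_smul,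
      K.J_sq, smul_neg]
  · intro x
    ext1 v
    exact hτ.ricciEnd_leviCivita hdim hd v
  · exact hX.extDerivOneForm_eq hψ
  · exact hX.hodgeLaplacian_eq hψ
  · intro x hx w
    rw [hX.hodgeLaplacian_eq hψ, ← KahlerGeometry.inner_ricciEnd, hψ]
    change 2 * K.g.inner x (KahlerGeometry.ricciEnd K.g x (K.Jgrad τ x)) w = _
    rw [hτ.ricciEnd_Jgrad hdim (hU hx), map_smul, smul_apply, smul_eq_mul, mul_assoc]
  · intro x hx v w
    rw [← hψ', hX.extDerivOneForm_eq hψ x v w]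
    have h := hτ.inner_leviCivita_eq_omega hdim (hU hx) v w
    change 2 * K.g.inner x (KahlerGeometry.leviCivita K.g (K.Jgrad τ) x v) w = _
    rw [h]
    ring
  · rcases hτ.eigH_eq_zero_or hdim with h | ⟨c, h⟩
    · exact Or.inl fun x hx => h x (hU hx)
    · exact Or.inr ⟨c, fun x hx => h x (hU hx)⟩
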